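/- Let $(X,\mu)$ be a measure space, $L^p=L^p(X,\mu;\mathbb C)$, and let $H$ be a complex Hilbert space. For each $t\in\mathbb R$ let $U(t):H\to L^2$ and $V(t):L^2\to H$ be linear operators, such that $U(\cdot)f$, $U^*(\cdot)g$, $V(\cdot)g$, $V^*(\cdot)f$ are strongly measurable for all $f\in H$, $g\in L^2$. Let $\sigma>1$ and suppose that for some constant $C$ and all real $s\ne t$ $$\|U(t)f\|_{L^2}\le C\|f\|_H\ (f\in H),\qquad \|V(t)g\|_H\le C\|g\|_{L^2}\ (g\in L^2),$$ $$\max\big\{\|U(s)V(t)g\|_\infty,\ \|U(s)U^*(t)g\|_\infty,\ \|V^*(s)V(t)g\|_\infty\big\}\le C|t-s|^{-\sigma}\|g\|_1\quad (g\in L^1\cap L^2).$$ Call $(q,r)\in[2,\infty]^2$ sharp $\sigma$-admissible if $\frac1q+\frac\sigma r=\frac\sigma2$, let $\frac1{q'}+\frac1q=1$, and write $L^q_tL^r_x=L^q(\mathbb R;L^r(X,\mu))$. Then for all sharp $\sigma$-admissible pairs $(q,r)$, $(\tilde q,\tilde r)$, the endpoint $(2,\frac{2\sigma}{\sigma-1})$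 included, there is a constant $K$, depending only on $\sigma$, $C$ and the exponents, such that the Strichartz estimates hold for $U$, $$\|U(t)f\|_{L^q_tL^r_x}\le K\|f\|_H,\quad \Big\|\int U^*(s)F(s)\,ds\Big\|_H\le K\|F\|_{L^{q'}_tL^{r'}_x},\quad \Big\|\int_{s<t}U(t)U^*(s)F(s)\,ds\Big\|_{L^q_tL^r_x}\le K\|F\|_{L^{\tilde q'}_tL^{\tilde r'}_x},$$ the same three estimates hold for $V$, that is, with $V^*(t)$ in place of $U(t)$ and $V(s)$ in place of $U^*(s)$, and moreover $$\Big\|\int_{s<t}U(t)V(s)F(s)\,ds\Big\|_{L^q_tL^r_x}\le K\|F\|_{L^{\tilde q'}_tL^{\tilde r'}_x}.$$ Here the integral operators are bounded operators defined on the whole of the indicated mixed Lebesgue spaces, which are given by the absolutely convergent Bochner integrals (in $H$, respectively in $L^2$ for almost every such $t$) whenever $F(s)\in L^2$ for almost all $s$ and these integrals converge absolutely. -/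

import Mathlib

open MeasureTheory Set
open scoped ENNReal

/-- Sharp `σ`-admissible pairs: `q, r ≥ 2` (the value `∞` is allowed) and
`1 / q + σ / r = σ / 2`, where `1 / ∞ = 0`. -/
def SharpAdmissible (σ : ℝ) (q r : ℝ≥0∞) : Prop :=
  2 ≤ q ∧ 2 ≤ r ∧ (q⁻¹).toReal + σ * (r⁻¹).toReal = σ / 2

section Strichartz

variable {X : Type*} [MeasurableSpace X] {μ : Measure X}
variable {H : Type*} [NormedAddCommGroup H] [InnerProductSpace ℂ H]

/-- The dispersive bound `‖A(s,t) f‖_∞ ≤ C |t - s|^{-σ} ‖f‖_1` for `s ≠ t`, for a family of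
operators on `L²` (tested on `L¹ ∩ L²`, which is dense in `L¹`). -/
def DispersiveBound (C σ : ℝ) (A : ℝ → ℝ → Lp ℂ 2 μ →L[ℂ] Lp ℂ 2 μ) : Prop :=
  ∀ s t : ℝ, s ≠ t → ∀ f : Lp ℂ 2 μ, MemLp f 1 μ →
    eLpNorm (A s t f) ∞ μ ≤ ENNReal.ofReal (C * |t - s| ^ (-σ)) * eLpNorm f 1 μ

/-- The mixed Lebesgue space `L^q_t L^r_x = L^q(ℝ; L^r(X, μ))`. -/
abbrev MixedLp (μ : Measure X) (q r : ℝ≥0∞) [Fact (1 ≤ r)] : Type _ :=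
  Lp (Lp ℂ r μ) q (volume : Measure ℝ)

/-- `‖A(t) f‖_{L^q_t L^r_x} ≤ C ‖f‖_H`: for every `f`, the function `t ↦ A(t) f` is (represented
by) an element of `L^q_t L^r_x` whose norm is at most `C ‖f‖`. -/
def HomogeneousStrichartz (A : ℝ → H →L[ℂ] Lp ℂ 2 μ) (q r : ℝ≥0∞)
    [Fact (1 ≤ r)] (C : ℝ) : Prop :=
  ∀ f : H, ∃ u : MixedLp μ q r, (∀ᵐ t : ℝ, (u t : X → ℂ) =ᵐ[μ] A t f) ∧ ‖u‖ ≤ C * ‖f‖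

/-- `‖∫ B(s) F(s) ds‖_H ≤ C ‖F‖_{L^p_t L^k_x}` for all `F ∈ L^p_t L^k_x`. The left-hand side is a
bounded operator on the whole of `L^p_t L^k_x`; it is the Bochner integral in `H` whenever
`F(s) ∈ L²` for almost all `s` and this integral converges absolutely. -/
def DualStrichartz (B : ℝ → Lp ℂ 2 μ →L[ℂ] H) (p k : ℝ≥0∞)
    [Fact (1 ≤ p)] [Fact (1 ≤ k)] (C : ℝ) : Prop :=
  ∃ T : MixedLp μ p k →L[ℂ] H,
    (∀ F : MixedLp μ p k, ∀ G : ℝ → Lp ℂ 2 μ,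
      (∀ᵐ s : ℝ, (F s : X → ℂ) =ᵐ[μ] G s) →
      Integrable (fun s : ℝ => B s (G s)) → T F = ∫ s : ℝ, B s (G s)) ∧
    ∀ F : MixedLp μ p k, ‖T F‖ ≤ C * ‖F‖

/-- `‖∫_{s<t} A(t) B(s) F(s) ds‖_{L^q_t L^r_x} ≤ C ‖F‖_{L^p_t L^k_x}` for all
`F ∈ L^p_t L^k_x`. The retarded integral is a bounded operator on the whole of `L^p_t L^k_x`; if
`F(s) ∈ L²` for almost all `s`, then at almost every time `t` at which the Bochner integral in
`L²` converges absolutely, it is this integral. -/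
def RetardedStrichartz (A : ℝ → H →L[ℂ] Lp ℂ 2 μ) (B : ℝ → Lp ℂ 2 μ →L[ℂ] H)
    (q r p k : ℝ≥0∞) [Fact (1 ≤ q)] [Fact (1 ≤ r)] [Fact (1 ≤ p)] [Fact (1 ≤ k)]
    (C : ℝ) : Prop :=
  ∃ T : MixedLp μ p k →L[ℂ] MixedLp μ q r,
    (∀ F : MixedLp μ p k, ∀ G : ℝ → Lp ℂ 2 μ,
      (∀ᵐ s : ℝ, (F s : X → ℂ) =ᵐ[μ] G s) →
      ∀ᵐ t : ℝ, IntegrableOn (fun s : ℝ => A t (B s (G s))) (Iio t) →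
        (T F t : X → ℂ) =ᵐ[μ] (∫ s in Iio t, A t (B s (G s)) : Lp ℂ 2 μ)) ∧
    ∀ F : MixedLp μ p k, ‖T F‖ ≤ C * ‖F‖

end Strichartz

section Layers

theorem ENNReal.mul_le_sq_add_sq (a b : ℝ≥0∞) : a * b ≤ a ^ 2 + b ^ 2 := by
  rcases le_total a b with h | h
  · calc a * b ≤ b * b := by gcongr
      _ = b ^ 2 := (sq b).symm
      _ ≤ _ := le_add_self
  · calc a * b ≤ a * a := by gcongr
      _ = a ^ 2 := (sq a).symm
      _ ≤ _ := le_self_add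

/-- Schur's test for a convolution kernel, in additive form. -/
theorem lintegral_convolution_mul_le {k c d : ℝ → ℝ≥0∞} (hk : Measurable k) (hc : AEMeasurable c)
    (hd : AEMeasurable d) :
    ∫⁻ t, ∫⁻ s, k (t - s) * (c t * d s) ≤
      (∫⁻ τ, k τ) * ((∫⁻ t, c t ^ 2) + ∫⁻ s, d s ^ 2) := by
  have hk2 : Measurable fun z : ℝ × ℝ => k (z.1 - z.2) := by fun_prop
  have h1 : ∫⁻ t, ∫⁻ s, k (t - s) * c t ^ 2 = (∫⁻ τ, k τ) * ∫⁻ t, c t ^ 2 := by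
    have : ∀ t, ∫⁻ s, k (t - s) * c t ^ 2 = (∫⁻ τ, k τ) * c t ^ 2 := fun t => by
      rw [lintegral_mul_const _ (by fun_prop), lintegral_sub_left_eq_self k t]
    simp_rw [this]
    rw [lintegral_const_mul'' _ (hc.pow_const 2)]
  have h2 : ∫⁻ t, ∫⁻ s, k (t - s) * d s ^ 2 = (∫⁻ τ, k τ) * ∫⁻ s, d s ^ 2 := by
    rw [lintegral_lintegral_swap]
    · have : ∀ s, ∫⁻ t, k (t - s) * d s ^ 2 = (∫⁻ τ, k τ) * d s ^ 2 := fun s => by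
        rw [lintegral_mul_const _ (by fun_prop), lintegral_sub_right_eq_self k s]
      simp_rw [this]
      rw [lintegral_const_mul'' _ (hd.pow_const 2)]
    · exact hk2.aemeasurable.mul
        ((hd.pow_const 2).comp_quasiMeasurePreserving Measure.quasiMeasurePreserving_snd)
  calc ∫⁻ t, ∫⁻ s, k (t - s) * (c t * d s)
      ≤ ∫⁻ t, ∫⁻ s, (k (t - s) * c t ^ 2 + k (t - s) * d s ^ 2) := by
        gcongr with t s
        rw [← mul_add]
        gcongr
        exact ENNReal.mul_le_sq_add_sq _ _
    _ = ∫⁻ t, ((∫⁻ s, k (t - s) * c t ^ 2) + ∫⁻ s, k (t - s) * d s ^ 2) := by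
        congr 1; ext t
        rw [lintegral_add_left (by fun_prop)]
    _ = _ := by
        rw [lintegral_add_left', h1, h2, mul_add]
        have : ∀ t, ∫⁻ s, k (t - s) * c t ^ 2 = (∫⁻ τ, k τ) * c t ^ 2 := fun t => by
          rw [lintegral_mul_const _ (by fun_prop), lintegral_sub_left_eq_self k t]
        simp_rw [this]
        exact (hc.pow_const 2).const_mul _

theorem lintegral_rpow_neg_abs_ge {σ ρ : ℝ} (hσ : 1 < σ) (hρ : 0 < ρ) :
    ∫⁻ τ : ℝ in {τ | ρ ≤ |τ|}, ENNReal.ofReal (|τ| ^ (-σ)) ≤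
      ENNReal.ofReal (2 * (ρ ^ (1 - σ) / (σ - 1))) := by
  have hI : ∫⁻ τ : ℝ in Ioi ρ, ENNReal.ofReal (|τ| ^ (-σ)) =
      ENNReal.ofReal (ρ ^ (1 - σ) / (σ - 1)) := by
    have h0 : IntegrableOn (fun τ : ℝ => τ ^ (-σ)) (Ioi ρ) :=
      integrableOn_Ioi_rpow_of_lt (by linarith) hρ
    have h1 := integral_Ioi_rpow_of_lt (a := -σ) (by linarith) hρ
    have h2 : ∫⁻ τ : ℝ in Ioi ρ, ENNReal.ofReal (|τ| ^ (-σ)) =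
        ∫⁻ τ : ℝ in Ioi ρ, ENNReal.ofReal (τ ^ (-σ)) := by
      refine setLIntegral_congr_fun measurableSet_Ioi fun τ hτ => ?_
      rw [abs_of_pos (hρ.trans hτ)]
    rw [h2, ← ofReal_integral_eq_lintegral_ofReal h0, h1]
    · congr 1
      rw [show -σ + 1 = -(σ - 1) by ring, show 1 - σ = -(σ - 1) by ring, neg_div_neg_eq]
    · filter_upwards [ae_restrict_mem measurableSet_Ioi] with τ hτ
      exact Real.rpow_nonneg (hρ.trans hτ).le _
  have hJ : ∫⁻ τ : ℝ in Iio (-ρ), ENNReal.ofReal (|τ| ^ (-σ)) =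
      ENNReal.ofReal (ρ ^ (1 - σ) / (σ - 1)) := by
    rw [← hI, ← lintegral_indicator measurableSet_Iio, ← lintegral_indicator measurableSet_Ioi,
      ← lintegral_neg_eq_self]
    congr 1; ext τ
    by_cases h : ρ < τ
    · simp [indicator, h]
    · simp [indicator, h]
  have hsub : {τ : ℝ | ρ ≤ |τ|} ⊆ (Ioi ρ ∪ Iio (-ρ)) ∪ {ρ, -ρ} := by
    intro τ hτ
    rw [mem_ofPred_eq, le_abs] at hτ
    simp only [mem_union, mem_Ioi, mem_Iio, mem_insert_iff, mem_singleton_iff]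
    rcases hτ with h | h
    · rcases h.lt_or_eq with h | h
      · tauto
      · right; left; exact h.symm
    · rcases h.lt_or_eq with h | h
      · left; right; linarith
      · right; right; linarith
  calc _ ≤ ∫⁻ τ : ℝ in (Ioi ρ ∪ Iio (-ρ)) ∪ {ρ, -ρ}, ENNReal.ofReal (|τ| ^ (-σ)) :=
        lintegral_mono_set hsub
    _ ≤ (∫⁻ τ : ℝ in (Ioi ρ ∪ Iio (-ρ)), ENNReal.ofReal (|τ| ^ (-σ))) +
        ∫⁻ τ : ℝ in {ρ, -ρ}, ENNReal.ofReal (|τ| ^ (-σ)) := lintegral_union_le _ _ _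
    _ = ∫⁻ τ : ℝ in (Ioi ρ ∪ Iio (-ρ)), ENNReal.ofReal (|τ| ^ (-σ)) := by
        rw [setLIntegral_measure_zero _ _ (Set.Finite.measure_zero (toFinite {ρ, -ρ}) _), add_zero]
    _ ≤ _ := lintegral_union_le _ _ _
    _ = _ := by
        have : 0 ≤ ρ ^ (1 - σ) / (σ - 1) := by
          have : 0 < σ - 1 := by linarith
          positivity
        rw [hI, hJ, ← ENNReal.ofReal_add this this]
        congr 1; ring

variable {H : Type*} [NormedAddCommGroup H] [InnerProductSpace ℂ H]

/-- A time dependent vector `a` which behaves like the image, under the adjoint of a dispersive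
evolution, of a function of height `x ^ (-(σ + 1))` at every time, with amplitude `c`. -/
structure IsLayer (σ x : ℝ) (c : ℝ → ℝ≥0∞) (a : ℝ → H) : Prop where
  integrable : Integrable a
  aemeasurable : AEMeasurable c
  enorm_le : ∀ t, ‖a t‖ₑ ≤ ENNReal.ofReal x⁻¹ * c t
  inner_le : ∀ s t, s ≠ t → ‖inner ℂ (a t) (a s)‖ₑ ≤
    ENNReal.ofReal (|t - s| ^ (-σ) * (x * x) ^ (σ - 1)) * (c t * c s)

theorem integrable_inner_prod {a b : ℝ → H} (ha : Integrable a) (hb : Integrable b) :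
    Integrable (fun z : ℝ × ℝ => inner ℂ (a z.1) (b z.2)) (volume.prod volume) :=
  ha.op_fst_snd (op := fun x y => inner ℂ x y) (by fun_prop)
    ⟨1, fun x y => by simpa using norm_inner_le_norm x y⟩ hb

theorem enorm_inner_le (x y : H) : ‖inner ℂ x y‖ₑ ≤ ‖x‖ₑ * ‖y‖ₑ := by
  rw [← ofReal_norm, ← ofReal_norm, ← ofReal_norm, ← ENNReal.ofReal_mul (norm_nonneg _)]
  exact ENNReal.ofReal_le_ofReal (norm_inner_le_norm x y)

theorem integral_prod_inner [CompleteSpace H] {a b : ℝ → H} (ha : Integrable a) (hb : Integrable b)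
    {W : Set (ℝ × ℝ)} (hW : MeasurableSet W) :
    ∫ z in W, inner ℂ (a z.1) (b z.2) ∂(volume.prod volume) =
      ∫ t, inner ℂ (a t) (∫ s in {s | (t, s) ∈ W}, b s) := by
  rw [← integral_indicator hW, integral_prod _ ((integrable_inner_prod ha hb).indicator hW)]
  congr 1; ext t
  have hm : MeasurableSet {s | (t, s) ∈ W} := measurable_prodMk_left hW
  rw [← integral_inner hb.integrableOn, ← integral_indicator hm]
  rfl

theorem integral_prod_inner_swap {a b : ℝ → H} (W : Set (ℝ × ℝ)) :
    ‖∫ z in W, inner ℂ (a z.1) (b z.2) ∂(volume.prod volume)‖ₑ =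
      ‖∫ z in Prod.swap ⁻¹' W, inner ℂ (b z.1) (a z.2) ∂(volume.prod volume)‖ₑ := by
  have h1 : ∫ z in Prod.swap ⁻¹' W, inner ℂ (a z.2) (b z.1) ∂((volume : Measure ℝ).prod
      (volume : Measure ℝ)) =
      ∫ z in W, inner ℂ (a z.1) (b z.2) ∂(volume.prod volume) :=
    (Measure.measurePreserving_swap (μ := (volume : Measure ℝ))
      (ν := (volume : Measure ℝ))).setIntegral_preimage_emb
      MeasurableEquiv.prodComm.measurableEmbedding (fun z => inner ℂ (a z.1) (b z.2)) W
  have h2 : ∫ z in Prod.swap ⁻¹' W, inner ℂ (b z.1) (a z.2) ∂((volume : Measure ℝ).prod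
      (volume : Measure ℝ)) = starRingEnd ℂ (∫ z in Prod.swap ⁻¹' W, inner ℂ (a z.2) (b z.1)
        ∂((volume : Measure ℝ).prod (volume : Measure ℝ))) := by
    rw [← integral_conj]
    simp
  rw [h2, h1, ← ofReal_norm, ← ofReal_norm, RCLike.norm_conj]

theorem enorm_setIntegral_prod_le {f : ℝ × ℝ → ℂ} {W : Set (ℝ × ℝ)} (hW : MeasurableSet W) :
    ‖∫ z in W, f z ∂(volume.prod volume)‖ₑ ≤
      ∫⁻ t, ∫⁻ s, W.indicator (fun z => ‖f z‖ₑ) (t, s) := by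
  calc _ ≤ ∫⁻ z in W, ‖f z‖ₑ ∂((volume : Measure ℝ).prod (volume : Measure ℝ)) :=
        enorm_integral_le_lintegral_enorm _
    _ = ∫⁻ z, W.indicator (fun z => ‖f z‖ₑ) z ∂((volume : Measure ℝ).prod (volume : Measure ℝ)) :=
        (lintegral_indicator hW _).symm
    _ ≤ _ := lintegral_prod_le _

/-- Two layers interact weakly far away from the diagonal. -/
theorem enorm_integral_inner_far_le {σ : ℝ} (hσ : 1 < σ) {x y ρ : ℝ} (hx : 0 < x) (hy : 0 < y)
    (hρ : 0 < ρ) {c d : ℝ → ℝ≥0∞} {a b : ℝ → H} (hc : AEMeasurable c) (hd : AEMeasurable d)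
    (hab : ∀ s t, s ≠ t → ‖inner ℂ (a t) (b s)‖ₑ ≤
      ENNReal.ofReal (|t - s| ^ (-σ) * (x * y) ^ (σ - 1)) * (c t * d s))
    {W : Set (ℝ × ℝ)} (hW : MeasurableSet W) (hWρ : ∀ z ∈ W, ρ ≤ |z.1 - z.2|) :
    ‖∫ z in W, inner ℂ (a z.1) (b z.2) ∂(volume.prod volume)‖ₑ ≤
      ENNReal.ofReal (2 / (σ - 1) * (x * y / ρ) ^ (σ - 1)) *
        ((∫⁻ t, c t ^ 2) + ∫⁻ s, d s ^ 2) := by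
  have hS : MeasurableSet {τ : ℝ | ρ ≤ |τ|} := measurableSet_le measurable_const (by fun_prop)
  set k : ℝ → ℝ≥0∞ := {τ : ℝ | ρ ≤ |τ|}.indicator
    fun τ => ENNReal.ofReal (|τ| ^ (-σ)) * ENNReal.ofReal ((x * y) ^ (σ - 1)) with hk
  have hkm : Measurable k := Measurable.indicator (by fun_prop) hS
  refine (enorm_setIntegral_prod_le hW).trans ?_
  have hle : ∀ t s, W.indicator (fun z => ‖inner ℂ (a z.1) (b z.2)‖ₑ) (t, s) ≤
      k (t - s) * (c t * d s) := by
    intro t s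
    by_cases hz : (t, s) ∈ W
    · have h1 := hWρ _ hz
      have h2 : s ≠ t := by
        rintro rfl
        simp only [sub_self, abs_zero] at h1
        linarith
      rw [indicator_of_mem hz, hk, indicator_of_mem (by exact h1), ← ENNReal.ofReal_mul
        (by positivity)]
      exact hab s t h2
    · simp [indicator_of_notMem hz]
  calc _ ≤ ∫⁻ t, ∫⁻ s, k (t - s) * (c t * d s) := by gcongr with t s; exact hle t s
    _ ≤ (∫⁻ τ, k τ) * ((∫⁻ t, c t ^ 2) + ∫⁻ s, d s ^ 2) :=
        lintegral_convolution_mul_le hkm hc hd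
    _ ≤ _ := by
        gcongr
        rw [hk, lintegral_indicator hS, lintegral_mul_const _ (by fun_prop)]
        refine (mul_le_mul_left (lintegral_rpow_neg_abs_ge hσ hρ) _).trans ?_
        have h1 : 0 < σ - 1 := by linarith
        rw [← ENNReal.ofReal_mul (by positivity), Real.div_rpow (by positivity) hρ.le,
          show 1 - σ = -(σ - 1) by ring, Real.rpow_neg hρ.le]
        apply le_of_eq
        congr 1
        ring

/-- The time integral of a layer is controlled by the square integral of its amplitude. -/
theorem IsLayer.enorm_setIntegral_sq_le [CompleteSpace H] {σ : ℝ} (hσ : 1 < σ) {x : ℝ}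
    (hx : 0 < x) {c : ℝ → ℝ≥0∞} {a : ℝ → H} (h : IsLayer σ x c a) {E : Set ℝ}
    (hE : MeasurableSet E) :
    ‖∫ t in E, a t‖ₑ ^ 2 ≤ ENNReal.ofReal (4 + 4 / (σ - 1)) * ∫⁻ t in E, c t ^ 2 := by
  have hσ1 : 0 < σ - 1 := by linarith
  have hS : MeasurableSet {τ : ℝ | x * x ≤ |τ|} := measurableSet_le measurable_const (by fun_prop)
  set k₁ : ℝ → ℝ≥0∞ := {τ : ℝ | x * x ≤ |τ|}.indicator
    fun τ => ENNReal.ofReal (|τ| ^ (-σ)) * ENNReal.ofReal ((x * x) ^ (σ - 1)) with hk₁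
  set k₂ : ℝ → ℝ≥0∞ := {τ : ℝ | x * x ≤ |τ|}ᶜ.indicator
    fun _ => ENNReal.ofReal (x⁻¹ * x⁻¹) with hk₂
  have hk₁m : Measurable k₁ := Measurable.indicator (by fun_prop) hS
  have hk₂m : Measurable k₂ := Measurable.indicator (by fun_prop) hS.compl
  have hk₁i : ∫⁻ τ, k₁ τ ≤ ENNReal.ofReal (2 / (σ - 1)) := by
    rw [hk₁, lintegral_indicator hS, lintegral_mul_const _ (by fun_prop)]
    refine (mul_le_mul_left (lintegral_rpow_neg_abs_ge hσ (by positivity)) _).trans ?_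
    rw [← ENNReal.ofReal_mul (by positivity), show 1 - σ = -(σ - 1) by ring,
      Real.rpow_neg (by positivity)]
    apply le_of_eq
    congr 1
    have : (x * x) ^ (σ - 1) ≠ 0 := by positivity
    field_simp
  have hk₂i : ∫⁻ τ, k₂ τ ≤ ENNReal.ofReal 2 := by
    have : {τ : ℝ | x * x ≤ |τ|}ᶜ = Metric.ball 0 (x * x) := by
      ext τ; simp
    rw [hk₂, lintegral_indicator hS.compl, setLIntegral_const, this, Real.volume_ball,
      ← ENNReal.ofReal_mul (by positivity)]
    apply le_of_eq
    congr 1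
    field_simp
  have hle : ∀ t s, ‖inner ℂ (a t) (a s)‖ₑ ≤ (k₁ + k₂) (t - s) * (c t * c s) := by
    intro t s
    by_cases hz : x * x ≤ |t - s|
    · have h2 : s ≠ t := by
        rintro rfl
        simp only [sub_self, abs_zero] at hz
        have : 0 < x * x := by positivity
        linarith
      refine (h.inner_le s t h2).trans ?_
      rw [ENNReal.ofReal_mul (by positivity)]
      gcongr
      rw [Pi.add_apply, hk₁, indicator_of_mem (by exact hz)]
      exact le_self_add
    · calc ‖inner ℂ (a t) (a s)‖ₑ ≤ ‖a t‖ₑ * ‖a s‖ₑ := enorm_inner_le _ _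
        _ ≤ (ENNReal.ofReal x⁻¹ * c t) * (ENNReal.ofReal x⁻¹ * c s) := by
            gcongr
            · exact h.enorm_le t
            · exact h.enorm_le s
        _ = ENNReal.ofReal (x⁻¹ * x⁻¹) * (c t * c s) := by
            rw [ENNReal.ofReal_mul (by positivity)]; ring
        _ ≤ _ := by
            gcongr
            rw [Pi.add_apply, hk₂, indicator_of_mem (by exact hz)]
            exact le_add_self
  set v := ∫ t in E, a t with hv
  have hvv : ‖v‖ₑ ^ 2 = ‖inner ℂ v v‖ₑ := by
    rw [inner_self_eq_norm_sq_to_K, enorm_pow, ← ofReal_norm, ← ofReal_norm]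
    simp
  have h1 : ‖v‖ₑ ^ 2 ≤ ∫⁻ t in E, ∫⁻ s in E, ‖inner ℂ (a t) (a s)‖ₑ := by
    have h2 : ∀ u : H, ‖inner ℂ u v‖ₑ ≤ ∫⁻ s in E, ‖inner ℂ u (a s)‖ₑ := fun u => by
      rw [hv, ← integral_inner h.integrable.integrableOn]
      exact enorm_integral_le_lintegral_enorm _
    rw [hvv]
    refine (h2 v).trans ?_
    gcongr with t
    have : ‖inner ℂ v (a t)‖ₑ = ‖inner ℂ (a t) v‖ₑ := by
      rw [← ofReal_norm, ← ofReal_norm, norm_inner_symm]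
    rw [this]
    exact h2 _
  set e := E.indicator c with he
  have hem : AEMeasurable e := h.aemeasurable.indicator hE
  have h3 : ∫⁻ t, e t ^ 2 = ∫⁻ t in E, c t ^ 2 := by
    rw [← lintegral_indicator hE]
    congr 1; ext t
    by_cases ht : t ∈ E <;> simp [he, ht]
  calc ‖v‖ₑ ^ 2 ≤ ∫⁻ t in E, ∫⁻ s in E, ‖inner ℂ (a t) (a s)‖ₑ := h1
    _ = ∫⁻ t, ∫⁻ s, E.indicator (fun t => E.indicator (fun s => ‖inner ℂ (a t) (a s)‖ₑ) s) t := by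
        rw [← lintegral_indicator hE]
        congr 1; ext t
        by_cases ht : t ∈ E
        · simp [ht, lintegral_indicator hE]
        · simp [ht]
    _ ≤ ∫⁻ t, ∫⁻ s, (k₁ + k₂) (t - s) * (e t * e s) := by
        gcongr with t s
        by_cases ht : t ∈ E
        · by_cases hs : s ∈ E
          · simpa [he, ht, hs] using hle t s
          · simp [ht, hs]
        · simp [ht]
    _ ≤ (∫⁻ τ, (k₁ + k₂) τ) * ((∫⁻ t, e t ^ 2) + ∫⁻ s, e s ^ 2) :=
        lintegral_convolution_mul_le (hk₁m.add hk₂m) hem hem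
    _ ≤ ENNReal.ofReal (2 / (σ - 1) + 2) * ((∫⁻ t, e t ^ 2) + ∫⁻ s, e s ^ 2) := by
        gcongr
        simp only [Pi.add_apply]
        rw [lintegral_add_left hk₁m, ENNReal.ofReal_add (by positivity) (by positivity)]
        gcongr
    _ = _ := by
        rw [h3, ← two_mul, ← mul_assoc]
        congr 1
        rw [show (2 : ℝ≥0∞) = ENNReal.ofReal 2 by simp, ← ENNReal.ofReal_mul (by positivity)]
        congr 1
        ring

/-- The interaction of two layers close to the diagonal. -/
theorem enorm_integral_inner_near_le [CompleteSpace H] {σ : ℝ} (hσ : 1 < σ) {x y ρ : ℝ}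
    (hx : 0 < x) (hy : 0 < y) (hρ : 0 < ρ) {c d : ℝ → ℝ≥0∞} {a b : ℝ → H}
    (ha : IsLayer σ x c a) (hb : IsLayer σ y d b) {W : Set (ℝ × ℝ)} (hW : MeasurableSet W)
    (hWρ : ∀ z ∈ W, |z.1 - z.2| < ρ) :
    ‖∫ z in W, inner ℂ (a z.1) (b z.2) ∂(volume.prod volume)‖ₑ ≤
      ENNReal.ofReal ((9 + 8 / (σ - 1)) * (√ρ * x⁻¹)) *
        ((∫⁻ t, c t ^ 2) + ∫⁻ s, d s ^ 2) := by
  have hσ1 : 0 < σ - 1 := by linarith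
  set K := 4 + 4 / (σ - 1) with hK
  have hK0 : 0 < K := by positivity
  set k : ℝ → ℝ≥0∞ := (Metric.ball (0 : ℝ) ρ).indicator fun _ => 1 with hk
  have hkm : Measurable k := Measurable.indicator (by fun_prop) Metric.isOpen_ball.measurableSet
  set v : ℝ → H := fun t => ∫ s in {s | (t, s) ∈ W}, b s with hv
  have hvle : ∀ t, ‖v t‖ₑ ^ 2 ≤ ENNReal.ofReal K * ∫⁻ s, k (t - s) * d s ^ 2 := by
    intro t
    have hm : MeasurableSet {s | (t, s) ∈ W} := measurable_prodMk_left hW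
    refine (hb.enorm_setIntegral_sq_le hσ hy hm).trans ?_
    rw [← lintegral_indicator hm]
    gcongr with s
    by_cases hs : (t, s) ∈ W
    · have : t - s ∈ Metric.ball (0 : ℝ) ρ := by simpa using hWρ _ hs
      rw [indicator_of_mem (by exact hs), hk, indicator_of_mem this, one_mul]
    · rw [indicator_of_notMem (by exact hs)]
      exact zero_le
  have hconv : ∫⁻ t, ∫⁻ s, k (t - s) * d s ^ 2 = ENNReal.ofReal (2 * ρ) * ∫⁻ s, d s ^ 2 := by
    rw [lintegral_lintegral_swap]
    · have : ∀ s, ∫⁻ t, k (t - s) * d s ^ 2 = ENNReal.ofReal (2 * ρ) * d s ^ 2 := fun s => by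
        rw [lintegral_mul_const _ (by fun_prop), lintegral_sub_right_eq_self k s, hk,
          lintegral_indicator Metric.isOpen_ball.measurableSet, setLIntegral_const,
          Real.volume_ball, one_mul]
      simp_rw [this]
      rw [lintegral_const_mul'' _ (hb.aemeasurable.pow_const 2)]
    · exact (by fun_prop : Measurable fun z : ℝ × ℝ => k (z.1 - z.2)).aemeasurable.mul
        ((hb.aemeasurable.pow_const 2).comp_quasiMeasurePreserving
          Measure.quasiMeasurePreserving_snd)
  have hpt : ∀ t, ‖inner ℂ (a t) (v t)‖ₑ ≤ ENNReal.ofReal (√ρ * x⁻¹) *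
      (c t ^ 2 + ENNReal.ofReal (ρ⁻¹ * K) * ∫⁻ s, k (t - s) * d s ^ 2) := by
    intro t
    have hs : ENNReal.ofReal √ρ * ENNReal.ofReal (√ρ)⁻¹ = 1 := by
      rw [← ENNReal.ofReal_mul (by positivity), mul_inv_cancel₀ (by positivity),
        ENNReal.ofReal_one]
    calc ‖inner ℂ (a t) (v t)‖ₑ ≤ ‖a t‖ₑ * ‖v t‖ₑ := enorm_inner_le _ _
      _ ≤ (ENNReal.ofReal x⁻¹ * c t) * ‖v t‖ₑ := by gcongr; exact ha.enorm_le t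
      _ = (ENNReal.ofReal √ρ * ENNReal.ofReal (√ρ)⁻¹) * ((ENNReal.ofReal x⁻¹ * c t) * ‖v t‖ₑ) := by
          rw [hs, one_mul]
      _ = ENNReal.ofReal (√ρ * x⁻¹) * (c t * (ENNReal.ofReal (√ρ)⁻¹ * ‖v t‖ₑ)) := by
          rw [ENNReal.ofReal_mul (by positivity)]; ring
      _ ≤ ENNReal.ofReal (√ρ * x⁻¹) * (c t ^ 2 + (ENNReal.ofReal (√ρ)⁻¹ * ‖v t‖ₑ) ^ 2) := by
          gcongr
          exact ENNReal.mul_le_sq_add_sq _ _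
      _ ≤ _ := by
          gcongr
          rw [mul_pow, ← ENNReal.ofReal_pow (by positivity), inv_pow, Real.sq_sqrt hρ.le,
            ENNReal.ofReal_mul (by positivity), mul_assoc]
          gcongr
          exact hvle t
  rw [integral_prod_inner ha.integrable hb.integrable hW]
  calc ‖∫ t, inner ℂ (a t) (v t)‖ₑ ≤ ∫⁻ t, ‖inner ℂ (a t) (v t)‖ₑ :=
        enorm_integral_le_lintegral_enorm _
    _ ≤ ∫⁻ t, ENNReal.ofReal (√ρ * x⁻¹) *
      (c t ^ 2 + ENNReal.ofReal (ρ⁻¹ * K) * ∫⁻ s, k (t - s) * d s ^ 2) := by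
        gcongr with t; exact hpt t
    _ = ENNReal.ofReal (√ρ * x⁻¹) *
      ((∫⁻ t, c t ^ 2) + ENNReal.ofReal (ρ⁻¹ * K) * (ENNReal.ofReal (2 * ρ) * ∫⁻ s, d s ^ 2)) := by
        rw [lintegral_const_mul' _ _ ENNReal.ofReal_ne_top,
          lintegral_add_left' (ha.aemeasurable.pow_const 2),
          lintegral_const_mul' _ _ ENNReal.ofReal_ne_top, hconv]
    _ = ENNReal.ofReal (√ρ * x⁻¹) *
      ((∫⁻ t, c t ^ 2) + ENNReal.ofReal (2 * K) * ∫⁻ s, d s ^ 2) := by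
        rw [← mul_assoc (ENNReal.ofReal (ρ⁻¹ * K)), ← ENNReal.ofReal_mul (by positivity)]
        congr 4
        field_simp
    _ ≤ ENNReal.ofReal (√ρ * x⁻¹) * (ENNReal.ofReal (1 + 2 * K) *
        ((∫⁻ t, c t ^ 2) + ∫⁻ s, d s ^ 2)) := by
        rw [mul_add (ENNReal.ofReal (1 + 2 * K))]
        gcongr
        · exact le_mul_of_one_le_left' (by rw [← ENNReal.ofReal_one]; gcongr; linarith)
        · linarith
    _ = _ := by
        rw [← mul_assoc, ← ENNReal.ofReal_mul (by positivity), hK]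
        congr 2
        ring

theorem enorm_integral_inner_layers_le_of_le [CompleteSpace H] {σ : ℝ} (hσ : 1 < σ) {x y : ℝ}
    (hx : 0 < x) (hy : 0 < y) (hyx : y ≤ x) {c d : ℝ → ℝ≥0∞} {a b : ℝ → H}
    (ha : IsLayer σ x c a) (hb : IsLayer σ y d b)
    (hab : ∀ s t, s ≠ t → ‖inner ℂ (a t) (b s)‖ₑ ≤
      ENNReal.ofReal (|t - s| ^ (-σ) * (x * y) ^ (σ - 1)) * (c t * d s))
    {W : Set (ℝ × ℝ)} (hW : MeasurableSet W) :
    ‖∫ z in W, inner ℂ (a z.1) (b z.2) ∂(volume.prod volume)‖ₑ ≤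
      ENNReal.ofReal ((9 + 10 / (σ - 1)) * (y / x) ^ (min 1 (2 * (σ - 1)) / 4)) *
        ((∫⁻ t, c t ^ 2) + ∫⁻ s, d s ^ 2) := by
  have hσ1 : 0 < σ - 1 := by linarith
  set δ := min 1 (2 * (σ - 1)) with hδ
  set u := (y / x) ^ (1 / 4 : ℝ) with hu
  have hyx0 : 0 < y / x := by positivity
  have hu0 : 0 < u := by positivity
  have hu1 : u ≤ 1 := Real.rpow_le_one hyx0.le ((div_le_one hx).2 hyx) (by norm_num)
  have hyu : y = x * u ^ 4 := by
    rw [hu, ← Real.rpow_natCast, ← Real.rpow_mul hyx0.le]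
    norm_num
    field_simp
  set ρ := (x * u) ^ 2 with hρ
  have hρ0 : 0 < ρ := by positivity
  have hsqrt : √ρ * x⁻¹ = u := by
    rw [hρ, Real.sqrt_sq (by positivity)]; field_simp
  have hquot : x * y / ρ = u ^ 2 := by rw [hyu, hρ]; field_simp
  have huδ : (y / x) ^ (δ / 4) = u ^ δ := by
    rw [hu, ← Real.rpow_mul hyx0.le]; congr 1; ring
  have hle1 : u ≤ u ^ δ := by
    conv_lhs => rw [← Real.rpow_one u]
    exact Real.rpow_le_rpow_of_exponent_ge hu0 hu1 (min_le_left _ _)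
  have hle2 : (u ^ 2) ^ (σ - 1) ≤ u ^ δ := by
    rw [← Real.rpow_natCast u 2, ← Real.rpow_mul hu0.le]
    exact Real.rpow_le_rpow_of_exponent_ge hu0 hu1 (by push_cast; exact min_le_right _ _)
  set N := {z : ℝ × ℝ | |z.1 - z.2| < ρ} with hN
  have hNm : MeasurableSet N := measurableSet_lt (by fun_prop) measurable_const
  have hnear := enorm_integral_inner_near_le hσ hx hy hρ0 ha hb (hW.inter hNm) fun z hz => hz.2
  have hfar := enorm_integral_inner_far_le hσ hx hy hρ0 ha.aemeasurable hb.aemeasurable hab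
    (hW.diff hNm) fun z hz => not_lt.1 hz.2
  have hi := integrable_inner_prod ha.integrable hb.integrable
  rw [← integral_inter_add_sdiff hNm hi.integrableOn, huδ]
  refine (enorm_add_le _ _).trans ((add_le_add hnear hfar).trans ?_)
  rw [← add_mul, hsqrt, hquot, ← ENNReal.ofReal_add (by positivity) (by positivity)]
  gcongr
  calc (9 + 8 / (σ - 1)) * u + 2 / (σ - 1) * (u ^ 2) ^ (σ - 1)
      ≤ (9 + 8 / (σ - 1)) * u ^ δ + 2 / (σ - 1) * u ^ δ := by gcongr
    _ = _ := by ring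

/-- Layers at different scales are almost orthogonal. -/
theorem enorm_integral_inner_layers_le [CompleteSpace H] {σ : ℝ} (hσ : 1 < σ) {x y : ℝ}
    (hx : 0 < x) (hy : 0 < y) {c d : ℝ → ℝ≥0∞} {a b : ℝ → H}
    (ha : IsLayer σ x c a) (hb : IsLayer σ y d b)
    (hab : ∀ s t, s ≠ t → ‖inner ℂ (a t) (b s)‖ₑ ≤
      ENNReal.ofReal (|t - s| ^ (-σ) * (x * y) ^ (σ - 1)) * (c t * d s))
    {W : Set (ℝ × ℝ)} (hW : MeasurableSet W) :
    ‖∫ z in W, inner ℂ (a z.1) (b z.2) ∂(volume.prod volume)‖ₑ ≤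
      ENNReal.ofReal ((9 + 10 / (σ - 1)) * (min (y / x) (x / y)) ^ (min 1 (2 * (σ - 1)) / 4)) *
        ((∫⁻ t, c t ^ 2) + ∫⁻ s, d s ^ 2) := by
  rcases le_total y x with h | h
  · rw [min_eq_left (((div_le_one hx).2 h).trans ((one_le_div hy).2 h))]
    exact enorm_integral_inner_layers_le_of_le hσ hx hy h ha hb hab hW
  · rw [min_eq_right (((div_le_one hy).2 h).trans ((one_le_div hx).2 h)),
      integral_prod_inner_swap, add_comm (∫⁻ t, c t ^ 2)]
    refine enorm_integral_inner_layers_le_of_le hσ hy hx h hb ha (fun s t hst => ?_)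
      (hW.preimage measurable_swap)
    have : ‖inner ℂ (b t) (a s)‖ₑ = ‖inner ℂ (a s) (b t)‖ₑ := by
      rw [← ofReal_norm, ← ofReal_norm, norm_inner_symm]
    rw [this, abs_sub_comm, mul_comm y x, mul_comm (d t)]
    exact hab t s hst.symm

end Layers

section Truncation
open Filter Topology

/-- The radial retraction of the complex plane onto the disc of radius `|R|`. -/
noncomputable def radialTrunc (R : ℝ) (z : ℂ) : ℂ := (|R| / max |R| ‖z‖) • z

theorem norm_radialTrunc (R : ℝ) (z : ℂ) : ‖radialTrunc R z‖ = min |R| ‖z‖ := by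
  rw [radialTrunc, norm_smul, Real.norm_eq_abs, abs_of_nonneg (by positivity)]
  rcases le_total |R| ‖z‖ with h | h
  · rw [max_eq_right h, min_eq_left h]
    rcases eq_or_ne ‖z‖ 0 with h0 | h0
    · rw [h0] at h ⊢
      simpa using (le_antisymm h (abs_nonneg R)).symm
    · field_simp
  · rw [max_eq_left h, min_eq_right h]
    rcases eq_or_ne |R| 0 with h0 | h0
    · rw [h0] at h ⊢
      simpa using (le_antisymm h (norm_nonneg z)).symm
    · field_simp

theorem radialTrunc_zero (R : ℝ) : radialTrunc R 0 = 0 := by simp [radialTrunc]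

theorem radialTrunc_eq_smul (R : ℝ) (z : ℂ) : radialTrunc R z = (min |R| ‖z‖ / ‖z‖) • z := by
  rcases eq_or_ne z 0 with rfl | hz
  · simp [radialTrunc]
  have hz' : 0 < ‖z‖ := norm_pos_iff.2 hz
  rw [radialTrunc]
  congr 1
  rcases le_total |R| ‖z‖ with h | h
  · rw [max_eq_right h, min_eq_left h]
  · rw [max_eq_left h, min_eq_right h, div_self hz'.ne', div_self (hz'.trans_le h).ne']

theorem norm_radialTrunc_sub {R S : ℝ} (h : |R| ≤ |S|) (z : ℂ) :
    ‖radialTrunc S z - radialTrunc R z‖ = min |S| ‖z‖ - min |R| ‖z‖ := by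
  rcases eq_or_ne z 0 with rfl | hz
  · simp [radialTrunc]
  have hz' : 0 < ‖z‖ := norm_pos_iff.2 hz
  have : min |R| ‖z‖ ≤ min |S| ‖z‖ := min_le_min_right _ h
  rw [radialTrunc_eq_smul, radialTrunc_eq_smul, ← sub_smul, norm_smul, ← sub_div,
    Real.norm_eq_abs, abs_of_nonneg (div_nonneg (by linarith) hz'.le)]
  field_simp

theorem radialTrunc_of_le {R : ℝ} {z : ℂ} (h : ‖z‖ ≤ |R|) : radialTrunc R z = z := by
  rcases eq_or_ne z 0 with rfl | hz
  · simp [radialTrunc]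
  have hz' : 0 < ‖z‖ := norm_pos_iff.2 hz
  rw [radialTrunc_eq_smul, min_eq_right h, div_self hz'.ne', one_smul]

theorem norm_radialTrunc_sub_self (R : ℝ) (z : ℂ) :
    ‖radialTrunc R z - z‖ = ‖z‖ - min |R| ‖z‖ := by
  set S := max |R| ‖z‖
  have h1 : |R| ≤ |S| := (le_max_left _ _).trans (le_abs_self _)
  have h2 : ‖z‖ ≤ |S| := (le_max_right _ _).trans (le_abs_self _)
  have := norm_radialTrunc_sub h1 z
  rwa [radialTrunc_of_le h2, min_eq_right h2, norm_sub_rev] at this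

theorem lipschitzWith_radialTrunc (R : ℝ) : LipschitzWith 2 (radialTrunc R) := by
  refine LipschitzWith.of_dist_le_mul fun z w => ?_
  rw [dist_eq_norm, dist_eq_norm, NNReal.coe_ofNat]
  rcases (abs_nonneg R).eq_or_lt with h0 | h0
  · simp [radialTrunc, ← h0]
  set r := |R|
  set a := max r ‖z‖
  set b := max r ‖w‖
  have ha : r ≤ a := le_max_left _ _
  have hb : r ≤ b := le_max_left _ _
  have ha0 : 0 < a := h0.trans_le ha
  have hb0 : 0 < b := h0.trans_le hb
  have hw : ‖w‖ ≤ b := le_max_right _ _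
  have hab : |b - a| ≤ ‖z - w‖ := by
    calc |b - a| ≤ max |r - r| |‖w‖ - ‖z‖| := abs_max_sub_max_le_max _ _ _ _
      _ ≤ ‖z - w‖ := by
        rw [sub_self, abs_zero]
        refine max_le (norm_nonneg _) ?_
        rw [norm_sub_rev]; exact abs_norm_sub_norm_le w z
  have key : radialTrunc R z - radialTrunc R w = (r / a) • (z - w) + ((r / a) * ((b - a) / b)) • w := by
    have : (r / a) * ((b - a) / b) = r / a - r / b := by field_simp
    rw [this, radialTrunc, radialTrunc, sub_smul, smul_sub]
    abel
  rw [key]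
  calc _ ≤ ‖(r / a) • (z - w)‖ + ‖((r / a) * ((b - a) / b)) • w‖ := norm_add_le _ _
    _ = (r / a) * ‖z - w‖ + (r / a) * (|b - a| * (‖w‖ / b)) := by
        rw [norm_smul, norm_smul, Real.norm_eq_abs, Real.norm_eq_abs, abs_mul, abs_div, abs_div,
          abs_of_pos ha0, abs_of_pos h0, abs_of_pos hb0]
        ring
    _ ≤ 1 * ‖z - w‖ + 1 * (‖z - w‖ * 1) := by
        have h1 : r / a ≤ 1 := (div_le_one ha0).2 ha
        have h2 : ‖w‖ / b ≤ 1 := (div_le_one hb0).2 hw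
        gcongr
    _ = _ := by ring

variable {X : Type*} [MeasurableSpace X] {μ : Measure X}

/-- Dominated convergence for `eLpNorm`. -/
theorem tendsto_eLpNorm_zero_of_dominated {p : ℝ≥0∞} (hp : p ≠ ∞) {f : ℕ → X → ℂ} {g : X → ℂ}
    (hf : ∀ n, AEStronglyMeasurable (f n) μ) (hg : MemLp g p μ)
    (hfg : ∀ n, ∀ᵐ x ∂μ, ‖f n x‖ ≤ ‖g x‖)
    (hlim : ∀ᵐ x ∂μ, Tendsto (fun n => f n x) atTop (𝓝 0)) :
    Tendsto (fun n => eLpNorm (f n) p μ) atTop (𝓝 0) := by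
  rcases eq_or_ne p 0 with rfl | hp0
  · simp
  have hp' : 0 < p.toReal := ENNReal.toReal_pos hp0 hp
  simp_rw [eLpNorm_eq_lintegral_rpow_enorm_toReal hp0 hp]
  have h : Tendsto (fun n => ∫⁻ x, ‖f n x‖ₑ ^ p.toReal ∂μ) atTop (𝓝 (∫⁻ _, 0 ∂μ)) := by
    refine tendsto_lintegral_of_dominated_convergence' (fun x => ‖g x‖ₑ ^ p.toReal)
      (fun n => (hf n).enorm.pow_const _) (fun n => ?_) ?_ ?_
    · filter_upwards [hfg n] with x hx
      gcongr
      exact enorm_le_iff_norm_le.2 hx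
    · exact (lintegral_rpow_enorm_lt_top_of_eLpNorm_lt_top hp0 hp hg.2).ne
    · filter_upwards [hlim] with x hx
      have := ((continuous_enorm.tendsto 0).comp hx).ennrpow_const p.toReal
      simpa [ENNReal.zero_rpow_of_pos hp'] using this
  have := h.ennrpow_const (1 / p.toReal)
  simpa [ENNReal.zero_rpow_of_pos (inv_pos.2 hp')] using this

/-- Truncation of the values of a square integrable function to the disc of radius `|R|`. -/
noncomputable def truncLp (R : ℝ) (f : Lp ℂ 2 μ) : Lp ℂ 2 μ :=
  (lipschitzWith_radialTrunc R).compLp (radialTrunc_zero R) f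

theorem coeFn_truncLp (R : ℝ) (f : Lp ℂ 2 μ) : truncLp R f =ᵐ[μ] fun x => radialTrunc R (f x) :=
  (lipschitzWith_radialTrunc R).coeFn_compLp (radialTrunc_zero R) f

theorem continuous_truncLp (R : ℝ) : Continuous (truncLp (μ := μ) R) :=
  (lipschitzWith_radialTrunc R).continuous_compLp (radialTrunc_zero R)

theorem tendsto_radialTrunc_atTop {R : ℕ → ℝ} (hR : Tendsto R atTop atTop) (z : ℂ) :
    Tendsto (fun n => radialTrunc (R n) z) atTop (𝓝 z) := by
  refine tendsto_const_nhds.congr' ?_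
  filter_upwards [hR.eventually_ge_atTop ‖z‖] with n hn
  exact (radialTrunc_of_le (hn.trans (le_abs_self _))).symm

theorem tendsto_eLpNorm_truncLp_sub {p : ℝ≥0∞} (hp : p ≠ ∞) {R : ℕ → ℝ}
    (hR : Tendsto R atTop atTop) {f : Lp ℂ 2 μ} (hf : MemLp f p μ) :
    Tendsto (fun n => eLpNorm (truncLp (R n) f - f : X → ℂ) p μ) atTop (𝓝 0) := by
  refine tendsto_eLpNorm_zero_of_dominated hp
    (fun n => (Lp.aestronglyMeasurable _).sub (Lp.aestronglyMeasurable _)) hf (fun n => ?_) ?_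
  · filter_upwards [coeFn_truncLp (R n) f] with x hx
    rw [Pi.sub_apply, hx, norm_radialTrunc_sub_self]
    have : 0 ≤ min |R n| ‖f x‖ := by positivity
    linarith
  · filter_upwards [ae_all_iff.2 fun n => coeFn_truncLp (R n) f] with x hx
    simp only [Pi.sub_apply, hx]
    simpa using (tendsto_radialTrunc_atTop hR (f x)).sub_const (f x)

theorem tendsto_truncLp_atTop {R : ℕ → ℝ} (hR : Tendsto R atTop atTop) (f : Lp ℂ 2 μ) :
    Tendsto (fun n => truncLp (R n) f) atTop (𝓝 f) := by
  rw [Lp.tendsto_Lp_iff_tendsto_eLpNorm']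
  exact tendsto_eLpNorm_truncLp_sub (by simp) hR (Lp.memLp f)

theorem tendsto_truncLp_zero {R : ℕ → ℝ} (hR : Tendsto R atTop (𝓝 0)) (f : Lp ℂ 2 μ) :
    Tendsto (fun n => truncLp (R n) f) atTop (𝓝 0) := by
  rw [Lp.tendsto_Lp_iff_tendsto_eLpNorm']
  have h : Tendsto (fun n => eLpNorm (truncLp (R n) f) 2 μ) atTop (𝓝 0) := by
    refine tendsto_eLpNorm_zero_of_dominated (by simp) (fun n => Lp.aestronglyMeasurable _)
      (Lp.memLp f) (fun n => ?_) ?_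
    · filter_upwards [coeFn_truncLp (R n) f] with x hx
      rw [hx, norm_radialTrunc]
      exact min_le_right _ _
    · filter_upwards [ae_all_iff.2 fun n => coeFn_truncLp (R n) f] with x hx
      simp only [hx]
      refine squeeze_zero_norm (fun n => ?_) (by simpa using hR.abs)
      rw [norm_radialTrunc]
      exact min_le_left _ _
  refine h.congr fun n => eLpNorm_congr_ae ?_
  filter_upwards [Lp.coeFn_zero ℂ 2 μ] with x hx
  rw [Pi.sub_apply, hx, Pi.zero_apply, sub_zero]

theorem isClosed_setOf_eLpNorm_le (p : ℝ≥0∞) (C : ℝ≥0∞) :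
    IsClosed {f : Lp ℂ 2 μ | eLpNorm f p μ ≤ C} := by
  refine IsSeqClosed.isClosed fun f g hf hfg => ?_
  exact eLpNorm_le_of_tendstoInMeasure (Eventually.of_forall hf)
    (tendstoInMeasure_of_tendsto_Lp hfg) fun n => Lp.aestronglyMeasurable _

theorem MeasureTheory.AEStronglyMeasurable.aemeasurable_eLpNorm {α : Type*} [MeasurableSpace α]
    {ν : Measure α} {u : α → Lp ℂ 2 μ} (hu : AEStronglyMeasurable u ν) (p : ℝ≥0∞) :
    AEMeasurable (fun t => eLpNorm (u t) p μ) ν := by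
  let _ : MeasurableSpace (Lp ℂ 2 μ) := borel _
  have : BorelSpace (Lp ℂ 2 μ) := ⟨rfl⟩
  have : Measurable fun f : Lp ℂ 2 μ => eLpNorm f p μ :=
    measurable_of_Iic fun C => (isClosed_setOf_eLpNorm_le p C).measurableSet
  exact this.comp_aemeasurable hu.aemeasurable

end Truncation

section HeightLayers
open Filter Topology

variable {X : Type*} [MeasurableSpace X] {μ : Measure X}

/-- The dyadic heights `2 ^ (n (σ + 1))`. -/
noncomputable def layerHeight (σ : ℝ) (n : ℤ) : ℝ := ((2 : ℝ) ^ n) ^ (σ + 1)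

theorem layerHeight_pos (σ : ℝ) (n : ℤ) : 0 < layerHeight σ n := by
  unfold layerHeight; positivity

theorem layerHeight_succ (σ : ℝ) (n : ℤ) :
    layerHeight σ (n + 1) = 2 ^ (σ + 1) * layerHeight σ n := by
  unfold layerHeight
  rw [← Real.mul_rpow (by norm_num) (by positivity), zpow_add_one₀ (by norm_num), mul_comm]

theorem layerHeight_lt_succ {σ : ℝ} (hσ : 1 < σ) (n : ℤ) :
    layerHeight σ n ≤ layerHeight σ (n + 1) := by
  rw [layerHeight_succ]
  exact le_mul_of_one_le_left (layerHeight_pos σ n).le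
    (Real.one_le_rpow (by norm_num) (by linarith))

/-- The part of a function with values at height between two consecutive dyadic heights. -/
noncomputable def heightLayer (σ : ℝ) (n : ℤ) (f : Lp ℂ 2 μ) : Lp ℂ 2 μ :=
  truncLp (layerHeight σ (n + 1)) f - truncLp (layerHeight σ n) f

theorem continuous_heightLayer (σ : ℝ) (n : ℤ) : Continuous (heightLayer (μ := μ) σ n) :=
  (continuous_truncLp _).sub (continuous_truncLp _)

theorem norm_truncLp_sub_truncLp {R S : ℝ} (hR : 0 ≤ R) (h : R ≤ S) (f : Lp ℂ 2 μ) :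
    ∀ᵐ x ∂μ, ‖(truncLp S f - truncLp R f : Lp ℂ 2 μ) x‖ = min S ‖f x‖ - min R ‖f x‖ := by
  filter_upwards [Lp.coeFn_sub (truncLp S f) (truncLp R f), coeFn_truncLp S f,
    coeFn_truncLp R f] with x h1 h2 h3
  rw [h1, Pi.sub_apply, h2, h3, norm_radialTrunc_sub, abs_of_nonneg hR, abs_of_nonneg (hR.trans h)]
  rwa [abs_of_nonneg hR, abs_of_nonneg (hR.trans h)]

theorem rpow_mul_min_sub_min_le {p a b x : ℝ} (hp : 1 < p) (ha : 0 < a) (hab : a ≤ b) :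
    a ^ (p - 1) * (min b x - min a x) ≤ (min b x) ^ p - (min a x) ^ p := by
  rcases le_total x a with h | h
  · rw [min_eq_right h, min_eq_right (h.trans hab)]; simp
  · rw [min_eq_left h]
    set y := min b x
    have hay : a ≤ y := le_min hab h
    have hy : 0 < y := ha.trans_le hay
    have h1 : a ^ (p - 1) * y ≤ y ^ (p - 1) * y := by
      gcongr
    have h2 : ∀ z : ℝ, 0 < z → z ^ (p - 1) * z = z ^ p := fun z hz => by
      rw [← Real.rpow_add_one hz.ne']; congr 1; ring
    rw [mul_sub, h2 a ha]
    rw [h2 y hy] at h1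
    linarith

theorem sum_layerHeight_rpow_mul_le {σ p : ℝ} (hσ : 1 < σ) (hp : 1 < p) (N : ℕ) {x : ℝ}
    (hx : 0 ≤ x) :
    ∑ i ∈ Finset.range (2 * N), layerHeight σ (i - N) ^ (p - 1) *
      (min (layerHeight σ (i - N + 1)) x - min (layerHeight σ (i - N)) x) ≤ x ^ p := by
  calc _ ≤ ∑ i ∈ Finset.range (2 * N), ((min (layerHeight σ (((i + 1 : ℕ) : ℤ) - N)) x) ^ p -
        (min (layerHeight σ ((i : ℤ) - N)) x) ^ p) := by
        refine Finset.sum_le_sum fun i _ => ?_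
        have : (((i + 1 : ℕ) : ℤ) - N) = (i : ℤ) - N + 1 := by push_cast; ring
        rw [this]
        exact rpow_mul_min_sub_min_le hp (layerHeight_pos _ _) (layerHeight_lt_succ hσ _)
    _ = (min (layerHeight σ (((2 * N : ℕ) : ℤ) - N)) x) ^ p -
        (min (layerHeight σ (((0 : ℕ) : ℤ) - N)) x) ^ p :=
        Finset.sum_range_sub (fun i : ℕ => (min (layerHeight σ ((i : ℤ) - N)) x) ^ p) _
    _ ≤ x ^ p := by
        have h1 : 0 ≤ (min (layerHeight σ (((0 : ℕ) : ℤ) - N)) x) ^ p :=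
          Real.rpow_nonneg (le_min (layerHeight_pos _ _).le hx) _
        have h2 : (min (layerHeight σ (((2 * N : ℕ) : ℤ) - N)) x) ^ p ≤ x ^ p :=
          Real.rpow_le_rpow (le_min (layerHeight_pos _ _).le hx) (min_le_right _ _) (by linarith)
        linarith

/-- The dual endpoint exponent `2 σ / (σ + 1)`. -/
noncomputable def endpointExp (σ : ℝ) : ℝ := 2 * σ / (σ + 1)

theorem one_lt_endpointExp {σ : ℝ} (hσ : 1 < σ) : 1 < endpointExp σ := by
  rw [endpointExp, lt_div_iff₀ (by linarith)]; linarith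

theorem layerHeight_rpow_endpointExp {σ : ℝ} (hσ : 1 < σ) (n : ℤ) :
    layerHeight σ n ^ (endpointExp σ - 1) = ((2 : ℝ) ^ n) ^ (σ - 1) := by
  rw [layerHeight, ← Real.rpow_mul (by positivity), endpointExp]
  congr 1
  have : σ + 1 ≠ 0 := by linarith
  field_simp
  ring

/-- The size of a height layer. -/
noncomputable def layerMass (σ : ℝ) (n : ℤ) (f : Lp ℂ 2 μ) : ℝ≥0∞ :=
  ENNReal.ofReal (((2 : ℝ) ^ n) ^ (σ - 1)) * eLpNorm (heightLayer σ n f) 1 μ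

theorem sum_layerMass_le {σ : ℝ} (hσ : 1 < σ) (N : ℕ) (f : Lp ℂ 2 μ) :
    ∑ i ∈ Finset.range (2 * N), layerMass σ (i - N) f ≤
      eLpNorm f (ENNReal.ofReal (endpointExp σ)) μ ^ endpointExp σ := by
  have hp := one_lt_endpointExp hσ
  have hp0 : 0 < endpointExp σ := by linarith
  rw [eLpNorm_eq_lintegral_rpow_enorm_toReal (by simpa) (by simp),
    ENNReal.toReal_ofReal hp0.le, ← ENNReal.rpow_mul, one_div, inv_mul_cancel₀ hp0.ne',
    ENNReal.rpow_one]
  simp_rw [layerMass, eLpNorm_one_eq_lintegral_enorm]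
  have h1 : ∀ n : ℤ, ENNReal.ofReal (((2 : ℝ) ^ n) ^ (σ - 1)) *
      ∫⁻ x, ‖(heightLayer σ n f : X → ℂ) x‖ₑ ∂μ =
      ∫⁻ x, ENNReal.ofReal (layerHeight σ n ^ (endpointExp σ - 1) *
        (min (layerHeight σ (n + 1)) ‖f x‖ - min (layerHeight σ n) ‖f x‖)) ∂μ := fun n => by
    rw [← lintegral_const_mul' _ _ ENNReal.ofReal_ne_top]
    refine lintegral_congr_ae ?_
    filter_upwards [norm_truncLp_sub_truncLp (layerHeight_pos σ n).le (layerHeight_lt_succ hσ n) f]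
      with x hx
    rw [ENNReal.ofReal_mul (Real.rpow_nonneg (layerHeight_pos σ n).le _), ← hx,
      layerHeight_rpow_endpointExp hσ, ofReal_norm]
    rfl
  simp_rw [h1]
  rw [← lintegral_finsetSum']
  · refine lintegral_mono fun x => ?_
    rw [← ENNReal.ofReal_sum_of_nonneg, ← ofReal_norm,
      ENNReal.ofReal_rpow_of_nonneg (norm_nonneg _) hp0.le]
    · exact ENNReal.ofReal_le_ofReal (sum_layerHeight_rpow_mul_le hσ hp N (norm_nonneg _))
    · intro i _
      exact mul_nonneg (Real.rpow_nonneg (layerHeight_pos σ _).le _)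
        (sub_nonneg.2 (min_le_min_right _ (layerHeight_lt_succ hσ _)))
  · intro i _
    have := (Lp.aestronglyMeasurable f).norm.aemeasurable
    fun_prop

theorem eLpNorm_one_heightLayer (σ : ℝ) (n : ℤ) (f : Lp ℂ 2 μ) :
    eLpNorm (heightLayer σ n f) 1 μ =
      ENNReal.ofReal (((2 : ℝ) ^ n)⁻¹ ^ (σ - 1)) * layerMass σ n f := by
  rw [layerMass, ← mul_assoc, ← ENNReal.ofReal_mul (by positivity), Real.inv_rpow (by positivity),
    inv_mul_cancel₀ (by positivity), ENNReal.ofReal_one, one_mul]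

theorem enorm_heightLayer_sq_le {σ : ℝ} (hσ : 1 < σ) (n : ℤ) (f : Lp ℂ 2 μ) :
    ‖heightLayer σ n f‖ₑ ^ 2 ≤
      ENNReal.ofReal (2 ^ (σ + 1)) * ENNReal.ofReal ((2 : ℝ) ^ n) ^ 2 * layerMass σ n f := by
  have h1 : ENNReal.ofReal (2 ^ (σ + 1)) * ENNReal.ofReal ((2 : ℝ) ^ n) ^ 2 * layerMass σ n f =
      ENNReal.ofReal (layerHeight σ (n + 1)) * eLpNorm (heightLayer σ n f) 1 μ := by
    rw [layerMass, ← mul_assoc, ← ENNReal.ofReal_pow (by positivity),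
      ← ENNReal.ofReal_mul (by positivity), ← ENNReal.ofReal_mul (by positivity), layerHeight_succ]
    congr 2
    rw [mul_assoc, layerHeight, ← Real.rpow_natCast, ← Real.rpow_add (by positivity)]
    congr 2
    push_cast
    ring
  rw [h1, Lp.enorm_def, eLpNorm_eq_lintegral_rpow_enorm_toReal (by simp) (by simp),
    ← ENNReal.rpow_natCast, ← ENNReal.rpow_mul, eLpNorm_one_eq_lintegral_enorm,
    ← lintegral_const_mul' _ _ ENNReal.ofReal_ne_top]
  simp only [ENNReal.toReal_ofNat, one_div, Nat.cast_ofNat, ne_eq, OfNat.ofNat_ne_zero,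
    not_false_eq_true, inv_mul_cancel₀, ENNReal.rpow_one]
  refine lintegral_mono_ae ?_
  filter_upwards [norm_truncLp_sub_truncLp (layerHeight_pos σ n).le (layerHeight_lt_succ hσ n) f]
    with x hx
  rw [ENNReal.rpow_ofNat, sq]
  gcongr
  rw [← ofReal_norm]
  refine ENNReal.ofReal_le_ofReal ?_
  change ‖(truncLp (layerHeight σ (n + 1)) f - truncLp (layerHeight σ n) f : Lp ℂ 2 μ) x‖ ≤ _
  rw [hx]
  have : 0 ≤ min (layerHeight σ n) ‖f x‖ := le_min (layerHeight_pos _ _).le (norm_nonneg _)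
  have := min_le_left (layerHeight σ (n + 1)) ‖f x‖
  linarith

theorem sum_heightLayer (σ : ℝ) (N : ℕ) (f : Lp ℂ 2 μ) :
    ∑ i ∈ Finset.range (2 * N), heightLayer σ (i - N) f =
      truncLp (layerHeight σ N) f - truncLp (layerHeight σ (-N)) f := by
  have := Finset.sum_range_sub (fun i : ℕ => truncLp (layerHeight σ ((i : ℤ) - N)) f) (2 * N)
  have h1 : ∀ i : ℕ, (((i + 1 : ℕ) : ℤ) - N) = (i : ℤ) - N + 1 := fun i => by push_cast; ring
  simp only [h1] at this
  unfold heightLayer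
  rw [this]
  congr 3
  · push_cast; ring
  · push_cast; ring

theorem tendsto_layerHeight_atTop {σ : ℝ} (hσ : 1 < σ) :
    Tendsto (fun N : ℕ => layerHeight σ N) atTop atTop := by
  have h1 : Tendsto (fun N : ℕ => (2 : ℝ) ^ N) atTop atTop :=
    tendsto_pow_atTop_atTop_of_one_lt (by norm_num)
  have := (tendsto_rpow_atTop (by linarith : 0 < σ + 1)).comp h1
  refine this.congr fun N => ?_
  simp [layerHeight]

theorem tendsto_layerHeight_zero {σ : ℝ} (hσ : 1 < σ) :
    Tendsto (fun N : ℕ => layerHeight σ (-N)) atTop (𝓝 0) := by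
  refine (tendsto_inv_atTop_zero.comp (tendsto_layerHeight_atTop hσ)).congr fun N => ?_
  simp [layerHeight, Real.inv_rpow]

theorem tendsto_sum_heightLayer {σ : ℝ} (hσ : 1 < σ) (f : Lp ℂ 2 μ) :
    Tendsto (fun N : ℕ => ∑ i ∈ Finset.range (2 * N), heightLayer σ (i - N) f) atTop (𝓝 f) := by
  simp_rw [sum_heightLayer]
  simpa using (tendsto_truncLp_atTop (tendsto_layerHeight_atTop hσ) f).sub
    (tendsto_truncLp_zero (tendsto_layerHeight_zero hσ) f)

theorem norm_truncLp_sub_truncLp_le {R S : ℝ} (hR : 0 ≤ R) (h : R ≤ S) (f : Lp ℂ 2 μ) :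
    ‖truncLp S f - truncLp R f‖ ≤ ‖f‖ := by
  refine Lp.norm_le_norm_of_ae_le ?_
  filter_upwards [norm_truncLp_sub_truncLp hR h f] with x hx
  rw [hx]
  have : 0 ≤ min R ‖f x‖ := le_min hR (norm_nonneg _)
  have := min_le_right S ‖f x‖
  linarith

theorem norm_sum_heightLayer_le {σ : ℝ} (hσ : 1 < σ) (N : ℕ) (f : Lp ℂ 2 μ) :
    ‖∑ i ∈ Finset.range (2 * N), heightLayer σ (i - N) f‖ ≤ ‖f‖ := by
  rw [sum_heightLayer]
  refine norm_truncLp_sub_truncLp_le (layerHeight_pos σ _).le ?_ f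
  unfold layerHeight
  gcongr
  · norm_num
  · linarith

end HeightLayers

section TimeLayers
open Filter Topology

variable {X : Type*} [MeasurableSpace X] {μ : Measure X}
variable {H : Type*} [NormedAddCommGroup H] [InnerProductSpace ℂ H]

/-- A strongly measurable family of operators applied to a strongly measurable function. -/
theorem aestronglyMeasurable_clm_apply {α E F : Type*} [MeasurableSpace α] {ν : Measure α}
    [NormedAddCommGroup E] [NormedSpace ℂ E] [NormedAddCommGroup F] [NormedSpace ℂ F]
    {T : α → E →L[ℂ] F} (hT : ∀ x, AEStronglyMeasurable (fun t => T t x) ν) {u : α → E}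
    (hu : AEStronglyMeasurable u ν) : AEStronglyMeasurable (fun t => T t (u t)) ν := by
  have hs : ∀ s : SimpleFunc α E, AEStronglyMeasurable (fun t => T t (s t)) ν := by
    intro s
    induction s using SimpleFunc.induction with
    | @const c S hS =>
      refine ((hT c).indicator hS).congr (Eventually.of_forall fun t => ?_)
      by_cases ht : t ∈ S <;> simp [ht]
    | @add f g _ hf hg =>
      refine (hf.add hg).congr (Eventually.of_forall fun t => ?_)
      simp
  obtain ⟨v, hv, huv⟩ := hu
  refine AEStronglyMeasurable.congr (f := fun t => T t (v t)) ?_ (huv.mono fun t ht => by simp [ht])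
  refine aestronglyMeasurable_of_tendsto_ae atTop (fun n => hs (hv.approx n))
    (Eventually.of_forall fun t => ?_)
  exact ((T t).continuous.tendsto _).comp (hv.tendsto_approx t)

theorem enorm_inner_Lp_le {p q : ℝ≥0∞} [ENNReal.HolderConjugate p q] (g f : Lp ℂ 2 μ) :
    ‖inner ℂ g f‖ₑ ≤ eLpNorm g p μ * eLpNorm f q μ := by
  rw [L2.inner_def]
  refine (enorm_integral_le_lintegral_enorm _).trans ?_
  rw [← eLpNorm_one_eq_lintegral_enorm]
  have := eLpNorm_le_eLpNorm_mul_eLpNorm_of_nnnorm (p := p) (q := q) (r := 1)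
    (Lp.aestronglyMeasurable g) (Lp.aestronglyMeasurable f) (fun x y : ℂ => inner ℂ x y) 1
    (Eventually.of_forall fun x => by simpa using nnnorm_inner_le_nnnorm (𝕜 := ℂ) (g x) (f x))
  simpa using this

variable [CompleteSpace H]

theorem enorm_inner_adjoint_le {C σ : ℝ} {A D : ℝ → H →L[ℂ] Lp ℂ 2 μ}
    (h : DispersiveBound C σ fun s t => A s ∘L ContinuousLinearMap.adjoint (D t)) {s t : ℝ}
    (hst : s ≠ t) (G F : Lp ℂ 2 μ) (hF : MemLp F 1 μ) :
    ‖inner ℂ (ContinuousLinearMap.adjoint (A t) G) (ContinuousLinearMap.adjoint (D s) F)‖ₑ ≤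
      ENNReal.ofReal (C * |t - s| ^ (-σ)) * (eLpNorm G 1 μ * eLpNorm F 1 μ) := by
  rw [ContinuousLinearMap.adjoint_inner_left]
  calc _ ≤ eLpNorm G 1 μ * eLpNorm (A t (ContinuousLinearMap.adjoint (D s) F)) ∞ μ :=
        enorm_inner_Lp_le _ _
    _ ≤ eLpNorm G 1 μ * (ENNReal.ofReal (C * |s - t| ^ (-σ)) * eLpNorm F 1 μ) := by
        gcongr
        exact h t s hst.symm F hF
    _ = _ := by rw [abs_sub_comm]; ring

/-- The assumptions on a single propagator: strong measurability, boundedness and dispersion. -/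
structure IsDispersive (C σ : ℝ) (D : ℝ → H →L[ℂ] Lp ℂ 2 μ) : Prop where
  one_le : 1 ≤ C
  measurable_apply : ∀ f, AEStronglyMeasurable (fun t => D t f)
  measurable_adjoint : ∀ g, AEStronglyMeasurable fun t => ContinuousLinearMap.adjoint (D t) g
  norm_apply_le : ∀ t f, ‖D t f‖ ≤ C * ‖f‖
  dispersive : DispersiveBound C σ fun s t => D s ∘L ContinuousLinearMap.adjoint (D t)

theorem IsDispersive.norm_adjoint_le {C σ : ℝ} {D : ℝ → H →L[ℂ] Lp ℂ 2 μ}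
    (hD : IsDispersive C σ D) (t : ℝ) (g : Lp ℂ 2 μ) :
    ‖ContinuousLinearMap.adjoint (D t) g‖ ≤ C * ‖g‖ := by
  refine ContinuousLinearMap.le_of_opNorm_le _ ?_ g
  rw [LinearIsometryEquiv.norm_map]
  exact ContinuousLinearMap.opNorm_le_bound _ (zero_le_one.trans hD.one_le) (hD.norm_apply_le t)

theorem IsDispersive.integrable_adjoint {C σ : ℝ} {D : ℝ → H →L[ℂ] Lp ℂ 2 μ}
    (hD : IsDispersive C σ D) {F : ℝ → Lp ℂ 2 μ} (hF : Integrable F) :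
    Integrable fun t => ContinuousLinearMap.adjoint (D t) (F t) :=
  (hF.norm.const_mul C).mono'
    (aestronglyMeasurable_clm_apply hD.measurable_adjoint hF.aestronglyMeasurable)
    (Eventually.of_forall fun t => hD.norm_adjoint_le t (F t))

/-- The height layers of `F t`, relative to its norm in the dual endpoint space. -/
noncomputable def timeLayer (σ : ℝ) (n : ℤ) (F : ℝ → Lp ℂ 2 μ) (t : ℝ) : Lp ℂ 2 μ :=
  (eLpNorm (F t) (ENNReal.ofReal (endpointExp σ)) μ).toReal •
    heightLayer σ n ((eLpNorm (F t) (ENNReal.ofReal (endpointExp σ)) μ).toReal⁻¹ • F t)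

/-- The amplitude of the height layers of `F t`. -/
noncomputable def timeAmp (σ : ℝ) (n : ℤ) (F : ℝ → Lp ℂ 2 μ) (t : ℝ) : ℝ≥0∞ :=
  ENNReal.ofReal (2 ^ (σ + 1) * (eLpNorm (F t) (ENNReal.ofReal (endpointExp σ)) μ).toReal) *
    layerMass σ n ((eLpNorm (F t) (ENNReal.ofReal (endpointExp σ)) μ).toReal⁻¹ • F t) ^ (1 / 2 : ℝ)

theorem aestronglyMeasurable_normalized {σ : ℝ} {F : ℝ → Lp ℂ 2 μ}
    (hF : AEStronglyMeasurable F) : AEStronglyMeasurable fun t =>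
      (eLpNorm (F t) (ENNReal.ofReal (endpointExp σ)) μ).toReal⁻¹ • F t :=
  (hF.aemeasurable_eLpNorm _).ennreal_toReal.inv.aestronglyMeasurable.smul hF

theorem aestronglyMeasurable_timeLayer {σ : ℝ} {n : ℤ} {F : ℝ → Lp ℂ 2 μ}
    (hF : AEStronglyMeasurable F) : AEStronglyMeasurable (timeLayer σ n F) :=
  (hF.aemeasurable_eLpNorm _).ennreal_toReal.aestronglyMeasurable.smul
    ((continuous_heightLayer σ n).comp_aestronglyMeasurable (aestronglyMeasurable_normalized hF))

theorem aemeasurable_timeAmp {σ : ℝ} {n : ℤ} {F : ℝ → Lp ℂ 2 μ}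
    (hF : AEStronglyMeasurable F) : AEMeasurable (timeAmp σ n F) := by
  have h1 := (hF.aemeasurable_eLpNorm (ENNReal.ofReal (endpointExp σ))).ennreal_toReal
  have h2 := ((continuous_heightLayer σ n).comp_aestronglyMeasurable
    (aestronglyMeasurable_normalized (σ := σ) hF)).aemeasurable_eLpNorm 1
  unfold timeAmp layerMass
  exact (h1.const_mul _).ennreal_ofReal.mul ((h2.const_mul _).pow_const _)

theorem eLpNorm_normalized_le {p : ℝ≥0∞} (f : Lp ℂ 2 μ) :
    eLpNorm ((eLpNorm f p μ).toReal⁻¹ • f : Lp ℂ 2 μ) p μ ≤ 1 := by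
  rw [eLpNorm_congr_ae (Lp.coeFn_smul _ f), eLpNorm_const_smul]
  rcases eq_or_ne (eLpNorm f p μ).toReal 0 with h | h
  · simp [h]
  · have h1 : eLpNorm f p μ ≠ 0 ∧ eLpNorm f p μ ≠ ∞ := by
      simpa [ENNReal.toReal_eq_zero_iff] using h
    rw [Real.enorm_eq_ofReal (by positivity), ENNReal.ofReal_inv_of_pos
      (ENNReal.toReal_pos h1.1 h1.2), ENNReal.ofReal_toReal h1.2, ENNReal.inv_mul_cancel h1.1 h1.2]

theorem sum_layerMass_normalized_le {σ : ℝ} (hσ : 1 < σ) (N : ℕ) (f : Lp ℂ 2 μ) :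
    ∑ i ∈ Finset.range (2 * N), layerMass σ (i - N)
      ((eLpNorm f (ENNReal.ofReal (endpointExp σ)) μ).toReal⁻¹ • f) ≤ 1 := by
  refine (sum_layerMass_le hσ N _).trans ?_
  have := one_lt_endpointExp hσ
  exact ENNReal.rpow_le_one (eLpNorm_normalized_le f) (by linarith)

theorem layerMass_normalized_le {σ : ℝ} (hσ : 1 < σ) (n : ℤ) (f : Lp ℂ 2 μ) :
    layerMass σ n ((eLpNorm f (ENNReal.ofReal (endpointExp σ)) μ).toReal⁻¹ • f) ≤ 1 := by
  refine le_trans ?_ (sum_layerMass_normalized_le hσ (n.natAbs + 1) f)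
  have h1 : (n + (n.natAbs + 1)).toNat ∈ Finset.range (2 * (n.natAbs + 1)) := by
    rw [Finset.mem_range]; omega
  refine le_trans (le_of_eq ?_) (Finset.single_le_sum (f := fun i : ℕ => layerMass σ
    (i - (n.natAbs + 1 : ℕ)) _) (fun _ _ => zero_le) h1)
  congr 1
  omega

theorem eLpNorm_timeLayer_le {σ : ℝ} (hσ : 1 < σ) (n : ℤ) (F : ℝ → Lp ℂ 2 μ) (t : ℝ) :
    eLpNorm (timeLayer σ n F t) 1 μ ≤
      ENNReal.ofReal (((2 : ℝ) ^ n)⁻¹ ^ (σ - 1)) * timeAmp σ n F t := by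
  set M := (eLpNorm (F t) (ENNReal.ofReal (endpointExp σ)) μ).toReal with hM
  have hM0 : 0 ≤ M := ENNReal.toReal_nonneg
  have h1 := layerMass_normalized_le hσ n (F t)
  rw [timeLayer, timeAmp, ← hM, eLpNorm_congr_ae (Lp.coeFn_smul _ _), eLpNorm_const_smul,
    eLpNorm_one_heightLayer, Real.enorm_eq_ofReal hM0, mul_left_comm]
  rw [← hM] at h1
  gcongr
  · exact le_mul_of_one_le_left hM0 (Real.one_le_rpow (by norm_num) (by linarith))
  · conv_lhs => rw [← ENNReal.rpow_one (layerMass _ _ _)]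
    exact ENNReal.rpow_le_rpow_of_exponent_ge h1 (by norm_num)

theorem eLpNorm_timeLayer_lt_top {σ : ℝ} (hσ : 1 < σ) (n : ℤ) (F : ℝ → Lp ℂ 2 μ) (t : ℝ) :
    eLpNorm (timeLayer σ n F t) 1 μ < ∞ := by
  refine (eLpNorm_timeLayer_le hσ n F t).trans_lt ?_
  refine ENNReal.mul_lt_top ENNReal.ofReal_lt_top (ENNReal.mul_lt_top ENNReal.ofReal_lt_top ?_)
  exact ENNReal.rpow_lt_top_of_nonneg (by norm_num)
    ((layerMass_normalized_le hσ n (F t)).trans_lt ENNReal.one_lt_top).ne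

theorem enorm_timeLayer_le {σ : ℝ} (hσ : 1 < σ) (n : ℤ) (F : ℝ → Lp ℂ 2 μ) (t : ℝ) :
    ‖timeLayer σ n F t‖ₑ ≤ ENNReal.ofReal (((2 : ℝ) ^ n)⁻¹)⁻¹ * timeAmp σ n F t := by
  set M := (eLpNorm (F t) (ENNReal.ofReal (endpointExp σ)) μ).toReal with hM
  have hM0 : 0 ≤ M := ENNReal.toReal_nonneg
  have h1 := enorm_heightLayer_sq_le hσ n (M⁻¹ • F t)
  rw [timeLayer, timeAmp, ← hM, enorm_smul, inv_inv, Real.enorm_eq_ofReal hM0]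
  set L := layerMass σ n (M⁻¹ • F t)
  have h2 : ‖heightLayer σ n (M⁻¹ • F t)‖ₑ ≤
      ENNReal.ofReal (2 ^ (σ + 1)) * ENNReal.ofReal ((2 : ℝ) ^ n) * L ^ (1 / 2 : ℝ) := by
    have h3 : (1 : ℝ≥0∞) ≤ ENNReal.ofReal (2 ^ (σ + 1)) := by
      rw [ENNReal.one_le_ofReal]
      exact Real.one_le_rpow (by norm_num) (by linarith)
    have h4 : (L ^ (1 / 2 : ℝ)) ^ 2 = L := by
      rw [← ENNReal.rpow_natCast, ← ENNReal.rpow_mul]; norm_num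
    refine (ENNReal.pow_le_pow_left_iff (n := 2) (by norm_num)).1 (h1.trans ?_)
    rw [mul_pow, mul_pow, h4]
    gcongr
    exact le_self_pow h3 (by norm_num)
  calc _ ≤ ENNReal.ofReal M *
      (ENNReal.ofReal (2 ^ (σ + 1)) * ENNReal.ofReal ((2 : ℝ) ^ n) * L ^ (1 / 2 : ℝ)) := by gcongr
    _ = _ := by
        rw [ENNReal.ofReal_mul (by positivity)]; ring

theorem sum_timeAmp_sq_le {σ : ℝ} (hσ : 1 < σ) (N : ℕ) (F : ℝ → Lp ℂ 2 μ) (t : ℝ) :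
    ∑ i ∈ Finset.range (2 * N), timeAmp σ (i - N) F t ^ 2 ≤
      ENNReal.ofReal (2 ^ (σ + 1)) ^ 2 *
        eLpNorm (F t) (ENNReal.ofReal (endpointExp σ)) μ ^ 2 := by
  have h4 : ∀ L : ℝ≥0∞, (L ^ (1 / 2 : ℝ)) ^ 2 = L := fun L => by
    rw [← ENNReal.rpow_natCast, ← ENNReal.rpow_mul]; norm_num
  simp_rw [timeAmp, mul_pow, h4]
  rw [← Finset.mul_sum]
  refine (mul_le_mul_right (sum_layerMass_normalized_le hσ N (F t)) _).trans ?_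
  rw [mul_one, ENNReal.ofReal_mul (by positivity), mul_pow]
  gcongr
  exact ENNReal.ofReal_toReal_le

theorem norm_timeSum_le {σ : ℝ} (hσ : 1 < σ) (N : ℕ) (F : ℝ → Lp ℂ 2 μ) (t : ℝ) :
    ‖∑ i ∈ Finset.range (2 * N), timeLayer σ (i - N) F t‖ ≤ ‖F t‖ := by
  unfold timeLayer
  rw [← Finset.smul_sum, norm_smul]
  refine (mul_le_mul_of_nonneg_left (norm_sum_heightLayer_le hσ N _) (norm_nonneg _)).trans ?_
  rw [norm_smul, norm_inv, ← mul_assoc]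
  exact mul_le_of_le_one_left (norm_nonneg _) mul_inv_le_one

theorem norm_timeLayer_le {σ : ℝ} (hσ : 1 < σ) (n : ℤ) (F : ℝ → Lp ℂ 2 μ) (t : ℝ) :
    ‖timeLayer σ n F t‖ ≤ ‖F t‖ := by
  rw [timeLayer, norm_smul]
  refine (mul_le_mul_of_nonneg_left (norm_truncLp_sub_truncLp_le (layerHeight_pos σ n).le
    (layerHeight_lt_succ hσ n) _) (norm_nonneg _)).trans ?_
  rw [norm_smul, norm_inv, ← mul_assoc]
  exact mul_le_of_le_one_left (norm_nonneg _) mul_inv_le_one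

theorem integrable_timeLayer {σ : ℝ} (hσ : 1 < σ) (n : ℤ) {F : ℝ → Lp ℂ 2 μ}
    (hF : Integrable F) : Integrable (timeLayer σ n F) :=
  hF.mono (aestronglyMeasurable_timeLayer hF.aestronglyMeasurable)
    (Eventually.of_forall (norm_timeLayer_le hσ n F))

theorem tendsto_timeSum {σ : ℝ} (hσ : 1 < σ) (F : ℝ → Lp ℂ 2 μ) {t : ℝ}
    (ht : eLpNorm (F t) (ENNReal.ofReal (endpointExp σ)) μ ≠ ∞) :
    Tendsto (fun N : ℕ => ∑ i ∈ Finset.range (2 * N), timeLayer σ (i - N) F t) atTop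
      (𝓝 (F t)) := by
  have hp := one_lt_endpointExp hσ
  unfold timeLayer
  simp_rw [← Finset.smul_sum]
  set M := (eLpNorm (F t) (ENNReal.ofReal (endpointExp σ)) μ).toReal with hM
  have h1 : M • (M⁻¹ • F t) = F t := by
    rcases eq_or_ne M 0 with h | h
    · have h2 : eLpNorm (F t) (ENNReal.ofReal (endpointExp σ)) μ = 0 := by
        rw [hM, ENNReal.toReal_eq_zero_iff] at h
        tauto
      rw [eLpNorm_eq_zero_iff (Lp.aestronglyMeasurable _) (by simp; linarith)] at h2
      have : F t = 0 := (Lp.eq_zero_iff_ae_eq_zero).2 h2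
      simp [this]
    · rw [smul_smul, mul_inv_cancel₀ h, one_smul]
  have := (tendsto_sum_heightLayer hσ (M⁻¹ • F t)).const_smul M
  rwa [h1] at this

theorem enorm_inner_timeLayer_le {C σ : ℝ} (hσ : 1 < σ) (hC : 1 ≤ C) {A D : ℝ → H →L[ℂ] Lp ℂ 2 μ}
    (h : DispersiveBound C σ fun s t => A s ∘L ContinuousLinearMap.adjoint (D t))
    (m n : ℤ) (G F : ℝ → Lp ℂ 2 μ) {s t : ℝ} (hst : s ≠ t) :
    ‖inner ℂ (ContinuousLinearMap.adjoint (A t) (timeLayer σ m G t))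
      (ContinuousLinearMap.adjoint (D s) (timeLayer σ n F s))‖ₑ ≤
      ENNReal.ofReal (|t - s| ^ (-σ) * (((2 : ℝ) ^ m)⁻¹ * ((2 : ℝ) ^ n)⁻¹) ^ (σ - 1)) *
        ((ENNReal.ofReal C * timeAmp σ m G t) * (ENNReal.ofReal C * timeAmp σ n F s)) := by
  refine (enorm_inner_adjoint_le h hst _ _ ⟨Lp.aestronglyMeasurable _,
    eLpNorm_timeLayer_lt_top hσ n F s⟩).trans ?_
  have hC1 : 1 ≤ ENNReal.ofReal C := by rwa [ENNReal.one_le_ofReal]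
  calc _ ≤ ENNReal.ofReal (C * |t - s| ^ (-σ)) *
      ((ENNReal.ofReal (((2 : ℝ) ^ m)⁻¹ ^ (σ - 1)) * timeAmp σ m G t) *
        (ENNReal.ofReal (((2 : ℝ) ^ n)⁻¹ ^ (σ - 1)) * timeAmp σ n F s)) := by
        gcongr
        · exact eLpNorm_timeLayer_le hσ m G t
        · exact eLpNorm_timeLayer_le hσ n F s
    _ = ENNReal.ofReal (|t - s| ^ (-σ) * (((2 : ℝ) ^ m)⁻¹ * ((2 : ℝ) ^ n)⁻¹) ^ (σ - 1)) *
        (timeAmp σ m G t * (ENNReal.ofReal C * timeAmp σ n F s)) := by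
        rw [Real.mul_rpow (by positivity) (by positivity), ENNReal.ofReal_mul (by positivity),
          ENNReal.ofReal_mul (by positivity), ENNReal.ofReal_mul (by positivity)]
        ring
    _ ≤ _ := by
        gcongr
        exact le_mul_of_one_le_left' hC1

theorem IsDispersive.isLayer {C σ : ℝ} (hσ : 1 < σ) {D : ℝ → H →L[ℂ] Lp ℂ 2 μ}
    (hD : IsDispersive C σ D) (n : ℤ) {F : ℝ → Lp ℂ 2 μ} (hF : Integrable F) :
    IsLayer σ ((2 : ℝ) ^ n)⁻¹ (fun t => ENNReal.ofReal C * timeAmp σ n F t)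
      (fun t => ContinuousLinearMap.adjoint (D t) (timeLayer σ n F t)) where
  integrable := hD.integrable_adjoint (integrable_timeLayer hσ n hF)
  aemeasurable := (aemeasurable_timeAmp hF.aestronglyMeasurable).const_mul _
  enorm_le t := by
    have h1 : ‖ContinuousLinearMap.adjoint (D t) (timeLayer σ n F t)‖ₑ ≤
        ENNReal.ofReal C * ‖timeLayer σ n F t‖ₑ := by
      rw [← ofReal_norm, ← ofReal_norm, ← ENNReal.ofReal_mul (zero_le_one.trans hD.one_le)]
      exact ENNReal.ofReal_le_ofReal (hD.norm_adjoint_le _ _)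
    refine h1.trans ?_
    rw [mul_left_comm]
    gcongr
    exact enorm_timeLayer_le hσ n F t
  inner_le s t hst := enorm_inner_timeLayer_le hσ hD.one_le hD.dispersive n n F F hst

end TimeLayers

section EndpointBilinear
open Filter Topology

variable {X : Type*} [MeasurableSpace X] {μ : Measure X}
variable {H : Type*} [NormedAddCommGroup H] [InnerProductSpace ℂ H] [CompleteSpace H]

theorem sum_pow_natAbs_sub_le {q : ℝ} (hq0 : 0 ≤ q) (hq1 : q < 1) (M i : ℕ) :
    ∑ j ∈ Finset.range M, q ^ ((i : ℤ) - j).natAbs ≤ 2 * (1 - q)⁻¹ := by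
  have hs := summable_geometric_of_lt_one hq0 hq1
  have key : ∀ (S : Finset ℕ) (f : ℕ → ℕ), Set.InjOn f S → ∑ j ∈ S, q ^ f j ≤ (1 - q)⁻¹ := by
    intro S f hf
    rw [← tsum_geometric_of_lt_one hq0 hq1, ← Finset.sum_image (f := fun k => q ^ k) hf]
    exact hs.sum_le_tsum _ fun k _ => pow_nonneg hq0 k
  rw [← Finset.sum_filter_add_sum_filter_not (Finset.range M) (fun j => j ≤ i), two_mul]
  gcongr
  · refine key _ _ fun a ha b hb hab => ?_
    simp only [Finset.coe_filter, Finset.mem_range, mem_ofPred_eq] at ha hb hab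
    omega
  · refine key _ _ fun a ha b hb hab => ?_
    simp only [Finset.coe_filter, Finset.mem_range, mem_ofPred_eq] at ha hb hab
    omega

theorem min_div_zpow (m n : ℤ) :
    min (((2 : ℝ) ^ n)⁻¹ / ((2 : ℝ) ^ m)⁻¹) (((2 : ℝ) ^ m)⁻¹ / ((2 : ℝ) ^ n)⁻¹) =
      (1 / 2 : ℝ) ^ (m - n).natAbs := by
  have h : ∀ k l : ℤ, ((2 : ℝ) ^ k)⁻¹ / ((2 : ℝ) ^ l)⁻¹ = 2 ^ (l - k) := fun k l => by
    rw [inv_div_inv, zpow_sub₀ (by norm_num)]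
  rw [h, h, one_div, inv_pow, ← zpow_natCast, ← zpow_neg]
  rcases le_total m n with hmn | hmn
  · rw [min_eq_left (zpow_le_zpow_right₀ (by norm_num) (by omega))]
    congr 1; omega
  · rw [min_eq_right (zpow_le_zpow_right₀ (by norm_num) (by omega))]
    congr 1; omega

/-- Summation of the almost orthogonality estimate over all scales. -/
theorem sum_sum_almost_orthogonal_le {q : ℝ} (hq0 : 0 ≤ q) (hq1 : q < 1) (M : ℕ)
    (a b : ℕ → ℝ≥0∞) :
    ∑ i ∈ Finset.range M, ∑ j ∈ Finset.range M,
        ENNReal.ofReal (q ^ ((i : ℤ) - j).natAbs) * (a i + b j) ≤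
      ENNReal.ofReal (2 * (1 - q)⁻¹) *
        (∑ i ∈ Finset.range M, a i + ∑ j ∈ Finset.range M, b j) := by
  have h : ∀ i : ℕ, ∑ j ∈ Finset.range M, ENNReal.ofReal (q ^ ((i : ℤ) - j).natAbs) ≤
      ENNReal.ofReal (2 * (1 - q)⁻¹) := fun i => by
    rw [← ENNReal.ofReal_sum_of_nonneg fun j _ => pow_nonneg hq0 _]
    exact ENNReal.ofReal_le_ofReal (sum_pow_natAbs_sub_le hq0 hq1 M i)
  simp_rw [mul_add, Finset.sum_add_distrib]
  gcongr
  · rw [Finset.mul_sum]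
    gcongr with i
    rw [← Finset.sum_mul]
    gcongr
    exact h i
  · rw [Finset.sum_comm, Finset.mul_sum]
    gcongr with j
    rw [← Finset.sum_mul]
    gcongr
    refine le_trans (le_of_eq (Finset.sum_congr rfl fun i _ => ?_)) (h j)
    rw [← Int.natAbs_neg, neg_sub]

/-- The constant of the endpoint bilinear estimate. -/
noncomputable def bilinearConst (C σ : ℝ) : ℝ :=
  (9 + 10 / (σ - 1)) * (2 * (1 - (1 / 2) ^ (min 1 (2 * (σ - 1)) / 4))⁻¹) * C ^ 2 *
    (2 ^ (σ + 1)) ^ 2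

theorem enorm_integral_inner_timeSum_le {C σ : ℝ} (hσ : 1 < σ) {A D : ℝ → H →L[ℂ] Lp ℂ 2 μ}
    (hA : IsDispersive C σ A) (hD : IsDispersive C σ D)
    (hAD : DispersiveBound C σ fun s t => A s ∘L ContinuousLinearMap.adjoint (D t))
    {G F : ℝ → Lp ℂ 2 μ} (hG : Integrable G) (hF : Integrable F)
    {W : Set (ℝ × ℝ)} (hW : MeasurableSet W) (N : ℕ) :
    ‖∫ z in W, inner ℂ
      (ContinuousLinearMap.adjoint (A z.1) (∑ i ∈ Finset.range (2 * N), timeLayer σ (i - N) G z.1))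
      (ContinuousLinearMap.adjoint (D z.2) (∑ i ∈ Finset.range (2 * N), timeLayer σ (i - N) F z.2))
      ∂(volume.prod volume)‖ₑ ≤ ENNReal.ofReal (bilinearConst C σ) *
        ((∫⁻ t, eLpNorm (G t) (ENNReal.ofReal (endpointExp σ)) μ ^ 2) +
          ∫⁻ t, eLpNorm (F t) (ENNReal.ofReal (endpointExp σ)) μ ^ 2) := by
  have hσ1 : 0 < σ - 1 := by linarith
  have hC0 : 0 ≤ C := zero_le_one.trans hA.one_le
  set δ := min 1 (2 * (σ - 1)) / 4 with hδ
  have hδ0 : 0 < δ := by positivity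
  set q : ℝ := (1 / 2) ^ δ with hq
  have hq0 : 0 ≤ q := by positivity
  have hq1 : q < 1 := Real.rpow_lt_one (by norm_num) (by norm_num) hδ0
  set K := 9 + 10 / (σ - 1) with hK
  have hK0 : 0 ≤ K := by positivity
  set a : ℤ → ℝ → H := fun n t => ContinuousLinearMap.adjoint (A t) (timeLayer σ n G t) with ha
  set b : ℤ → ℝ → H := fun n t => ContinuousLinearMap.adjoint (D t) (timeLayer σ n F t) with hb
  have hLa : ∀ n, IsLayer σ ((2 : ℝ) ^ n)⁻¹ _ (a n) := fun n => hA.isLayer hσ n hG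
  have hLb : ∀ n, IsLayer σ ((2 : ℝ) ^ n)⁻¹ _ (b n) := fun n => hD.isLayer hσ n hF
  have hsum : ∀ (g : ℝ → Lp ℂ 2 μ), AEStronglyMeasurable g →
      ∑ i ∈ Finset.range (2 * N), ∫⁻ t, (ENNReal.ofReal C * timeAmp σ (i - N) g t) ^ 2 ≤
      ENNReal.ofReal (C ^ 2 * (2 ^ (σ + 1)) ^ 2) *
        ∫⁻ t, eLpNorm (g t) (ENNReal.ofReal (endpointExp σ)) μ ^ 2 := by
    intro g hg
    rw [← lintegral_finsetSum' _ fun i _ => ((aemeasurable_timeAmp hg).const_mul _).pow_const _,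
      ← lintegral_const_mul' _ _ ENNReal.ofReal_ne_top]
    refine lintegral_mono fun t => ?_
    simp_rw [mul_pow]
    rw [← Finset.mul_sum, ENNReal.ofReal_mul (by positivity), ENNReal.ofReal_pow hC0,
      ENNReal.ofReal_pow (by positivity), mul_assoc]
    gcongr
    exact sum_timeAmp_sq_le hσ N g t
  have hpair : ∀ i j : ℕ, ‖∫ z in W, inner ℂ (a (i - N) z.1) (b (j - N) z.2)
      ∂(volume.prod volume)‖ₑ ≤ ENNReal.ofReal K * (ENNReal.ofReal (q ^ ((i : ℤ) - j).natAbs) *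
        ((∫⁻ t, (ENNReal.ofReal C * timeAmp σ (i - N) G t) ^ 2) +
          ∫⁻ t, (ENNReal.ofReal C * timeAmp σ (j - N) F t) ^ 2)) := by
    intro i j
    refine (enorm_integral_inner_layers_le hσ (by positivity) (by positivity) (hLa _) (hLb _)
      (fun s t hst => enorm_inner_timeLayer_le hσ hA.one_le hAD _ _ G F hst) hW).trans ?_
    rw [min_div_zpow, ← hδ, ← mul_assoc, ENNReal.ofReal_mul hK0, hq, ← Real.rpow_natCast,
      ← Real.rpow_natCast, ← Real.rpow_mul (by norm_num), ← Real.rpow_mul (by norm_num),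
      mul_comm δ]
    apply le_of_eq
    congr 6
    omega
  have hexp : ∀ z : ℝ × ℝ, inner ℂ
      (ContinuousLinearMap.adjoint (A z.1) (∑ i ∈ Finset.range (2 * N), timeLayer σ (i - N) G z.1))
      (ContinuousLinearMap.adjoint (D z.2) (∑ i ∈ Finset.range (2 * N), timeLayer σ (i - N) F z.2))
      = ∑ i ∈ Finset.range (2 * N), ∑ j ∈ Finset.range (2 * N),
        inner ℂ (a (i - N) z.1) (b (j - N) z.2) := fun z => by
    simp_rw [map_sum, sum_inner, inner_sum, ha, hb]
  have hint : ∀ i j : ℕ, Integrable (fun z : ℝ × ℝ => inner ℂ (a (i - N) z.1) (b (j - N) z.2))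
      ((volume.prod volume).restrict W) := fun i j =>
    (integrable_inner_prod (hLa _).integrable (hLb _).integrable).integrableOn
  simp_rw [hexp]
  rw [integral_finsetSum _ fun i _ => integrable_finsetSum _ fun j _ => hint i j]
  simp_rw [integral_finsetSum _ fun j _ => hint _ j]
  calc _ ≤ ∑ i ∈ Finset.range (2 * N), ∑ j ∈ Finset.range (2 * N),
        ‖∫ z in W, inner ℂ (a (i - N) z.1) (b (j - N) z.2) ∂(volume.prod volume)‖ₑ :=
        (enorm_sum_le _ _).trans (Finset.sum_le_sum fun i _ => enorm_sum_le _ _)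
    _ ≤ ∑ i ∈ Finset.range (2 * N), ∑ j ∈ Finset.range (2 * N), ENNReal.ofReal K *
        (ENNReal.ofReal (q ^ ((i : ℤ) - j).natAbs) *
        ((∫⁻ t, (ENNReal.ofReal C * timeAmp σ (i - N) G t) ^ 2) +
          ∫⁻ t, (ENNReal.ofReal C * timeAmp σ (j - N) F t) ^ 2)) := by
        gcongr with i _ j _
        exact hpair i j
    _ ≤ ENNReal.ofReal K * (ENNReal.ofReal (2 * (1 - q)⁻¹) *
        (∑ i ∈ Finset.range (2 * N), (∫⁻ t, (ENNReal.ofReal C * timeAmp σ (i - N) G t) ^ 2) +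
          ∑ j ∈ Finset.range (2 * N), ∫⁻ t, (ENNReal.ofReal C * timeAmp σ (j - N) F t) ^ 2)) := by
        simp_rw [← Finset.mul_sum]
        gcongr
        exact sum_sum_almost_orthogonal_le hq0 hq1 _ _ _
    _ ≤ ENNReal.ofReal K * (ENNReal.ofReal (2 * (1 - q)⁻¹) *
        (ENNReal.ofReal (C ^ 2 * (2 ^ (σ + 1)) ^ 2) *
        (∫⁻ t, eLpNorm (G t) (ENNReal.ofReal (endpointExp σ)) μ ^ 2) +
        ENNReal.ofReal (C ^ 2 * (2 ^ (σ + 1)) ^ 2) *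
        ∫⁻ t, eLpNorm (F t) (ENNReal.ofReal (endpointExp σ)) μ ^ 2)) := by
        gcongr
        · exact hsum G hG.aestronglyMeasurable
        · exact hsum F hF.aestronglyMeasurable
    _ = _ := by
        have : 0 < 1 - q := by linarith
        rw [← mul_add, ← mul_assoc, ← mul_assoc, ← ENNReal.ofReal_mul hK0,
          ← ENNReal.ofReal_mul (by positivity), bilinearConst]
        congr 2
        ring

/-- The endpoint bilinear Strichartz estimate, over an arbitrary set of pairs of times. -/
theorem enorm_integral_inner_adjoint_le {C σ : ℝ} (hσ : 1 < σ) {A D : ℝ → H →L[ℂ] Lp ℂ 2 μ}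
    (hA : IsDispersive C σ A) (hD : IsDispersive C σ D)
    (hAD : DispersiveBound C σ fun s t => A s ∘L ContinuousLinearMap.adjoint (D t))
    {G F : ℝ → Lp ℂ 2 μ} (hG : Integrable G) (hF : Integrable F)
    {W : Set (ℝ × ℝ)} (hW : MeasurableSet W) :
    ‖∫ z in W, inner ℂ (ContinuousLinearMap.adjoint (A z.1) (G z.1))
      (ContinuousLinearMap.adjoint (D z.2) (F z.2)) ∂(volume.prod volume)‖ₑ ≤
      ENNReal.ofReal (bilinearConst C σ) *
        ((∫⁻ t, eLpNorm (G t) (ENNReal.ofReal (endpointExp σ)) μ ^ 2) +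
          ∫⁻ t, eLpNorm (F t) (ENNReal.ofReal (endpointExp σ)) μ ^ 2) := by
  have hC0 : 0 < C := zero_lt_one.trans_le hA.one_le
  have hσ1 : 0 < σ - 1 := by linarith
  have hKpos : 0 < bilinearConst C σ := by
    have : ((1 : ℝ) / 2) ^ (min 1 (2 * (σ - 1)) / 4) < 1 :=
      Real.rpow_lt_one (by norm_num) (by norm_num) (by positivity)
    have : 0 < 1 - ((1 : ℝ) / 2) ^ (min 1 (2 * (σ - 1)) / 4) := by linarith
    unfold bilinearConst
    positivity
  set p := ENNReal.ofReal (endpointExp σ)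
  rcases eq_or_ne ((∫⁻ t, eLpNorm (G t) p μ ^ 2) + ∫⁻ t, eLpNorm (F t) p μ ^ 2) ∞ with htop | htop
  · rw [htop, ENNReal.mul_top (by simpa using hKpos)]
    exact le_top
  have hfin : ∀ {g : ℝ → Lp ℂ 2 μ}, AEStronglyMeasurable g → ∫⁻ t, eLpNorm (g t) p μ ^ 2 ≠ ∞ →
      ∀ᵐ t, eLpNorm (g t) p μ ≠ ∞ := by
    intro g hg h
    filter_upwards [ae_lt_top' ((hg.aemeasurable_eLpNorm p).pow_const 2) h] with t ht
    intro h'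
    simp [h'] at ht
  have hG' := hfin hG.aestronglyMeasurable (ne_top_of_le_ne_top htop le_self_add)
  have hF' := hfin hF.aestronglyMeasurable (ne_top_of_le_ne_top htop le_add_self)
  have hmeas : ∀ {T : ℝ → H →L[ℂ] Lp ℂ 2 μ} (_ : IsDispersive C σ T) {g : ℝ → Lp ℂ 2 μ}
      (_ : Integrable g) (N : ℕ), Integrable fun t => ContinuousLinearMap.adjoint (T t)
        (∑ i ∈ Finset.range (2 * N), timeLayer σ (i - N) g t) := fun hT _ hg N =>
    hT.integrable_adjoint (integrable_finsetSum _ fun i _ => integrable_timeLayer hσ _ hg)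
  have hlim := tendsto_integral_of_dominated_convergence
    (μ := ((volume : Measure ℝ).prod (volume : Measure ℝ)).restrict W)
    (F := fun (N : ℕ) (z : ℝ × ℝ) => inner ℂ
      (ContinuousLinearMap.adjoint (A z.1) (∑ i ∈ Finset.range (2 * N), timeLayer σ (i - N) G z.1))
      (ContinuousLinearMap.adjoint (D z.2) (∑ i ∈ Finset.range (2 * N), timeLayer σ (i - N) F z.2)))
    (f := fun z => inner ℂ (ContinuousLinearMap.adjoint (A z.1) (G z.1))
      (ContinuousLinearMap.adjoint (D z.2) (F z.2)))
    (fun z => (C * ‖G z.1‖) * (C * ‖F z.2‖))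
    (fun N => (integrable_inner_prod (hmeas hA hG N) (hmeas hD hF N)).aestronglyMeasurable.restrict)
    (((hG.norm.const_mul C).mul_prod (hF.norm.const_mul C)).integrableOn)
    (fun N => Eventually.of_forall fun z => by
      refine (norm_inner_le_norm _ _).trans ?_
      gcongr
      · exact (hA.norm_adjoint_le _ _).trans (by gcongr; exact norm_timeSum_le hσ N G _)
      · exact (hD.norm_adjoint_le _ _).trans (by gcongr; exact norm_timeSum_le hσ N F _))
    (by
      refine ae_restrict_of_ae ?_
      filter_upwards [Measure.quasiMeasurePreserving_fst.ae hG',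
        Measure.quasiMeasurePreserving_snd.ae hF'] with z h1 h2
      refine Tendsto.inner ?_ ?_
      · exact ((ContinuousLinearMap.adjoint (A z.1)).continuous.tendsto _).comp
          (tendsto_timeSum hσ G h1)
      · exact ((ContinuousLinearMap.adjoint (D z.2)).continuous.tendsto _).comp
          (tendsto_timeSum hσ F h2))
  refine le_of_tendsto ((continuous_enorm.tendsto _).comp hlim) (Eventually.of_forall fun N => ?_)
  exact enorm_integral_inner_timeSum_le hσ hA hD hAD hG hF hW N

end EndpointBilinear

section Duality
open Filter Topology

theorem rpow_sub_rpow_mul_le {s a b : ℝ} (hs : 0 < s) (ha : 0 ≤ a) (hb : 0 < b) :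
    (b ^ s - a ^ s) * a ≤ s * b ^ s * (b - a) := by
  rcases ha.eq_or_lt with rfl | ha
  · have : 0 ≤ s * b ^ s * b := by positivity
    simpa using this
  have h1 := one_add_mul_self_le_rpow_one_add (s := a / b - 1) (p := s + 1)
    (by have : 0 ≤ a / b := by positivity
        linarith) (by linarith)
  have h2 : (1 + (a / b - 1)) ^ (s + 1) = (a ^ s * a) / (b ^ s * b) := by
    rw [add_sub_cancel, Real.div_rpow ha.le hb.le, Real.rpow_add_one ha.ne', Real.rpow_add_one hb.ne']
  rw [h2, le_div_iff₀ (by positivity)] at h1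
  have h3 : (1 + (s + 1) * (a / b - 1)) * (b ^ s * b) = b ^ s * b + (s + 1) * (a - b) * b ^ s := by
    field_simp
  rw [h3] at h1
  nlinarith

theorem norm_rpow_smul_sub_le {s R : ℝ} (hs : 0 < s) {z w : ℂ} (hz : ‖z‖ ≤ R) (hw : ‖w‖ ≤ R) :
    ‖‖z‖ ^ s • z - ‖w‖ ^ s • w‖ ≤ (1 + s) * R ^ s * ‖z - w‖ := by
  wlog hwz : ‖w‖ ≤ ‖z‖ generalizing z w
  · rw [norm_sub_rev, norm_sub_rev z]
    exact this hw hz (le_of_not_ge hwz)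
  rcases (norm_nonneg z).eq_or_lt with h0 | h0
  · have h1 : z = 0 := norm_eq_zero.1 h0.symm
    have h2 : w = 0 := norm_eq_zero.1 (le_antisymm (by rwa [h0]) (norm_nonneg _))
    simp [h1, h2]
  have key : ‖z‖ ^ s • z - ‖w‖ ^ s • w = ‖z‖ ^ s • (z - w) + (‖z‖ ^ s - ‖w‖ ^ s) • w := by
    rw [smul_sub, sub_smul]; abel
  have h1 : 0 ≤ ‖z‖ ^ s - ‖w‖ ^ s := sub_nonneg.2 (by gcongr)
  rw [key]
  calc _ ≤ ‖‖z‖ ^ s • (z - w)‖ + ‖(‖z‖ ^ s - ‖w‖ ^ s) • w‖ := norm_add_le _ _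
    _ = ‖z‖ ^ s * ‖z - w‖ + (‖z‖ ^ s - ‖w‖ ^ s) * ‖w‖ := by
        rw [norm_smul, norm_smul, Real.norm_of_nonneg h1, Real.norm_of_nonneg (by positivity)]
    _ ≤ ‖z‖ ^ s * ‖z - w‖ + s * ‖z‖ ^ s * (‖z‖ - ‖w‖) := by
        exact add_le_add le_rfl (rpow_sub_rpow_mul_le hs (norm_nonneg _) h0)
    _ ≤ ‖z‖ ^ s * ‖z - w‖ + s * ‖z‖ ^ s * ‖z - w‖ := by
        gcongr
        exact norm_sub_norm_le z w
    _ = (1 + s) * ‖z‖ ^ s * ‖z - w‖ := by ring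
    _ ≤ _ := by gcongr

/-- The truncated duality map of the exponent `ρ`. -/
noncomputable def dualTrunc (ρ R : ℝ) (z : ℂ) : ℂ := ‖radialTrunc R z‖ ^ (ρ - 2) • radialTrunc R z

theorem dualTrunc_zero (ρ R : ℝ) : dualTrunc ρ R 0 = 0 := by simp [dualTrunc, radialTrunc_zero]

theorem lipschitzWith_dualTrunc {ρ R : ℝ} (hρ : 2 < ρ) (hR : 0 < R) :
    LipschitzWith ((1 + (ρ - 2)) * R ^ (ρ - 2) * 2).toNNReal (dualTrunc ρ R) := by
  have hρ2 : 0 < ρ - 2 := by linarith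
  refine LipschitzWith.of_dist_le_mul fun z w => ?_
  rw [Real.coe_toNNReal _ (by positivity), dist_eq_norm]
  have h : ∀ z, ‖radialTrunc R z‖ ≤ R := fun z => by
    rw [norm_radialTrunc, abs_of_pos hR]; exact min_le_left _ _
  refine (norm_rpow_smul_sub_le hρ2 (h z) (h w)).trans ?_
  rw [mul_assoc _ (2 : ℝ)]
  gcongr
  rw [← dist_eq_norm]
  exact (lipschitzWith_radialTrunc R).dist_le_mul z w

theorem norm_dualTrunc {ρ R : ℝ} (hρ : 2 < ρ) (z : ℂ) :
    ‖dualTrunc ρ R z‖ = ‖radialTrunc R z‖ ^ (ρ - 1) := by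
  have hρ1 : ρ - 1 ≠ 0 := by linarith
  rw [dualTrunc, norm_smul, Real.norm_of_nonneg (by positivity)]
  rcases (norm_nonneg (radialTrunc R z)).eq_or_lt with h | h
  · rw [← h, Real.zero_rpow hρ1, mul_zero]
  · rw [← Real.rpow_add_one h.ne']; congr 1; ring

theorem rpow_norm_le_re_inner_dualTrunc {ρ : ℝ} (hρ : 2 < ρ) (R : ℝ) (z : ℂ) :
    ‖radialTrunc R z‖ ^ ρ ≤ (inner ℂ (dualTrunc ρ R z) z).re := by
  rcases eq_or_ne z 0 with rfl | hz
  · simp [radialTrunc_zero, Real.zero_rpow (by linarith : ρ ≠ 0)]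
  have hz' : 0 < ‖z‖ := norm_pos_iff.2 hz
  have h1 : (inner ℂ (dualTrunc ρ R z) z).re =
      ‖radialTrunc R z‖ ^ (ρ - 2) * (min |R| ‖z‖ * ‖z‖) := by
    rw [dualTrunc]
    nth_rewrite 2 [radialTrunc_eq_smul]
    rw [inner_smul_left_eq_smul, inner_smul_left_eq_smul, smul_smul, Complex.smul_re,
      inner_self_eq_norm_sq_to_K]
    have : (((‖z‖ : ℝ) : ℂ) ^ 2).re = ‖z‖ ^ 2 := by
      rw [← Complex.ofReal_pow, Complex.ofReal_re]
    simp only [Complex.coe_algebraMap, this, smul_eq_mul]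
    field_simp
  rw [h1, norm_radialTrunc]
  rcases (le_min (abs_nonneg R) (norm_nonneg z)).eq_or_lt with h | h
  · rw [← h, Real.zero_rpow (by linarith : ρ ≠ 0), Real.zero_rpow (by linarith : ρ - 2 ≠ 0)]
    simp
  · calc min |R| ‖z‖ ^ ρ = min |R| ‖z‖ ^ (ρ - 2) * min |R| ‖z‖ ^ 2 := by
          rw [← Real.rpow_natCast, ← Real.rpow_add h]; congr 1; norm_num
      _ ≤ _ := by
          rw [sq]
          gcongr
          exact min_le_right _ _

variable {X : Type*} [MeasurableSpace X] {μ : Measure X}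

/-- The truncated duality map on square integrable functions. -/
noncomputable def dualLp {ρ R : ℝ} (hρ : 2 < ρ) (hR : 0 < R) (f : Lp ℂ 2 μ) : Lp ℂ 2 μ :=
  (lipschitzWith_dualTrunc hρ hR).compLp (dualTrunc_zero ρ R) f

theorem coeFn_dualLp {ρ R : ℝ} (hρ : 2 < ρ) (hR : 0 < R) (f : Lp ℂ 2 μ) :
    dualLp hρ hR f =ᵐ[μ] fun x => dualTrunc ρ R (f x) :=
  (lipschitzWith_dualTrunc hρ hR).coeFn_compLp (dualTrunc_zero ρ R) f

theorem continuous_dualLp {ρ R : ℝ} (hρ : 2 < ρ) (hR : 0 < R) :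
    Continuous (dualLp (μ := μ) hρ hR) :=
  (lipschitzWith_dualTrunc hρ hR).continuous_compLp (dualTrunc_zero ρ R)

theorem norm_dualLp_le {ρ R : ℝ} (hρ : 2 < ρ) (hR : 0 < R) (f : Lp ℂ 2 μ) :
    ‖dualLp hρ hR f‖ ≤ R ^ (ρ - 2) * ‖f‖ := by
  refine Lp.norm_le_mul_norm_of_ae_le_mul ?_
  filter_upwards [coeFn_dualLp hρ hR f] with x hx
  rw [hx, dualTrunc, norm_smul, Real.norm_of_nonneg (by positivity), norm_radialTrunc,
    abs_of_pos hR]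
  have : 0 ≤ ρ - 2 := by linarith
  gcongr
  · exact min_le_left _ _
  · exact min_le_right _ _

theorem eLpNorm_truncLp_rpow {ρ : ℝ} (hρ : 2 < ρ) (R : ℝ) (f : Lp ℂ 2 μ) :
    eLpNorm (truncLp R f) (ENNReal.ofReal ρ) μ ^ ρ = ∫⁻ x, ‖radialTrunc R (f x)‖ₑ ^ ρ ∂μ := by
  have hρ0 : 0 < ρ := by linarith
  rw [eLpNorm_congr_ae (coeFn_truncLp R f), eLpNorm_eq_lintegral_rpow_enorm_toReal (by simpa)
    (by simp), ENNReal.toReal_ofReal hρ0.le, ← ENNReal.rpow_mul, one_div, inv_mul_cancel₀ hρ0.ne',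
    ENNReal.rpow_one]

theorem eLpNorm_truncLp_rpow_le {ρ R : ℝ} (hρ : 2 < ρ) (hR : 0 < R) (f : Lp ℂ 2 μ) :
    eLpNorm (truncLp R f) (ENNReal.ofReal ρ) μ ^ ρ ≤ ENNReal.ofReal (R ^ (ρ - 2)) * ‖f‖ₑ ^ 2 := by
  have hρ0 : 0 < ρ := by linarith
  rw [eLpNorm_truncLp_rpow hρ, Lp.enorm_def, eLpNorm_eq_lintegral_rpow_enorm_toReal (by simp)
    (by simp), ← ENNReal.rpow_natCast, ← ENNReal.rpow_mul]
  simp only [ENNReal.toReal_ofNat, one_div, Nat.cast_ofNat, ne_eq, OfNat.ofNat_ne_zero,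
    not_false_eq_true, inv_mul_cancel₀, ENNReal.rpow_one]
  rw [← lintegral_const_mul' _ _ ENNReal.ofReal_ne_top]
  refine lintegral_mono fun x => ?_
  rw [← ofReal_norm, ← ofReal_norm, ENNReal.ofReal_rpow_of_nonneg (norm_nonneg _) hρ0.le,
    ENNReal.rpow_ofNat, ← ENNReal.ofReal_pow (norm_nonneg _), ← ENNReal.ofReal_mul (by positivity)]
  refine ENNReal.ofReal_le_ofReal ?_
  rw [norm_radialTrunc, abs_of_pos hR]
  rcases (le_min hR.le (norm_nonneg (f x))).eq_or_lt with h | h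
  · rw [← h, Real.zero_rpow hρ0.ne']; positivity
  · calc min R ‖f x‖ ^ ρ = min R ‖f x‖ ^ (ρ - 2) * min R ‖f x‖ ^ 2 := by
          rw [← Real.rpow_natCast, ← Real.rpow_add h]; congr 1; norm_num
      _ ≤ _ := by
          have : 0 ≤ ρ - 2 := by linarith
          gcongr
          · exact min_le_left _ _
          · exact min_le_right _ _

theorem eLpNorm_truncLp_lt_top {ρ R : ℝ} (hρ : 2 < ρ) (hR : 0 < R) (f : Lp ℂ 2 μ) :
    eLpNorm (truncLp R f) (ENNReal.ofReal ρ) μ < ∞ := by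
  refine (ENNReal.rpow_lt_top_iff_of_pos (by linarith : 0 < ρ)).1 ?_
  exact (eLpNorm_truncLp_rpow_le hρ hR f).trans_lt
    (ENNReal.mul_lt_top ENNReal.ofReal_lt_top (ENNReal.pow_lt_top enorm_lt_top))

theorem eLpNorm_dualLp {ρ R : ℝ} (hρ : 2 < ρ) (hR : 0 < R) (f : Lp ℂ 2 μ) :
    eLpNorm (dualLp hρ hR f) (ENNReal.ofReal (ρ / (ρ - 1))) μ =
      eLpNorm (truncLp R f) (ENNReal.ofReal ρ) μ ^ (ρ - 1) := by
  have hρ0 : 0 < ρ := by linarith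
  have hρ1 : 0 < ρ - 1 := by linarith
  have hp : 0 < ρ / (ρ - 1) := by positivity
  rw [eLpNorm_congr_ae (coeFn_dualLp hρ hR f), eLpNorm_congr_ae (coeFn_truncLp R f),
    eLpNorm_eq_lintegral_rpow_enorm_toReal (by simpa) (by simp),
    eLpNorm_eq_lintegral_rpow_enorm_toReal (by simpa) (by simp),
    ENNReal.toReal_ofReal hρ0.le, ENNReal.toReal_ofReal hp.le, ← ENNReal.rpow_mul]
  congr 1
  · refine lintegral_congr fun x => ?_
    rw [← ofReal_norm, norm_dualTrunc hρ, ← ENNReal.ofReal_rpow_of_nonneg (norm_nonneg _) hρ1.le,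
      ← ENNReal.rpow_mul, mul_div_cancel₀ _ hρ1.ne', ofReal_norm]
  · field_simp

theorem eLpNorm_truncLp_rpow_le_re_inner {ρ R : ℝ} (hρ : 2 < ρ) (hR : 0 < R) (f : Lp ℂ 2 μ) :
    (eLpNorm (truncLp R f) (ENNReal.ofReal ρ) μ).toReal ^ ρ ≤ (inner ℂ (dualLp hρ hR f) f).re := by
  have hρ0 : 0 < ρ := by linarith
  have hi := L2.integrable_inner (𝕜 := ℂ) (dualLp hρ hR f) f
  have hnn : ∀ᵐ x ∂μ, ‖radialTrunc R (f x)‖ ^ ρ ≤ (inner ℂ (dualLp hρ hR f x) (f x)).re := by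
    filter_upwards [coeFn_dualLp hρ hR f] with x hx
    rw [hx]
    exact rpow_norm_le_re_inner_dualTrunc hρ R (f x)
  have hre : (inner ℂ (dualLp hρ hR f) f).re = ∫ x, (inner ℂ (dualLp hρ hR f x) (f x)).re ∂μ := by
    rw [L2.inner_def]
    exact (integral_re hi).symm
  rw [ENNReal.toReal_rpow, eLpNorm_truncLp_rpow hρ, hre,
    integral_eq_lintegral_of_nonneg_ae (hnn.mono fun x hx => (by positivity : (0 : ℝ) ≤ _).trans hx)
      hi.re.aestronglyMeasurable]
  refine ENNReal.toReal_mono ?_ (lintegral_mono_ae ?_)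
  · have := hi.re.lintegral_lt_top
    exact this.ne
  · filter_upwards [hnn] with x hx
    rw [← ofReal_norm, ENNReal.ofReal_rpow_of_nonneg (norm_nonneg _) hρ0.le]
    exact ENNReal.ofReal_le_ofReal hx

end Duality

section MixedDuality
open Filter Topology

variable {X : Type*} [MeasurableSpace X] {μ : Measure X}

theorem lintegral_indicator_truncLp_le {ρ K B : ℝ} (hρ : 2 < ρ) (hK : 0 < K) {S : ℝ≥0∞}
    {u : ℝ → Lp ℂ 2 μ} (hu : AEStronglyMeasurable u) (hB : ∀ t, ‖u t‖ ≤ B)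
    (h : ∀ G : ℝ → Lp ℂ 2 μ, Integrable G → ‖∫ t, inner ℂ (G t) (u t)‖ₑ ≤
      ENNReal.ofReal K * (∫⁻ t, eLpNorm (G t) (ENNReal.ofReal (ρ / (ρ - 1))) μ ^ 2) + S)
    {R T ε : ℝ} (hR : 0 < R) (hε : 0 < ε) :
    ∫⁻ t, ({t | |t| ≤ T ∧ ENNReal.ofReal ε ≤
      eLpNorm (truncLp R (u t)) (ENNReal.ofReal ρ) μ} : Set ℝ).indicator
      (fun t => eLpNorm (truncLp R (u t)) (ENNReal.ofReal ρ) μ ^ 2) t ≤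
      ENNReal.ofReal (4 * K) * S := by
  have hρ0 : 0 < ρ := by linarith
  have hρ1 : 0 < ρ - 1 := by linarith
  have hB0 : 0 ≤ B := (norm_nonneg _).trans (hB 0)
  set a : ℝ → ℝ≥0∞ := fun t => eLpNorm (truncLp R (u t)) (ENNReal.ofReal ρ) μ with ha
  have ham : AEMeasurable a :=
    ((continuous_truncLp _).comp_aestronglyMeasurable hu).aemeasurable_eLpNorm _
  have hafin : ∀ t, a t ≠ ∞ := fun t => (eLpNorm_truncLp_lt_top hρ hR (u t)).ne
  set E : Set ℝ := {t | |t| ≤ T ∧ ENNReal.ofReal ε ≤ a t} with hE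
  have hEm : NullMeasurableSet E :=
    (measurableSet_le (f := fun t : ℝ => |t|) (g := fun _ => T)
      (by fun_prop) measurable_const).nullMeasurableSet.inter (nullMeasurableSet_le aemeasurable_const ham)
  have hEI : ∀ t ∈ E, t ∈ Icc (-T) T := fun t ht => abs_le.1 ht.1
  set m : ℝ → ℝ≥0∞ := E.indicator (fun t => a t ^ 2) with hm
  have hmm : AEMeasurable m := (ham.pow_const 2).indicator₀ hEm
  have hMfin : ∫⁻ t, m t ≠ ∞ := by
    set c := (ENNReal.ofReal (R ^ (ρ - 2)) * ENNReal.ofReal B ^ 2) ^ (ρ⁻¹) with hc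
    have hc' : c < ∞ := ENNReal.rpow_lt_top_of_nonneg (by positivity)
      (ENNReal.mul_lt_top ENNReal.ofReal_lt_top (ENNReal.pow_lt_top ENNReal.ofReal_lt_top)).ne
    have hac : ∀ t, a t ≤ c := fun t => by
      rw [hc, ENNReal.le_rpow_inv_iff hρ0]
      refine (eLpNorm_truncLp_rpow_le hρ hR (u t)).trans ?_
      gcongr
      rw [← ofReal_norm]
      exact ENNReal.ofReal_le_ofReal (hB t)
    have hle : ∫⁻ t, m t ≤ ∫⁻ t in Icc (-T) T, c ^ 2 := by
      rw [← lintegral_indicator measurableSet_Icc]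
      refine lintegral_mono fun t => ?_
      by_cases ht : t ∈ E
      · rw [hm, indicator_of_mem ht, indicator_of_mem (hEI t ht)]
        gcongr
        exact hac t
      · rw [hm, indicator_of_notMem ht]
        exact zero_le
    refine (hle.trans_lt ?_).ne
    rw [setLIntegral_const]
    exact ENNReal.mul_lt_top (ENNReal.pow_lt_top hc') measure_Icc_lt_top
  set θ : ℝ := (2 * K)⁻¹ with hθ
  have hθ0 : 0 < θ := by positivity
  set w : ℝ → ℝ := E.indicator (fun t => (a t).toReal ^ (2 - ρ)) with hw
  have hwm : AEMeasurable w := (ham.ennreal_toReal.pow_const _).indicator₀ hEm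
  have hw0 : ∀ t, 0 ≤ w t := fun t => indicator_nonneg (fun t _ => by positivity) t
  have hapos : ∀ t ∈ E, ε ≤ (a t).toReal := fun t ht =>
    (ENNReal.ofReal_le_iff_le_toReal (hafin t)).1 ht.2
  set G : ℝ → Lp ℂ 2 μ := fun t => (θ * w t) • dualLp hρ hR (u t) with hG
  have hGm : AEStronglyMeasurable G := (hwm.const_mul θ).aestronglyMeasurable.smul
    ((continuous_dualLp hρ hR).comp_aestronglyMeasurable hu)
  have hGle : ∀ t, ‖G t‖ ≤ (Icc (-T) T).indicator
      (fun _ => θ * ε ^ (2 - ρ) * (R ^ (ρ - 2) * B)) t := by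
    intro t
    by_cases ht : t ∈ E
    · rw [indicator_of_mem (hEI t ht), hG, norm_smul, Real.norm_of_nonneg
        (mul_nonneg hθ0.le (hw0 t)), hw, indicator_of_mem ht]
      have h1 : (a t).toReal ^ (2 - ρ) ≤ ε ^ (2 - ρ) :=
        Real.rpow_le_rpow_of_nonpos hε (hapos t ht) (by linarith)
      have h2 : ‖dualLp hρ hR (u t)‖ ≤ R ^ (ρ - 2) * B :=
        (norm_dualLp_le hρ hR (u t)).trans (by gcongr; exact hB t)
      gcongr
    · rw [hG]
      simp only [hw, indicator_of_notMem ht, mul_zero, zero_smul, norm_zero]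
      exact indicator_nonneg (fun _ _ => by positivity) _
  have hGi : Integrable G := by
    refine Integrable.mono' ?_ hGm (Eventually.of_forall hGle)
    exact (integrable_indicator_iff measurableSet_Icc).2
      (integrableOn_const measure_Icc_lt_top.ne)
  have hGp : ∀ t, eLpNorm (G t) (ENNReal.ofReal (ρ / (ρ - 1))) μ ^ 2 = ENNReal.ofReal θ ^ 2 * m t := by
    intro t
    rw [hG, eLpNorm_congr_ae (Lp.coeFn_smul _ _), eLpNorm_const_smul, eLpNorm_dualLp,
      Real.enorm_eq_ofReal (mul_nonneg hθ0.le (hw0 t)), ENNReal.ofReal_mul hθ0.le, mul_assoc,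
      mul_pow]
    congr 1
    by_cases ht : t ∈ E
    · have h1 : 0 < (a t).toReal := hε.trans_le (hapos t ht)
      rw [hw, hm, indicator_of_mem ht, indicator_of_mem ht,
        ← ENNReal.ofReal_rpow_of_pos h1, ENNReal.ofReal_toReal (hafin t),
        ← ENNReal.rpow_add _ _ (ENNReal.toReal_pos_iff.1 h1).1.ne' (hafin t)]
      congr 1
      conv_rhs => rw [← ENNReal.rpow_one (a t)]
      congr 1; ring
    · rw [hw, hm, indicator_of_notMem ht, indicator_of_notMem ht]
      simp
  have hin : Integrable fun t => inner ℂ (G t) (u t) := by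
    refine Integrable.mono' (hGi.norm.mul_const B) (hGm.inner hu) (Eventually.of_forall fun t => ?_)
    refine (norm_inner_le_norm _ _).trans ?_
    gcongr
    exact hB t
  have hre : ∀ t, θ * (m t).toReal ≤ (inner ℂ (G t) (u t)).re := by
    intro t
    have h1 : (inner ℂ (G t) (u t)).re = θ * w t * (inner ℂ (dualLp hρ hR (u t)) (u t)).re := by
      rw [hG, inner_smul_left_eq_smul, Complex.smul_re, smul_eq_mul]
    have h2 := eLpNorm_truncLp_rpow_le_re_inner hρ hR (u t)
    rw [h1, mul_assoc]
    gcongr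
    by_cases ht : t ∈ E
    · have h3 : 0 < (a t).toReal := hε.trans_le (hapos t ht)
      refine le_trans (le_of_eq ?_) (mul_le_mul_of_nonneg_left h2 (hw0 t))
      rw [hm, hw, indicator_of_mem ht, indicator_of_mem ht, ← Real.rpow_add h3,
        ENNReal.toReal_pow, ← Real.rpow_natCast]
      congr 1; push_cast; ring
    · rw [hm, hw, indicator_of_notMem ht, indicator_of_notMem ht]
      simp
  have hmfin : ∀ t, m t ≠ ∞ := fun t => by
    by_cases ht : t ∈ E
    · rw [hm, indicator_of_mem ht]
      exact ENNReal.pow_ne_top (hafin t)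
    · rw [hm, indicator_of_notMem ht]; simp
  have hlow : ENNReal.ofReal θ * ∫⁻ t, m t ≤ ‖∫ t, inner ℂ (G t) (u t)‖ₑ := by
    have h1 : ENNReal.ofReal (∫ t, (inner ℂ (G t) (u t)).re) ≤ ‖∫ t, inner ℂ (G t) (u t)‖ₑ := by
      rw [← ofReal_norm]
      refine ENNReal.ofReal_le_ofReal ?_
      have : ∫ t, (inner ℂ (G t) (u t)).re = (∫ t, inner ℂ (G t) (u t)).re := integral_re hin
      rw [this]
      exact Complex.re_le_norm _
    refine le_trans ?_ h1
    have h2 : Integrable fun t => (inner ℂ (G t) (u t)).re := hin.re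
    rw [ofReal_integral_eq_lintegral_ofReal h2 (Eventually.of_forall fun t =>
      (mul_nonneg hθ0.le ENNReal.toReal_nonneg).trans (hre t)),
      ← lintegral_const_mul' _ _ ENNReal.ofReal_ne_top]
    refine lintegral_mono fun t => ?_
    rw [← ENNReal.ofReal_toReal (hmfin t), ← ENNReal.ofReal_mul hθ0.le]
    exact ENNReal.ofReal_le_ofReal (hre t)
  have hmain := hlow.trans (h G hGi)
  simp_rw [hGp] at hmain
  rw [lintegral_const_mul' _ _ (by finiteness)] at hmain
  set M := ∫⁻ t, m t with hM
  have hK1 : ENNReal.ofReal K * (ENNReal.ofReal θ ^ 2 * M) = ENNReal.ofReal (θ / 2) * M := by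
    rw [← mul_assoc, ← ENNReal.ofReal_pow hθ0.le, ← ENNReal.ofReal_mul hK.le]
    congr 2
    rw [hθ]; field_simp
  have hK2 : ENNReal.ofReal θ * M = ENNReal.ofReal (θ / 2) * M + ENNReal.ofReal (θ / 2) * M := by
    rw [← add_mul, ← ENNReal.ofReal_add (by positivity) (by positivity), add_halves]
  rw [hK1, hK2] at hmain
  have hcancel : ENNReal.ofReal (θ / 2) * M ≤ S :=
    (ENNReal.add_le_add_iff_left (by finiteness)).1 hmain
  calc M = ENNReal.ofReal (4 * K) * (ENNReal.ofReal (θ / 2) * M) := by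
        rw [← mul_assoc, ← ENNReal.ofReal_mul (by positivity)]
        have : 4 * K * (θ / 2) = 1 := by rw [hθ]; field_simp; norm_num
        rw [this, ENNReal.ofReal_one, one_mul]
    _ ≤ _ := by gcongr

/-- A dual characterization of the norm of `L²_t L^ρ_x`. -/
theorem lintegral_eLpNorm_sq_le_of_forall {ρ K B : ℝ} (hρ : 2 < ρ) (hK : 0 < K) {S : ℝ≥0∞}
    {u : ℝ → Lp ℂ 2 μ} (hu : AEStronglyMeasurable u) (hB : ∀ t, ‖u t‖ ≤ B)
    (h : ∀ G : ℝ → Lp ℂ 2 μ, Integrable G → ‖∫ t, inner ℂ (G t) (u t)‖ₑ ≤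
      ENNReal.ofReal K * (∫⁻ t, eLpNorm (G t) (ENNReal.ofReal (ρ / (ρ - 1))) μ ^ 2) + S) :
    ∫⁻ t, eLpNorm (u t) (ENNReal.ofReal ρ) μ ^ 2 ≤ ENNReal.ofReal (4 * K) * S := by
  set a : ℕ → ℝ → ℝ≥0∞ := fun n t => eLpNorm (truncLp (n + 1 : ℝ) (u t)) (ENNReal.ofReal ρ) μ
    with ha
  have ham : ∀ n, AEMeasurable (a n) := fun n =>
    ((continuous_truncLp _).comp_aestronglyMeasurable hu).aemeasurable_eLpNorm _
  set E : ℕ → Set ℝ := fun n => {t | |t| ≤ n ∧ ENNReal.ofReal ((n : ℝ) + 1)⁻¹ ≤ a n t} with hE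
  have hpt : ∀ t, eLpNorm (u t) (ENNReal.ofReal ρ) μ ^ 2 ≤
      liminf (fun n => (E n).indicator (fun t => a n t ^ 2) t) atTop := by
    intro t
    have hliminf : eLpNorm (u t) (ENNReal.ofReal ρ) μ ≤ liminf (fun n => a n t) atTop := by
      have hR : Tendsto (fun n : ℕ => (n + 1 : ℝ)) atTop atTop :=
        tendsto_natCast_atTop_atTop.atTop_add tendsto_const_nhds
      refine Lp.eLpNorm_lim_le_liminf_eLpNorm (fun n => Lp.aestronglyMeasurable _) _ ?_
      filter_upwards [ae_all_iff.2 fun n : ℕ => coeFn_truncLp (n + 1 : ℝ) (u t)] with x hx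
      simp only [hx]
      exact tendsto_radialTrunc_atTop hR _
    set Y := liminf (fun n => (E n).indicator (fun t => a n t ^ 2) t) atTop with hY
    have hd : ∀ d < eLpNorm (u t) (ENNReal.ofReal ρ) μ, d ≤ Y ^ (1 / 2 : ℝ) := by
      intro d hd
      rcases eq_or_ne d 0 with rfl | hd0
      · exact zero_le
      have h1 : d ^ 2 ≤ Y := by
        refine le_liminf_of_le (by isBoundedDefault) ?_
        have h2 : Tendsto (fun n : ℕ => ENNReal.ofReal ((n : ℝ) + 1)⁻¹) atTop (𝓝 0) := by
          have := ENNReal.tendsto_ofReal (tendsto_one_div_add_atTop_nhds_zero_nat (𝕜 := ℝ))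
          simpa using this
        filter_upwards [eventually_lt_of_lt_liminf (hd.trans_le hliminf),
          h2.eventually_le_const (pos_iff_ne_zero.2 hd0),
          (tendsto_natCast_atTop_atTop (R := ℝ)).eventually_ge_atTop |t|] with n h3 h4 h5
        have h6 : t ∈ E n := ⟨h5, h4.trans h3.le⟩
        rw [indicator_of_mem h6]
        gcongr
      have h2 : d = (d ^ 2) ^ (1 / 2 : ℝ) := by
        rw [← ENNReal.rpow_natCast, ← ENNReal.rpow_mul]; norm_num
      rw [h2]
      gcongr
    have h1 : eLpNorm (u t) (ENNReal.ofReal ρ) μ ≤ Y ^ (1 / 2 : ℝ) :=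
      le_of_forall_lt_imp_le_of_dense hd
    calc _ ≤ (Y ^ (1 / 2 : ℝ)) ^ 2 := by gcongr
      _ = Y := by rw [← ENNReal.rpow_natCast, ← ENNReal.rpow_mul]; norm_num
  calc _ ≤ ∫⁻ t, liminf (fun n => (E n).indicator (fun t => a n t ^ 2) t) atTop :=
        lintegral_mono hpt
    _ ≤ liminf (fun n => ∫⁻ t, (E n).indicator (fun t => a n t ^ 2) t) atTop := by
        refine lintegral_liminf_le' fun n => ((ham n).pow_const 2).indicator₀ ?_
        exact (measurableSet_le (f := fun t : ℝ => |t|) (g := fun _ => (n : ℝ))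
          (by fun_prop) measurable_const).nullMeasurableSet.inter (nullMeasurableSet_le aemeasurable_const (ham n))
    _ ≤ _ := by
        refine liminf_le_of_le (by isBoundedDefault) fun b hb => ?_
        obtain ⟨n, hn⟩ := hb.exists
        exact hn.trans (lintegral_indicator_truncLp_le hρ hK hu hB h (by positivity) (by positivity))

end MixedDuality

section Admissible
open Filter Topology

variable {X : Type*} [MeasurableSpace X] {μ : Measure X}

/-- The endpoint exponent `2 σ / (σ - 1)`. -/
noncomputable def keelTaoExp (σ : ℝ) : ℝ := 2 * σ / (σ - 1)

theorem two_lt_keelTaoExp {σ : ℝ} (hσ : 1 < σ) : 2 < keelTaoExp σ := by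
  rw [keelTaoExp, lt_div_iff₀ (by linarith)]; linarith

theorem keelTaoExp_conj {σ : ℝ} (hσ : 1 < σ) :
    keelTaoExp σ / (keelTaoExp σ - 1) = endpointExp σ := by
  have h1 : σ - 1 ≠ 0 := by linarith
  have h2 : σ + 1 ≠ 0 := by linarith
  have h3 : keelTaoExp σ - 1 = (σ + 1) / (σ - 1) := by rw [keelTaoExp]; field_simp; ring
  rw [h3, keelTaoExp, endpointExp]
  field_simp

theorem SharpAdmissible.ne_top {σ : ℝ} (hσ : 1 < σ) {q r : ℝ≥0∞} (h : SharpAdmissible σ q r) :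
    r ≠ ∞ := by
  rintro rfl
  obtain ⟨h1, -, h3⟩ := h
  have h4 : (q⁻¹).toReal ≤ 2⁻¹ := by
    have : q⁻¹ ≤ 2⁻¹ := ENNReal.inv_le_inv.2 h1
    have := ENNReal.toReal_mono (by simp) this
    simpa using this
  simp only [ENNReal.inv_top, ENNReal.toReal_zero, mul_zero, add_zero] at h3
  rw [h3] at h4
  norm_num at h4
  linarith

theorem SharpAdmissible.inv_eq {σ : ℝ} (hσ : 1 < σ) {q r : ℝ≥0∞} (h : SharpAdmissible σ q r) :
    (r⁻¹).toReal = (1 - 2 * (q⁻¹).toReal) / 2 + 2 * (q⁻¹).toReal / keelTaoExp σ := by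
  have h1 : σ - 1 ≠ 0 := by linarith
  have h2 : σ ≠ 0 := by linarith
  have h3 : (q⁻¹).toReal = σ / 2 - σ * (r⁻¹).toReal := by linarith [h.2.2]
  rw [h3, keelTaoExp]
  field_simp
  ring

theorem two_mul_toReal_inv_le_one {q : ℝ≥0∞} (h : 2 ≤ q) : 2 * (q⁻¹).toReal ≤ 1 := by
  have : q⁻¹ ≤ 2⁻¹ := ENNReal.inv_le_inv.2 h
  have := ENNReal.toReal_mono (by simp) this
  simp only [ENNReal.toReal_inv, ENNReal.toReal_ofNat] at this ⊢
  linarith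

/-- Interpolation between `L²` and `L^ρ`. -/
theorem eLpNorm_le_rpow_mul_rpow {f : X → ℂ} (hf : AEStronglyMeasurable f μ) {r : ℝ≥0∞}
    {ρ θ : ℝ} (hr0 : r ≠ 0) (hr : r ≠ ∞) (hρ : 0 < ρ) (hθ0 : 0 ≤ θ) (hθ1 : θ ≤ 1)
    (h : (r⁻¹).toReal = (1 - θ) / 2 + θ / ρ) :
    eLpNorm f r μ ≤ eLpNorm f 2 μ ^ (1 - θ) * eLpNorm f (ENNReal.ofReal ρ) μ ^ θ := by
  have hr' : 0 < r.toReal := ENNReal.toReal_pos hr0 hr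
  have hθ1' : 0 ≤ 1 - θ := by linarith
  rw [eLpNorm_eq_lintegral_rpow_enorm_toReal hr0 hr, eLpNorm_eq_lintegral_rpow_enorm_toReal
    (p := 2) (by simp) (by simp), eLpNorm_eq_lintegral_rpow_enorm_toReal
    (p := ENNReal.ofReal ρ) (by simpa) (by simp), ENNReal.toReal_ofReal hρ.le,
    ← ENNReal.rpow_mul, ← ENNReal.rpow_mul]
  set p₁ := r.toReal * ((1 - θ) / 2) with hp₁
  set p₂ := r.toReal * (θ / ρ) with hp₂
  have hp : p₁ + p₂ = 1 := by
    rw [hp₁, hp₂, ← mul_add, ← h, ENNReal.toReal_inv, mul_inv_cancel₀ hr'.ne']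
  have h1 := ENNReal.lintegral_mul_norm_pow_le (μ := μ) (hf.enorm.pow_const (2 : ℝ))
    (hf.enorm.pow_const ρ) (p := p₁) (q := p₂) (by positivity) (by positivity) hp
  have h2 : ∀ x, ‖f x‖ₑ ^ r.toReal = (‖f x‖ₑ ^ (2 : ℝ)) ^ p₁ * (‖f x‖ₑ ^ ρ) ^ p₂ := fun x => by
    rw [← ENNReal.rpow_mul, ← ENNReal.rpow_mul, ← ENNReal.rpow_add_of_nonneg _ _ (by positivity)
      (by positivity)]
    congr 1
    rw [hp₁, hp₂]; field_simp; ring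
  simp_rw [h2]
  refine (ENNReal.rpow_le_rpow h1 (by positivity)).trans (le_of_eq ?_)
  rw [ENNReal.mul_rpow_of_nonneg _ _ (by positivity), ← ENNReal.rpow_mul, ← ENNReal.rpow_mul]
  congr 2
  · rw [hp₁]; simp only [ENNReal.toReal_ofNat]; field_simp
  · rw [hp₂]; field_simp

/-- A function of time which is bounded in `L^∞_t L²_x` and at the endpoint is bounded in every
sharp admissible space. -/
theorem SharpAdmissible.eLpNorm_le {σ : ℝ} (hσ : 1 < σ) {q r : ℝ≥0∞} (h : SharpAdmissible σ q r)
    {u : ℝ → Lp ℂ 2 μ} {b : ℝ≥0∞} (hb : b ≠ ∞) (hub : ∀ t, ‖u t‖ₑ ≤ b)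
    (hu2 : ∫⁻ t, eLpNorm (u t) (ENNReal.ofReal (keelTaoExp σ)) μ ^ 2 ≤ b ^ 2) :
    eLpNorm (fun t => eLpNorm (u t) r μ) q volume ≤ b := by
  have hr0 : r ≠ 0 := (lt_of_lt_of_le (by norm_num) h.2.1).ne'
  have hq0 : q ≠ 0 := (lt_of_lt_of_le (by norm_num) h.1).ne'
  have hρ : 0 < keelTaoExp σ := by linarith [two_lt_keelTaoExp hσ]
  set θ := 2 * (q⁻¹).toReal with hθ
  have hθ1 : θ ≤ 1 := two_mul_toReal_inv_le_one h.1
  have hθ0 : 0 ≤ θ := by positivity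
  have hpt : ∀ t, eLpNorm (u t) r μ ≤
      b ^ (1 - θ) * eLpNorm (u t) (ENNReal.ofReal (keelTaoExp σ)) μ ^ θ := fun t => by
    refine (eLpNorm_le_rpow_mul_rpow (Lp.aestronglyMeasurable _) hr0 (h.ne_top hσ) hρ hθ0 hθ1
      (h.inv_eq hσ)).trans ?_
    have h1 : 0 ≤ 1 - θ := by linarith
    gcongr
    rw [← Lp.enorm_def]
    exact hub t
  rcases eq_or_ne q ∞ with rfl | hq
  · have hθ' : θ = 0 := by simp [hθ]
    rw [eLpNorm_exponent_top]
    refine essSup_le_of_ae_le _ (Eventually.of_forall fun t => ?_)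
    have := hpt t
    rw [hθ'] at this
    simpa using this
  · have hq' : 0 < q.toReal := ENNReal.toReal_pos hq0 hq
    have hθq : θ * q.toReal = 2 := by
      rw [hθ, ENNReal.toReal_inv]; field_simp
    have hb' : b ^ ((1 - θ) * q.toReal) ≠ ∞ := by
      refine ENNReal.rpow_ne_top_of_nonneg (mul_nonneg (by linarith) hq'.le) hb
    rw [eLpNorm_eq_lintegral_rpow_enorm_toReal hq0 hq, one_div, ENNReal.rpow_inv_le_iff hq']
    calc _ ≤ ∫⁻ t, b ^ ((1 - θ) * q.toReal) *
          eLpNorm (u t) (ENNReal.ofReal (keelTaoExp σ)) μ ^ 2 := by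
          refine lintegral_mono fun t => ?_
          simp only [enorm_eq_self]
          refine (ENNReal.rpow_le_rpow (hpt t) hq'.le).trans (le_of_eq ?_)
          rw [ENNReal.mul_rpow_of_nonneg _ _ hq'.le, ← ENNReal.rpow_mul, ← ENNReal.rpow_mul, hθq,
            ENNReal.rpow_ofNat]
      _ ≤ b ^ ((1 - θ) * q.toReal) * b ^ 2 := by
          rw [lintegral_const_mul' _ _ hb']
          gcongr
      _ = b ^ q.toReal := by
          rw [← ENNReal.rpow_ofNat, ← ENNReal.rpow_add_of_nonneg _ _
            (mul_nonneg (by linarith) hq'.le) (by norm_num)]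
          congr 1
          rw [sub_mul, hθq]; ring

theorem eLpNorm_le_of_bounded {h : X → ℂ} {R : ℝ}
    (hle : ∀ᵐ x ∂μ, ‖h x‖ ≤ R) {r : ℝ≥0∞} (hr2 : 2 ≤ r) (hr : r ≠ ∞) :
    eLpNorm h r μ ≤ ENNReal.ofReal R ^ ((r.toReal - 2) / r.toReal) *
      eLpNorm h 2 μ ^ (2 / r.toReal) := by
  have hr0 : r ≠ 0 := (lt_of_lt_of_le (by norm_num) hr2).ne'
  have hr' : 2 ≤ r.toReal := by
    simpa using ENNReal.toReal_mono hr hr2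
  have hr2' : 0 ≤ r.toReal - 2 := by linarith
  have hfin : ENNReal.ofReal R ^ (r.toReal - 2) ≠ ∞ :=
    ENNReal.rpow_ne_top_of_nonneg hr2' ENNReal.ofReal_ne_top
  rw [eLpNorm_eq_lintegral_rpow_enorm_toReal hr0 hr, eLpNorm_eq_lintegral_rpow_enorm_toReal
    (p := 2) (by simp) (by simp), ENNReal.toReal_ofNat, one_div, ENNReal.rpow_inv_le_iff
    (by linarith), ENNReal.mul_rpow_of_nonneg _ _ (by linarith), ← ENNReal.rpow_mul,
    ← ENNReal.rpow_mul, ← ENNReal.rpow_mul, div_mul_cancel₀ _ (by linarith),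
    div_mul_cancel₀ _ (by linarith)]
  norm_num
  rw [← lintegral_const_mul' _ _ hfin]
  refine lintegral_mono_ae ?_
  filter_upwards [hle] with x hx
  calc ‖h x‖ₑ ^ r.toReal = ‖h x‖ₑ ^ (r.toReal - 2) * ‖h x‖ₑ ^ (2 : ℝ) := by
        rw [← ENNReal.rpow_add_of_nonneg _ _ hr2' (by norm_num)]; congr 1; ring
    _ = ‖h x‖ₑ ^ (r.toReal - 2) * ‖h x‖ₑ ^ 2 := by rw [ENNReal.rpow_ofNat]
    _ ≤ _ := by
        gcongr
        rw [← ofReal_norm]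
        exact ENNReal.ofReal_le_ofReal hx

theorem memLp_truncLp {r : ℝ≥0∞} (hr2 : 2 ≤ r) (hr : r ≠ ∞) {R : ℝ} (hR : 0 ≤ R) (f : Lp ℂ 2 μ) :
    MemLp (truncLp R f) r μ := by
  refine ⟨Lp.aestronglyMeasurable _, (eLpNorm_le_of_bounded (R := R) ?_
    hr2 hr).trans_lt ?_⟩
  · filter_upwards [coeFn_truncLp R f] with x hx
    rw [hx, norm_radialTrunc, abs_of_nonneg hR]
    exact min_le_left _ _
  · have hr' : 2 ≤ r.toReal := by
      simpa using ENNReal.toReal_mono hr hr2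
    have hr2' : 0 ≤ r.toReal - 2 := by linarith
    exact ENNReal.mul_lt_top
      (ENNReal.rpow_lt_top_of_nonneg (by positivity) ENNReal.ofReal_ne_top)
      (ENNReal.rpow_lt_top_of_nonneg (by positivity) (Lp.eLpNorm_ne_top _))

theorem continuous_toLp_truncLp {r : ℝ≥0∞} [Fact (1 ≤ r)] (hr2 : 2 ≤ r) (hr : r ≠ ∞) {R : ℝ}
    (hR : 0 ≤ R) : Continuous fun f : Lp ℂ 2 μ => (memLp_truncLp hr2 hr hR f).toLp _ := by
  have hr' : 2 ≤ r.toReal := by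
    simpa using ENNReal.toReal_mono hr hr2
  rw [continuous_iff_continuousAt]
  intro f
  rw [ContinuousAt, Lp.tendsto_Lp_iff_tendsto_eLpNorm'']
  have h1 : Tendsto (fun g => eLpNorm (truncLp R g - truncLp R f : Lp ℂ 2 μ) 2 μ) (𝓝 f) (𝓝 0) := by
    have h2 := ((continuous_truncLp (μ := μ) R).tendsto f).sub_const (truncLp R f)
    rw [sub_self] at h2
    have h3 := h2.enorm
    simp only [enorm_zero] at h3
    exact h3.congr fun g => Lp.enorm_def _
  have h3 : Tendsto (fun g => ENNReal.ofReal (2 * R) ^ ((r.toReal - 2) / r.toReal) *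
      eLpNorm (truncLp R g - truncLp R f : Lp ℂ 2 μ) 2 μ ^ (2 / r.toReal)) (𝓝 f) (𝓝 0) := by
    have h4 := ENNReal.Tendsto.const_mul
      (a := ENNReal.ofReal (2 * R) ^ ((r.toReal - 2) / r.toReal)) (h1.ennrpow_const (2 / r.toReal))
      (Or.inr (ENNReal.rpow_ne_top_of_nonneg (div_nonneg (by linarith) (by linarith))
        ENNReal.ofReal_ne_top))
    rwa [ENNReal.zero_rpow_of_pos (by positivity), mul_zero] at h4
  refine tendsto_of_tendsto_of_tendsto_of_le_of_le tendsto_const_nhds h3 (fun _ => zero_le)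
    fun g => ?_
  simp only
  rw [← eLpNorm_congr_ae (Lp.coeFn_sub (truncLp R g) (truncLp R f))]
  refine eLpNorm_le_of_bounded (R := 2 * R) ?_ hr2 hr
  filter_upwards [Lp.coeFn_sub (truncLp R g) (truncLp R f), coeFn_truncLp R f, coeFn_truncLp R g]
    with x h5 h6 h7
  rw [h5, Pi.sub_apply, h6, h7, two_mul]
  refine (norm_sub_le _ _).trans ?_
  rw [norm_radialTrunc, norm_radialTrunc, abs_of_nonneg hR]
  gcongr <;> exact min_le_left _ _

/-- An `L²`-valued strongly measurable function with values in `L^r` is strongly measurable as an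
`L^r`-valued function. -/
theorem exists_aestronglyMeasurable_Lp {r : ℝ≥0∞} [Fact (1 ≤ r)] (hr2 : 2 ≤ r) (hr : r ≠ ∞)
    {u : ℝ → Lp ℂ 2 μ} (hu : AEStronglyMeasurable u) (hur : ∀ᵐ t, MemLp (u t) r μ) :
    ∃ v : ℝ → Lp ℂ r μ, AEStronglyMeasurable v ∧ ∀ᵐ t, (v t : X → ℂ) =ᵐ[μ] u t := by
  classical
  refine ⟨fun t => if h : MemLp (u t) r μ then h.toLp _ else 0, ?_, ?_⟩
  · refine aestronglyMeasurable_of_tendsto_ae atTop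
      (f := fun (n : ℕ) t => (memLp_truncLp hr2 hr n.cast_nonneg (u t)).toLp _)
      (fun n => (continuous_toLp_truncLp hr2 hr n.cast_nonneg).comp_aestronglyMeasurable hu) ?_
    filter_upwards [hur] with t ht
    simp only [ht, dite_true]
    rw [Lp.tendsto_Lp_iff_tendsto_eLpNorm'']
    exact tendsto_eLpNorm_truncLp_sub hr tendsto_natCast_atTop_atTop ht
  · filter_upwards [hur] with t ht
    simp only [ht, dite_true]
    exact ht.coeFn_toLp

/-- Bounds in `L^∞_t L²_x` and at the endpoint produce an element of `L^q_t L^r_x`. -/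
theorem SharpAdmissible.exists_mixedLp {σ : ℝ} (hσ : 1 < σ) {q r : ℝ≥0∞} [Fact (1 ≤ r)]
    (h : SharpAdmissible σ q r) {u : ℝ → Lp ℂ 2 μ} (hu : AEStronglyMeasurable u) {b : ℝ≥0∞}
    (hb : b ≠ ∞) (hub : ∀ t, ‖u t‖ₑ ≤ b)
    (hu2 : ∫⁻ t, eLpNorm (u t) (ENNReal.ofReal (keelTaoExp σ)) μ ^ 2 ≤ b ^ 2) :
    ∃ v : MixedLp μ q r, (∀ᵐ t : ℝ, (v t : X → ℂ) =ᵐ[μ] u t) ∧ ‖v‖ₑ ≤ b := by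
  have hq0 : q ≠ 0 := (lt_of_lt_of_le (by norm_num) h.1).ne'
  have hle := h.eLpNorm_le hσ hb hub hu2
  have hfin : ∀ᵐ t, eLpNorm (u t) r μ < ∞ := by
    rcases eq_or_ne q ∞ with rfl | hq
    · have h1 := ae_le_eLpNormEssSup (μ := (volume : Measure ℝ)) (f := fun t => eLpNorm (u t) r μ)
      filter_upwards [h1] with t ht
      rw [eLpNorm_exponent_top] at hle
      exact (ht.trans hle).trans_lt hb.lt_top
    · have h1 := lintegral_rpow_enorm_lt_top_of_eLpNorm_lt_top hq0 hq (hle.trans_lt hb.lt_top)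
      have hq' : 0 < q.toReal := ENNReal.toReal_pos hq0 hq
      filter_upwards [ae_lt_top' ((hu.aemeasurable_eLpNorm r).enorm.pow_const _) h1.ne] with t ht
      rw [ENNReal.rpow_lt_top_iff_of_pos hq'] at ht
      exact ht
  obtain ⟨v, hv, hvu⟩ := exists_aestronglyMeasurable_Lp h.2.1 (h.ne_top hσ) hu
    (hfin.mono fun t ht => ⟨Lp.aestronglyMeasurable _, ht⟩)
  have hnorm : eLpNorm v q volume = eLpNorm (fun t => eLpNorm (u t) r μ) q volume := by
    refine eLpNorm_congr_enorm_ae ?_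
    filter_upwards [hvu] with t ht
    rw [Lp.enorm_def, eLpNorm_congr_ae ht, enorm_eq_self]
  have hmem : MemLp v q volume := ⟨hv, by rw [hnorm]; exact hle.trans_lt hb.lt_top⟩
  refine ⟨hmem.toLp v, ?_, ?_⟩
  · filter_upwards [hvu, hmem.coeFn_toLp] with t h1 h2
    rw [h2]
    exact h1
  · rw [Lp.enorm_def, eLpNorm_congr_ae hmem.coeFn_toLp, hnorm]
    exact hle

end Admissible

section Homogeneous
open Filter Topology

variable {X : Type*} [MeasurableSpace X] {μ : Measure X}
variable {H : Type*} [NormedAddCommGroup H] [InnerProductSpace ℂ H]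

theorem enorm_clm_apply_le {E F : Type*} [NormedAddCommGroup E] [NormedAddCommGroup F]
    {T : E → F} {C : ℝ} (hC : 0 ≤ C) (h : ∀ x, ‖T x‖ ≤ C * ‖x‖) (x : E) :
    ‖T x‖ₑ ≤ ENNReal.ofReal C * ‖x‖ₑ := by
  rw [← ofReal_norm, ← ofReal_norm, ← ENNReal.ofReal_mul hC]
  exact ENNReal.ofReal_le_ofReal (h x)

theorem aestronglyMeasurable_setIntegral_section {g : ℝ → H} (hg : Integrable g)
    {W : Set (ℝ × ℝ)} (hW : MeasurableSet W) :
    AEStronglyMeasurable fun s => ∫ t in {t | (s, t) ∈ W}, g t := by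
  have h1 : AEStronglyMeasurable (W.indicator fun z : ℝ × ℝ => g z.2)
      ((volume : Measure ℝ).prod (volume : Measure ℝ)) :=
    hg.aestronglyMeasurable.comp_snd.indicator hW
  refine h1.integral_prod_right'.congr (Eventually.of_forall fun s => ?_)
  have hm : MeasurableSet {t | (s, t) ∈ W} := measurable_prodMk_left hW
  simp only
  rw [← integral_indicator hm]
  rfl

variable [CompleteSpace H]

theorem bilinearConst_pos {C σ : ℝ} (hσ : 1 < σ) (hC : 1 ≤ C) : 0 < bilinearConst C σ := by
  have hC0 : 0 < C := zero_lt_one.trans_le hC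
  have hσ1 : 0 < σ - 1 := by linarith
  have : ((1 : ℝ) / 2) ^ (min 1 (2 * (σ - 1)) / 4) < 1 :=
    Real.rpow_lt_one (by norm_num) (by norm_num) (by positivity)
  have : 0 < 1 - ((1 : ℝ) / 2) ^ (min 1 (2 * (σ - 1)) / 4) := by linarith
  unfold bilinearConst
  positivity

/-- The dual endpoint estimate for integrable square integrable valued functions. -/
theorem IsDispersive.enorm_setIntegral_adjoint_sq_le {C σ : ℝ} (hσ : 1 < σ)
    {D : ℝ → H →L[ℂ] Lp ℂ 2 μ} (hD : IsDispersive C σ D) {G : ℝ → Lp ℂ 2 μ} (hG : Integrable G)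
    {E : Set ℝ} (hE : MeasurableSet E) :
    ‖∫ t in E, ContinuousLinearMap.adjoint (D t) (G t)‖ₑ ^ 2 ≤
      ENNReal.ofReal (2 * bilinearConst C σ) *
        ∫⁻ t, eLpNorm (G t) (ENNReal.ofReal (endpointExp σ)) μ ^ 2 := by
  have hg := hD.integrable_adjoint hG
  set g := fun t => ContinuousLinearMap.adjoint (D t) (G t)
  have h1 := enorm_integral_inner_adjoint_le hσ hD hD hD.dispersive hG hG (hE.prod hE)
  rw [setIntegral_prod _ (integrable_inner_prod hg hg).integrableOn] at h1
  have h2 : ∫ t in E, ∫ s in E, inner ℂ (g t) (g s) =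
      inner ℂ (∫ t in E, g t) (∫ t in E, g t) := by
    simp_rw [integral_inner hg.integrableOn]
    have : ∀ t, inner ℂ (g t) (∫ s in E, g s) = starRingEnd ℂ (inner ℂ (∫ s in E, g s) (g t)) :=
      fun t => (inner_conj_symm _ _).symm
    simp_rw [this]
    rw [integral_conj, integral_inner hg.integrableOn, inner_conj_symm]
  have h3 : ‖∫ t in E, g t‖ₑ ^ 2 = ‖inner ℂ (∫ t in E, g t) (∫ t in E, g t)‖ₑ := by
    rw [inner_self_eq_norm_sq_to_K, enorm_pow, ← ofReal_norm, ← ofReal_norm]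
    simp
  rw [h3, ← h2]
  refine h1.trans (le_of_eq ?_)
  rw [← two_mul, ← mul_assoc, mul_comm _ (2 : ℝ≥0∞), ENNReal.ofReal_mul zero_le_two,
    ENNReal.ofReal_ofNat]

/-- The constant of the homogeneous Strichartz estimate. -/
noncomputable def homogeneousConst (C σ : ℝ) : ℝ := C + 8 * bilinearConst C σ + 1

theorem IsDispersive.lintegral_eLpNorm_apply_sq_le {C σ : ℝ} (hσ : 1 < σ)
    {D : ℝ → H →L[ℂ] Lp ℂ 2 μ} (hD : IsDispersive C σ D) (f : H) :
    ∫⁻ t, eLpNorm (D t f) (ENNReal.ofReal (keelTaoExp σ)) μ ^ 2 ≤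
      ENNReal.ofReal (8 * bilinearConst C σ) * ‖f‖ₑ ^ 2 := by
  have hK := bilinearConst_pos hσ hD.one_le
  have h := lintegral_eLpNorm_sq_le_of_forall (two_lt_keelTaoExp hσ)
    (K := 2 * bilinearConst C σ) (B := C * ‖f‖) (S := ‖f‖ₑ ^ 2) (by positivity)
    (hD.measurable_apply f) (fun t => hD.norm_apply_le t f) fun G hG => by
      have hg := hD.integrable_adjoint hG
      have h1 : ∫ t, inner ℂ (G t) (D t f) =
          starRingEnd ℂ (inner ℂ f (∫ t, ContinuousLinearMap.adjoint (D t) (G t))) := by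
        rw [← integral_inner hg, ← integral_conj]
        congr 1; ext t
        rw [inner_conj_symm, ContinuousLinearMap.adjoint_inner_left]
      rw [h1, inner_conj_symm]
      refine (enorm_inner_le _ _).trans ((ENNReal.mul_le_sq_add_sq _ _).trans ?_)
      gcongr
      have := hD.enorm_setIntegral_adjoint_sq_le hσ hG MeasurableSet.univ
      rw [keelTaoExp_conj hσ]
      simpa using this
  refine h.trans (le_of_eq ?_)
  congr 2
  ring

theorem IsDispersive.exists_mixedLp {C σ : ℝ} (hσ : 1 < σ) {q r : ℝ≥0∞} [Fact (1 ≤ r)]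
    (h : SharpAdmissible σ q r) {D : ℝ → H →L[ℂ] Lp ℂ 2 μ} (hD : IsDispersive C σ D) (f : H) :
    ∃ u : MixedLp μ q r, (∀ᵐ t : ℝ, (u t : X → ℂ) =ᵐ[μ] D t f) ∧
      ‖u‖ₑ ≤ ENNReal.ofReal (homogeneousConst C σ) * ‖f‖ₑ := by
  have hK := bilinearConst_pos hσ hD.one_le
  have hC := hD.one_le
  have hL : 0 ≤ homogeneousConst C σ := by unfold homogeneousConst; positivity
  refine h.exists_mixedLp hσ (hD.measurable_apply f) (by finiteness) (fun t => ?_) ?_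
  · refine (enorm_clm_apply_le (by linarith) (hD.norm_apply_le t) f).trans ?_
    gcongr
    unfold homogeneousConst
    linarith
  · refine (hD.lintegral_eLpNorm_apply_sq_le hσ f).trans ?_
    rw [mul_pow, ← ENNReal.ofReal_pow hL]
    gcongr
    unfold homogeneousConst
    nlinarith

theorem IsDispersive.homogeneousStrichartz {C σ : ℝ} (hσ : 1 < σ) {q r : ℝ≥0∞} [Fact (1 ≤ r)]
    (h : SharpAdmissible σ q r) {D : ℝ → H →L[ℂ] Lp ℂ 2 μ} (hD : IsDispersive C σ D) :
    HomogeneousStrichartz D q r (homogeneousConst C σ) := by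
  have hK := bilinearConst_pos hσ hD.one_le
  have hC := hD.one_le
  have hL : 0 ≤ homogeneousConst C σ := by unfold homogeneousConst; positivity
  intro f
  obtain ⟨u, hu, hle⟩ := hD.exists_mixedLp hσ h f
  refine ⟨u, hu, ?_⟩
  rw [← ofReal_norm f, ← ENNReal.ofReal_mul hL] at hle
  rw [Lp.norm_def, ← Lp.enorm_def]
  exact ENNReal.toReal_le_of_le_ofReal (by positivity) hle

/-- The constant of the inhomogeneous estimate for the adjoint of the retarded operator. -/
noncomputable def advancedConst (C σ : ℝ) : ℝ := C * (2 * bilinearConst C σ + 1)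

/-- The inhomogeneous evolution with integration over the set `W` of pairs of times. -/
noncomputable def duhamel (A D : ℝ → H →L[ℂ] Lp ℂ 2 μ) (W : Set (ℝ × ℝ)) (G : ℝ → Lp ℂ 2 μ)
    (s : ℝ) : Lp ℂ 2 μ :=
  D s (∫ t in {t | (s, t) ∈ W}, ContinuousLinearMap.adjoint (A t) (G t))

theorem IsDispersive.aestronglyMeasurable_duhamel {C σ : ℝ}
    {A D : ℝ → H →L[ℂ] Lp ℂ 2 μ} (hA : IsDispersive C σ A) (hD : IsDispersive C σ D)
    {W : Set (ℝ × ℝ)} (hW : MeasurableSet W) {G : ℝ → Lp ℂ 2 μ} (hG : Integrable G) :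
    AEStronglyMeasurable (duhamel A D W G) :=
  aestronglyMeasurable_clm_apply hD.measurable_apply
    (aestronglyMeasurable_setIntegral_section (hA.integrable_adjoint hG) hW)

theorem IsDispersive.norm_duhamel_le {C σ : ℝ}
    {A D : ℝ → H →L[ℂ] Lp ℂ 2 μ} (hA : IsDispersive C σ A) (hD : IsDispersive C σ D)
    {W : Set (ℝ × ℝ)} {G : ℝ → Lp ℂ 2 μ} (hG : Integrable G) (s : ℝ) :
    ‖duhamel A D W G s‖ ≤ C * ∫ t, ‖ContinuousLinearMap.adjoint (A t) (G t)‖ := by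
  have hC0 : 0 ≤ C := zero_le_one.trans hD.one_le
  refine (hD.norm_apply_le _ _).trans ?_
  gcongr
  refine (norm_integral_le_integral_norm _).trans ?_
  exact setIntegral_le_integral (hA.integrable_adjoint hG).norm
    (Eventually.of_forall fun t => norm_nonneg _)

theorem integral_inner_duhamel {C σ : ℝ}
    {A D : ℝ → H →L[ℂ] Lp ℂ 2 μ} (hA : IsDispersive C σ A) (hD : IsDispersive C σ D)
    {W : Set (ℝ × ℝ)} (hW : MeasurableSet W) {G F : ℝ → Lp ℂ 2 μ} (hG : Integrable G)
    (hF : Integrable F) :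
    ∫ s, inner ℂ (F s) (duhamel A D W G s) =
      ∫ z in W, inner ℂ (ContinuousLinearMap.adjoint (D z.1) (F z.1))
        (ContinuousLinearMap.adjoint (A z.2) (G z.2)) ∂(volume.prod volume) := by
  rw [integral_prod_inner (hD.integrable_adjoint hF) (hA.integrable_adjoint hG) hW]
  congr 1; ext s
  rw [ContinuousLinearMap.adjoint_inner_left]
  rfl

theorem IsDispersive.duhamel_bounds {C σ : ℝ} (hσ : 1 < σ)
    {A D : ℝ → H →L[ℂ] Lp ℂ 2 μ} (hA : IsDispersive C σ A) (hD : IsDispersive C σ D)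
    (hAD : DispersiveBound C σ fun s t => A s ∘L ContinuousLinearMap.adjoint (D t))
    {W : Set (ℝ × ℝ)} (hW : MeasurableSet W) {G : ℝ → Lp ℂ 2 μ} (hG : Integrable G)
    {b : ℝ≥0∞} (hb : b = ENNReal.ofReal (advancedConst C σ) *
      (∫⁻ t, eLpNorm (G t) (ENNReal.ofReal (endpointExp σ)) μ ^ 2) ^ (1 / 2 : ℝ)) :
    (∀ s, ‖duhamel A D W G s‖ₑ ≤ b) ∧
      ∫⁻ s, eLpNorm (duhamel A D W G s) (ENNReal.ofReal (keelTaoExp σ)) μ ^ 2 ≤ b ^ 2 := by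
  have hK := bilinearConst_pos hσ hA.one_le
  have hC := hA.one_le
  have hC0 : 0 < C := by linarith
  set K := bilinearConst C σ with hKdef
  set N := ∫⁻ t, eLpNorm (G t) (ENNReal.ofReal (endpointExp σ)) μ ^ 2 with hN
  have hL : 0 ≤ advancedConst C σ := by unfold advancedConst; positivity
  have hN2 : (N ^ (1 / 2 : ℝ)) ^ 2 = N := by
    rw [← ENNReal.rpow_natCast, ← ENNReal.rpow_mul]; norm_num
  have hb2 : b ^ 2 = ENNReal.ofReal (advancedConst C σ ^ 2) * N := by
    rw [hb, mul_pow, hN2, ENNReal.ofReal_pow hL]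
  refine ⟨fun s => ?_, ?_⟩
  · have hm : MeasurableSet {t | (s, t) ∈ W} := measurable_prodMk_left hW
    refine (ENNReal.pow_le_pow_left_iff (n := 2) (by norm_num)).1 ?_
    calc ‖duhamel A D W G s‖ₑ ^ 2 ≤ (ENNReal.ofReal C *
          ‖∫ t in {t | (s, t) ∈ W}, ContinuousLinearMap.adjoint (A t) (G t)‖ₑ) ^ 2 := by
          gcongr
          exact enorm_clm_apply_le hC0.le (hD.norm_apply_le s) _
      _ ≤ ENNReal.ofReal (C ^ 2) * (ENNReal.ofReal (2 * K) * N) := by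
          rw [mul_pow, ENNReal.ofReal_pow hC0.le]
          gcongr
          exact hA.enorm_setIntegral_adjoint_sq_le hσ hG hm
      _ ≤ _ := by
          rw [hb2, ← mul_assoc, ← ENNReal.ofReal_mul (by positivity)]
          gcongr
          rw [advancedConst, mul_pow]
          gcongr
          nlinarith
  · have h := lintegral_eLpNorm_sq_le_of_forall (two_lt_keelTaoExp hσ) hK
      (S := ENNReal.ofReal K * N) (hA.aestronglyMeasurable_duhamel hD hW hG)
      (hA.norm_duhamel_le hD hG) fun F hF => by
        rw [integral_inner_duhamel hA hD hW hG hF, keelTaoExp_conj hσ, integral_prod_inner_swap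
          (a := fun s => ContinuousLinearMap.adjoint (D s) (F s))
          (b := fun t => ContinuousLinearMap.adjoint (A t) (G t)) W]
        refine (enorm_integral_inner_adjoint_le hσ hA hD hAD hG hF
          (hW.preimage measurable_swap)).trans (le_of_eq ?_)
        rw [mul_add, add_comm]
    refine h.trans ?_
    rw [hb2, ← mul_assoc, ← ENNReal.ofReal_mul (by positivity)]
    gcongr
    rw [advancedConst, mul_pow]
    nlinarith [mul_nonneg (by nlinarith : 0 ≤ C ^ 2 - 1) (sq_nonneg (2 * K + 1))]

end Homogeneous

section WeakIntegral
open Filter Topology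

variable {X : Type*} [MeasurableSpace X] {μ : Measure X}
variable {H : Type*} [NormedAddCommGroup H] [InnerProductSpace ℂ H]
variable {p k q r : ℝ≥0∞}

theorem integrable_inner_of_memLp [ENNReal.HolderConjugate k r] {f g : X → ℂ} (hf : MemLp f k μ)
    (hg : MemLp g r μ) : Integrable (fun x => inner ℂ (f x) (g x)) μ :=
  memLp_one_iff_integrable.1 <| MemLp.of_bilin (p := k) (q := r) (r := 1)
    (fun x y : ℂ => inner ℂ x y) 1 hf hg (hf.1.inner hg.1)
    (Eventually.of_forall fun x => by
      simpa using nnnorm_inner_le_nnnorm (𝕜 := ℂ) (f x) (g x))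

/-- The pairing of two elements of `L^k` and `L^r`, as a real bilinear map. -/
noncomputable def innerPairing (μ : Measure X) (k r : ℝ≥0∞) [Fact (1 ≤ k)] [Fact (1 ≤ r)]
    [ENNReal.HolderConjugate k r] : Lp ℂ k μ →L[ℝ] Lp ℂ r μ →L[ℝ] ℂ :=
  ((isBoundedBilinearMap_inner (𝕜 := ℂ) (E := ℂ)).toContinuousLinearMap).lpPairing μ k r

theorem innerPairing_apply [Fact (1 ≤ k)] [Fact (1 ≤ r)] [ENNReal.HolderConjugate k r]
    (f : Lp ℂ k μ) (g : Lp ℂ r μ) : innerPairing μ k r f g = ∫ x, inner ℂ (f x) (g x) ∂μ :=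
  ContinuousLinearMap.lpPairing_eq_integral _ _ _

theorem enorm_innerPairing_le [Fact (1 ≤ k)] [Fact (1 ≤ r)] [ENNReal.HolderConjugate k r]
    (f : Lp ℂ k μ) (g : Lp ℂ r μ) : ‖innerPairing μ k r f g‖ₑ ≤ ‖f‖ₑ * ‖g‖ₑ := by
  rw [innerPairing_apply]
  refine (enorm_integral_le_lintegral_enorm _).trans ?_
  rw [← eLpNorm_one_eq_lintegral_enorm]
  have := eLpNorm_le_eLpNorm_mul_eLpNorm_of_nnnorm (p := k) (q := r) (r := 1)
    (Lp.aestronglyMeasurable f) (Lp.aestronglyMeasurable g) (fun x y : ℂ => inner ℂ x y) 1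
    (Eventually.of_forall fun x => by simpa using nnnorm_inner_le_nnnorm (𝕜 := ℂ) (f x) (g x))
  simpa [Lp.enorm_def] using this

/-- The weak integrand `⟨F(s), D(s) h⟩`. -/
noncomputable def weakIntegrand [Fact (1 ≤ k)] (D : ℝ → H →L[ℂ] Lp ℂ 2 μ) (F : MixedLp μ p k)
    (h : H) (s : ℝ) : ℂ :=
  ∫ x, inner ℂ (F s x) (D s h x) ∂μ

variable [Fact (1 ≤ k)] [Fact (1 ≤ r)] [ENNReal.HolderConjugate k r]

theorem weakIntegrand_ae_eq {D : ℝ → H →L[ℂ] Lp ℂ 2 μ} (F : MixedLp μ p k) {h : H}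
    {J : MixedLp μ q r} (hJ : ∀ᵐ t : ℝ, (J t : X → ℂ) =ᵐ[μ] D t h) :
    weakIntegrand D F h =ᵐ[volume] fun s => innerPairing μ k r (F s) (J s) := by
  filter_upwards [hJ] with s hs
  rw [innerPairing_apply]
  refine integral_congr_ae ?_
  filter_upwards [hs] with x hx
  rw [hx]

variable [CompleteSpace H] {C σ : ℝ} {D : ℝ → H →L[ℂ] Lp ℂ 2 μ}

theorem IsDispersive.ae_integrable_inner (hσ : 1 < σ) (h : SharpAdmissible σ q r)
    (hD : IsDispersive C σ D) (F : MixedLp μ p k) (f : H) :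
    ∀ᵐ s, Integrable (fun x => inner ℂ (F s x) (D s f x)) μ := by
  obtain ⟨J, hJ, -⟩ := hD.exists_mixedLp hσ h f
  filter_upwards [hJ] with s hs
  exact integrable_inner_of_memLp (Lp.memLp (F s)) ((memLp_congr_ae hs).1 (Lp.memLp (J s)))

variable [ENNReal.HolderConjugate p q]

theorem integrable_pairing (F : MixedLp μ p k) (J : MixedLp μ q r) :
    Integrable (fun s => innerPairing μ k r (F s) (J s)) :=
  memLp_one_iff_integrable.1
    ((innerPairing μ k r).memLp_of_bilin 1 (Lp.memLp F) (Lp.memLp J))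

theorem lintegral_enorm_pairing_le (F : MixedLp μ p k) (J : MixedLp μ q r) :
    ∫⁻ s, ‖innerPairing μ k r (F s) (J s)‖ₑ ≤ ‖F‖ₑ * ‖J‖ₑ := by
  rw [← eLpNorm_one_eq_lintegral_enorm]
  have := eLpNorm_le_eLpNorm_mul_eLpNorm_of_nnnorm (p := p) (q := q) (r := 1)
    (Lp.aestronglyMeasurable F) (Lp.aestronglyMeasurable J)
    (fun f g => innerPairing μ k r f g) 1
    (Eventually.of_forall fun s => by
      rw [← ENNReal.coe_le_coe]
      simpa [enorm_eq_nnnorm] using enorm_innerPairing_le (F s) (J s))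
  simpa [Lp.enorm_def] using this

theorem IsDispersive.integrable_weakIntegrand (hσ : 1 < σ) (h : SharpAdmissible σ q r)
    (hD : IsDispersive C σ D) (F : MixedLp μ p k) (f : H) :
    Integrable (weakIntegrand D F f) := by
  obtain ⟨J, hJ, -⟩ := hD.exists_mixedLp hσ h f
  exact (integrable_pairing F J).congr (weakIntegrand_ae_eq F hJ).symm

theorem IsDispersive.lintegral_weakIntegrand_le (hσ : 1 < σ) (h : SharpAdmissible σ q r)
    (hD : IsDispersive C σ D) (F : MixedLp μ p k) (f : H) :
    ∫⁻ s, ‖weakIntegrand D F f s‖ₑ ≤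
      ENNReal.ofReal (homogeneousConst C σ) * ‖F‖ₑ * ‖f‖ₑ := by
  obtain ⟨J, hJ, hle⟩ := hD.exists_mixedLp hσ h f
  have h1 : ∫⁻ s, ‖weakIntegrand D F f s‖ₑ = ∫⁻ s, ‖innerPairing μ k r (F s) (J s)‖ₑ :=
    lintegral_congr_ae ((weakIntegrand_ae_eq F hJ).mono fun s hs => by simp only [hs])
  rw [h1]
  refine (lintegral_enorm_pairing_le F J).trans ?_
  calc _ ≤ ‖F‖ₑ * (ENNReal.ofReal (homogeneousConst C σ) * ‖f‖ₑ) := by gcongr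
    _ = _ := by ring

/-- The element of `H` representing `∫_E D(s)^* F(s) ds` in the weak sense. -/
noncomputable def weakIntegral (D : ℝ → H →L[ℂ] Lp ℂ 2 μ) (E : Set ℝ) (F : MixedLp μ p k) : H :=
  Classical.epsilon fun S : H => ∀ f, inner ℂ S f = ∫ s in E, weakIntegrand D F f s

theorem homogeneousConst_pos (hσ : 1 < σ) (hC : 1 ≤ C) : 0 < homogeneousConst C σ := by
  have := bilinearConst_pos hσ hC
  unfold homogeneousConst
  linarith

theorem IsDispersive.norm_setIntegral_weakIntegrand_le (hσ : 1 < σ) (h : SharpAdmissible σ q r)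
    (hD : IsDispersive C σ D) (E : Set ℝ) (F : MixedLp μ p k) (f : H) :
    ‖∫ s in E, weakIntegrand D F f s‖ₑ ≤
      ENNReal.ofReal (homogeneousConst C σ) * ‖F‖ₑ * ‖f‖ₑ :=
  (enorm_integral_le_lintegral_enorm _).trans
    ((setLIntegral_le_lintegral _ _).trans (hD.lintegral_weakIntegrand_le hσ h F f))

theorem IsDispersive.inner_weakIntegral [Fact (1 ≤ p)] (hσ : 1 < σ) (h : SharpAdmissible σ q r)
    (hD : IsDispersive C σ D) (E : Set ℝ) (F : MixedLp μ p k) (f : H) :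
    inner ℂ (weakIntegral D E F) f = ∫ s in E, weakIntegrand D F f s := by
  have hint := hD.integrable_weakIntegrand hσ h F
  have hK := (homogeneousConst_pos hσ hD.one_le).le
  let ℓ : H →ₗ[ℂ] ℂ :=
    { toFun := fun f => ∫ s in E, weakIntegrand D F f s
      map_add' := fun f g => by
        rw [← integral_add (hint f).integrableOn (hint g).integrableOn]
        refine integral_congr_ae (ae_restrict_of_ae ?_)
        filter_upwards [hD.ae_integrable_inner hσ h F f, hD.ae_integrable_inner hσ h F g]
          with s h1 h2
        simp only [weakIntegrand]
        rw [← integral_add h1 h2, map_add]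
        refine integral_congr_ae ?_
        filter_upwards [Lp.coeFn_add (D s f) (D s g)] with x hx
        rw [hx, Pi.add_apply, inner_add_right]
      map_smul' := fun c f => by
        rw [← integral_smul]
        refine integral_congr_ae (Eventually.of_forall fun s => ?_)
        simp only [weakIntegrand, RingHom.id_apply]
        rw [← integral_smul, map_smul]
        refine integral_congr_ae ?_
        filter_upwards [Lp.coeFn_smul c (D s f)] with x hx
        rw [hx, Pi.smul_apply, inner_smul_right, smul_eq_mul] }
  let L : H →L[ℂ] ℂ := ℓ.mkContinuous (homogeneousConst C σ * ‖F‖) fun f => by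
    have := hD.norm_setIntegral_weakIntegrand_le hσ h E F f
    rw [← ofReal_norm F, ← ofReal_norm f, ← ENNReal.ofReal_mul hK,
      ← ENNReal.ofReal_mul (by positivity), ← ofReal_norm] at this
    exact (ENNReal.ofReal_le_ofReal_iff (by positivity)).1 this
  have hex : ∃ S : H, ∀ f, inner ℂ S f = ∫ s in E, weakIntegrand D F f s :=
    ⟨(InnerProductSpace.toDual ℂ H).symm L, fun f => InnerProductSpace.toDual_symm_apply⟩
  exact Classical.epsilon_spec hex f

variable [Fact (1 ≤ p)]

theorem IsDispersive.enorm_weakIntegral_le (hσ : 1 < σ) (h : SharpAdmissible σ q r)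
    (hD : IsDispersive C σ D) (E : Set ℝ) (F : MixedLp μ p k) :
    ‖weakIntegral D E F‖ₑ ≤ ENNReal.ofReal (homogeneousConst C σ) * ‖F‖ₑ := by
  have h1 := hD.norm_setIntegral_weakIntegrand_le hσ h E F (weakIntegral D E F)
  rw [← hD.inner_weakIntegral hσ h, inner_self_eq_norm_sq_to_K, enorm_pow] at h1
  rcases eq_or_ne (‖weakIntegral D E F‖ₑ) 0 with h0 | h0
  · rw [h0]; exact zero_le
  · have h2 : ‖((‖weakIntegral D E F‖ : ℝ) : ℂ)‖ₑ = ‖weakIntegral D E F‖ₑ := by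
      rw [← ofReal_norm, ← ofReal_norm]; simp
    change ‖((‖weakIntegral D E F‖ : ℝ) : ℂ)‖ₑ ^ 2 ≤ _ at h1
    rw [h2, sq] at h1
    exact (ENNReal.mul_le_mul_iff_left h0 enorm_ne_top).1 h1

theorem IsDispersive.weakIntegral_add (hσ : 1 < σ) (h : SharpAdmissible σ q r)
    (hD : IsDispersive C σ D) (E : Set ℝ) (F G : MixedLp μ p k) :
    weakIntegral D E (F + G) = weakIntegral D E F + weakIntegral D E G := by
  refine ext_inner_right ℂ fun f => ?_
  rw [inner_add_left, hD.inner_weakIntegral hσ h, hD.inner_weakIntegral hσ h,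
    hD.inner_weakIntegral hσ h, ← integral_add (hD.integrable_weakIntegrand hσ h F f).integrableOn
      (hD.integrable_weakIntegrand hσ h G f).integrableOn]
  refine integral_congr_ae (ae_restrict_of_ae ?_)
  filter_upwards [hD.ae_integrable_inner hσ h F f, hD.ae_integrable_inner hσ h G f,
    Lp.coeFn_add F G] with s h1 h2 h3
  simp only [weakIntegrand]
  rw [← integral_add h1 h2, h3, Pi.add_apply]
  refine integral_congr_ae ?_
  filter_upwards [Lp.coeFn_add (F s) (G s)] with x hx
  rw [hx, Pi.add_apply, inner_add_left]

theorem IsDispersive.weakIntegral_smul (hσ : 1 < σ) (h : SharpAdmissible σ q r)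
    (hD : IsDispersive C σ D) (E : Set ℝ) (c : ℂ) (F : MixedLp μ p k) :
    weakIntegral D E (c • F) = c • weakIntegral D E F := by
  refine ext_inner_right ℂ fun f => ?_
  rw [inner_smul_left, hD.inner_weakIntegral hσ h, hD.inner_weakIntegral hσ h, ← smul_eq_mul,
    ← integral_smul]
  refine integral_congr_ae (ae_restrict_of_ae ?_)
  filter_upwards [Lp.coeFn_smul c F] with s h3
  simp only [weakIntegrand]
  rw [← integral_smul, h3, Pi.smul_apply]
  refine integral_congr_ae ?_
  filter_upwards [Lp.coeFn_smul c (F s)] with x hx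
  rw [hx, Pi.smul_apply, inner_smul_left, smul_eq_mul]

/-- The weak integral is the Bochner integral whenever the latter converges. -/
theorem IsDispersive.clm_weakIntegral {H' : Type*} [NormedAddCommGroup H']
    [InnerProductSpace ℂ H'] [NormedSpace ℝ H'] [CompleteSpace H'] (hσ : 1 < σ)
    (h : SharpAdmissible σ q r)
    (hD : IsDispersive C σ D) (E : Set ℝ) (F : MixedLp μ p k) {G : ℝ → Lp ℂ 2 μ}
    (hFG : ∀ᵐ s : ℝ, (F s : X → ℂ) =ᵐ[μ] G s) (T : H →L[ℂ] H')
    (hT : IntegrableOn (fun s => T (ContinuousLinearMap.adjoint (D s) (G s))) E) :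
    T (weakIntegral D E F) = ∫ s in E, T (ContinuousLinearMap.adjoint (D s) (G s)) := by
  refine ext_inner_left ℂ fun g => ?_
  rw [← ContinuousLinearMap.adjoint_inner_left, ← inner_conj_symm, hD.inner_weakIntegral hσ h,
    ← integral_inner hT, ← integral_conj]
  refine integral_congr_ae (ae_restrict_of_ae ?_)
  filter_upwards [hFG] with s hs
  rw [← ContinuousLinearMap.adjoint_inner_left, ContinuousLinearMap.adjoint_inner_right,
    ← inner_conj_symm, L2.inner_def, weakIntegrand]
  congr 1
  refine integral_congr_ae ?_
  filter_upwards [hs] with x hx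
  rw [hx]

theorem IsDispersive.dualStrichartz (hσ : 1 < σ) (h : SharpAdmissible σ q r)
    (hD : IsDispersive C σ D) :
    DualStrichartz (fun s => ContinuousLinearMap.adjoint (D s)) p k (homogeneousConst C σ) := by
  have hK := (homogeneousConst_pos hσ hD.one_le).le
  have hle : ∀ F : MixedLp μ p k, ‖weakIntegral D univ F‖ ≤ homogeneousConst C σ * ‖F‖ := by
    intro F
    have h1 := hD.enorm_weakIntegral_le hσ h univ F
    rw [← ofReal_norm F, ← ENNReal.ofReal_mul hK, ← ofReal_norm] at h1
    exact (ENNReal.ofReal_le_ofReal_iff (by positivity)).1 h1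
  refine ⟨LinearMap.mkContinuous
    { toFun := weakIntegral D univ
      map_add' := hD.weakIntegral_add hσ h univ
      map_smul' := hD.weakIntegral_smul hσ h univ } (homogeneousConst C σ) hle,
    fun F G hFG hG => ?_, hle⟩
  have := hD.clm_weakIntegral hσ h univ F hFG (ContinuousLinearMap.id ℂ H)
    (by simpa using hG)
  simpa using this

end WeakIntegral

section Retarded
open Filter Topology

variable {X : Type*} [MeasurableSpace X] {μ : Measure X}
variable {p k q r : ℝ≥0∞}

theorem mem_closure_memLp_two [Fact (1 ≤ k)] (hk : k ≠ ∞) (c : Lp ℂ k μ) :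
    c ∈ closure {c : Lp ℂ k μ | MemLp c 2 μ} := by
  induction c using Lp.induction hk with
  | @indicatorConst c s hs hμs =>
    refine subset_closure ?_
    rw [Set.mem_ofPred_eq, Lp.simpleFunc.coe_indicatorConst]
    exact (memLp_congr_ae indicatorConstLp_coeFn).2 (memLp_indicator_const 2 hs c (Or.inr hμs.ne))
  | @add f g hf hg _ h1 h2 =>
    refine map_mem_closure₂ continuous_add h1 h2 fun a ha b hb => ?_
    exact (memLp_congr_ae (Lp.coeFn_add a b)).2 (ha.add hb)
  | isClosed => exact isClosed_closure

/-- Elements of the mixed space that are integrable functions with values in `L²` are dense. -/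
theorem mem_closure_integrable [Fact (1 ≤ p)] [Fact (1 ≤ k)] (hp : p ≠ ∞) (hk : k ≠ ∞)
    (F : MixedLp μ p k) : F ∈ closure {F : MixedLp μ p k | ∃ G : ℝ → Lp ℂ 2 μ, Integrable G ∧
      ∀ᵐ s : ℝ, (F s : X → ℂ) =ᵐ[μ] G s} := by
  induction F using Lp.induction hp with
  | @indicatorConst c s hs hμs =>
    rw [Lp.simpleFunc.coe_indicatorConst]
    have hcont : Continuous fun c : Lp ℂ k μ =>
        (indicatorConstLp p hs hμs.ne c : MixedLp μ p k) := by
      refine (LipschitzWith.of_dist_le_mul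
        (K := ⟨(volume.real s) ^ (1 / p.toReal), by positivity⟩) fun a b => ?_).continuous
      rw [dist_eq_norm, dist_eq_norm, mul_comm, indicatorConstLp_sub]
      exact norm_indicatorConstLp_le
    refine map_mem_closure hcont (mem_closure_memLp_two hk c) fun c hc => ?_
    refine ⟨s.indicator fun _ => hc.toLp c, (integrable_indicator_iff hs).2
      (integrableOn_const hμs.ne), ?_⟩
    filter_upwards [indicatorConstLp_coeFn (p := p) (hs := hs) (hμs := hμs.ne) (c := c)] with t ht
    rw [ht]
    by_cases hts : t ∈ s
    · simp only [hts, indicator_of_mem]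
      exact hc.coeFn_toLp.symm
    · simp only [hts, not_false_eq_true, indicator_of_notMem]
      exact (Lp.coeFn_zero _ _ _).trans (Lp.coeFn_zero _ _ _).symm
  | @add f g hf hg _ h1 h2 =>
    refine map_mem_closure₂ continuous_add h1 h2 ?_
    rintro a ⟨a', ha', ha⟩ b ⟨b', hb', hb⟩
    refine ⟨a' + b', ha'.add hb', ?_⟩
    filter_upwards [ha, hb, Lp.coeFn_add a b] with s h3 h4 h5
    rw [h5]
    exact (Lp.coeFn_add _ _).trans ((h3.add h4).trans (Lp.coeFn_add _ _).symm)
  | isClosed => exact isClosed_closure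

variable {H : Type*} [NormedAddCommGroup H] [InnerProductSpace ℂ H] [CompleteSpace H]
variable [Fact (1 ≤ p)] [Fact (1 ≤ k)] [Fact (1 ≤ r)] [ENNReal.HolderConjugate k r]
  [ENNReal.HolderConjugate p q] {C σ : ℝ} {A D : ℝ → H →L[ℂ] Lp ℂ 2 μ}

/-- The retarded evolution of an element of the mixed space. -/
noncomputable def retarded (A D : ℝ → H →L[ℂ] Lp ℂ 2 μ) (F : MixedLp μ p k) (t : ℝ) : Lp ℂ 2 μ :=
  A t (weakIntegral D (Iio t) F)

theorem IsDispersive.norm_retarded_le (hσ : 1 < σ) (h : SharpAdmissible σ q r)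
    (hA : IsDispersive C σ A) (hD : IsDispersive C σ D) (F : MixedLp μ p k) (t : ℝ) :
    ‖retarded A D F t‖ ≤ C * homogeneousConst C σ * ‖F‖ := by
  have hC := hA.one_le
  have hK := (homogeneousConst_pos hσ hC).le
  refine (hA.norm_apply_le t _).trans ?_
  rw [mul_assoc]
  gcongr
  have h1 := hD.enorm_weakIntegral_le hσ h (Iio t) F
  rw [← ofReal_norm F, ← ENNReal.ofReal_mul hK, ← ofReal_norm] at h1
  exact (ENNReal.ofReal_le_ofReal_iff (by positivity)).1 h1

theorem IsDispersive.retarded_add (hσ : 1 < σ) (h : SharpAdmissible σ q r)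
    (hD : IsDispersive C σ D) (F G : MixedLp μ p k) (t : ℝ) :
    retarded A D (F + G) t = retarded A D F t + retarded A D G t := by
  rw [retarded, hD.weakIntegral_add hσ h, map_add]; rfl

theorem IsDispersive.retarded_smul (hσ : 1 < σ) (h : SharpAdmissible σ q r)
    (hD : IsDispersive C σ D) (c : ℂ) (F : MixedLp μ p k) (t : ℝ) :
    retarded A D (c • F) t = c • retarded A D F t := by
  rw [retarded, hD.weakIntegral_smul hσ h, map_smul]; rfl

theorem IsDispersive.continuous_retarded (hσ : 1 < σ) (h : SharpAdmissible σ q r)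
    (hA : IsDispersive C σ A) (hD : IsDispersive C σ D) (t : ℝ) :
    Continuous fun F : MixedLp μ p k => retarded A D F t :=
  (LinearMap.mkContinuous (σ := RingHom.id ℂ)
    { toFun := fun F : MixedLp μ p k => retarded A D F t
      map_add' := fun F G => hD.retarded_add hσ h F G t
      map_smul' := fun c F => hD.retarded_smul hσ h c F t } _
    fun F => hA.norm_retarded_le hσ h hD F t).continuous

theorem IsDispersive.retarded_eq_duhamel (hσ : 1 < σ) (h : SharpAdmissible σ q r)
    (hD : IsDispersive C σ D) {F : MixedLp μ p k} {G : ℝ → Lp ℂ 2 μ} (hG : Integrable G)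
    (hFG : ∀ᵐ s : ℝ, (F s : X → ℂ) =ᵐ[μ] G s) :
    retarded A D F = duhamel D A {z | z.2 < z.1} G := by
  ext1 t
  rw [retarded, duhamel]
  congr 1
  have := hD.clm_weakIntegral hσ h (Iio t) F hFG (ContinuousLinearMap.id ℂ H)
    (by simpa using (hD.integrable_adjoint hG).integrableOn)
  simp only [ContinuousLinearMap.id_apply] at this
  exact this

theorem measurableSet_lt_snd_fst : MeasurableSet {z : ℝ × ℝ | z.2 < z.1} :=
  measurableSet_lt measurable_snd measurable_fst

theorem IsDispersive.enorm_integral_inner_retarded_le_of_integrable (hσ : 1 < σ)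
    (h : SharpAdmissible σ q r) (hA : IsDispersive C σ A) (hD : IsDispersive C σ D)
    (hAD : DispersiveBound C σ fun s t => A s ∘L ContinuousLinearMap.adjoint (D t))
    {F : MixedLp μ p k} {G : ℝ → Lp ℂ 2 μ} (hG : Integrable G)
    (hFG : ∀ᵐ s : ℝ, (F s : X → ℂ) =ᵐ[μ] G s) {G' : ℝ → Lp ℂ 2 μ} (hG' : Integrable G')
    {b : ℝ≥0∞} (hb : b = ENNReal.ofReal (advancedConst C σ) *
      (∫⁻ t, eLpNorm (G' t) (ENNReal.ofReal (endpointExp σ)) μ ^ 2) ^ (1 / 2 : ℝ))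
    (hb' : b ≠ ∞) :
    ‖∫ t, inner ℂ (G' t) (retarded A D F t)‖ₑ ≤ ‖F‖ₑ * b := by
  have hW := measurableSet_lt_snd_fst.preimage measurable_swap
  obtain ⟨h1, h2⟩ := hA.duhamel_bounds hσ hD hAD hW hG' hb
  obtain ⟨J, hJ, hle⟩ := h.exists_mixedLp hσ (hA.aestronglyMeasurable_duhamel hD hW hG') hb' h1 h2
  rw [hD.retarded_eq_duhamel hσ h hG hFG,
    integral_inner_duhamel hD hA measurableSet_lt_snd_fst hG hG', integral_prod_inner_swap
      (a := fun t => ContinuousLinearMap.adjoint (A t) (G' t))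
      (b := fun s => ContinuousLinearMap.adjoint (D s) (G s)),
    ← integral_inner_duhamel hA hD hW hG' hG]
  have h3 : ∫ s, inner ℂ (G s) (duhamel A D (Prod.swap ⁻¹' {z : ℝ × ℝ | z.2 < z.1}) G' s) =
      ∫ s, innerPairing μ k r (F s) (J s) := by
    refine integral_congr_ae ?_
    filter_upwards [hFG, hJ] with s h4 h5
    rw [innerPairing_apply, L2.inner_def]
    refine integral_congr_ae ?_
    filter_upwards [h4, h5] with x h6 h7
    rw [h6, h7]
  rw [h3]
  refine (enorm_integral_le_lintegral_enorm _).trans ((lintegral_enorm_pairing_le F J).trans ?_)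
  gcongr

theorem IsDispersive.aestronglyMeasurable_retarded_and_le (hσ : 1 < σ)
    (h : SharpAdmissible σ q r) (hA : IsDispersive C σ A) (hD : IsDispersive C σ D)
    (hAD : DispersiveBound C σ fun s t => A s ∘L ContinuousLinearMap.adjoint (D t))
    (hp : p ≠ ∞) (hk : k ≠ ∞) (F : MixedLp μ p k) :
    AEStronglyMeasurable (retarded A D F) ∧ ∀ {G' : ℝ → Lp ℂ 2 μ}, Integrable G' → ∀ {b : ℝ≥0∞},
      b = ENNReal.ofReal (advancedConst C σ) *
        (∫⁻ t, eLpNorm (G' t) (ENNReal.ofReal (endpointExp σ)) μ ^ 2) ^ (1 / 2 : ℝ) → b ≠ ∞ →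
      ‖∫ t, inner ℂ (G' t) (retarded A D F t)‖ₑ ≤ ‖F‖ₑ * b := by
  obtain ⟨f, hf, hlim⟩ := mem_closure_iff_seq_limit.1 (mem_closure_integrable hp hk F)
  choose G hG hFG using hf
  have hmeas : ∀ n, AEStronglyMeasurable (retarded A D (f n)) := fun n => by
    rw [hD.retarded_eq_duhamel hσ h (hG n) (hFG n)]
    exact hD.aestronglyMeasurable_duhamel hA measurableSet_lt_snd_fst (hG n)
  have htend : ∀ t, Tendsto (fun n => retarded A D (f n) t) atTop (𝓝 (retarded A D F t)) :=
    fun t => ((hA.continuous_retarded hσ h hD t).tendsto F).comp hlim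
  refine ⟨aestronglyMeasurable_of_tendsto_ae atTop hmeas (Eventually.of_forall htend), ?_⟩
  intro G' hG' b hb hb'
  have hC := hA.one_le
  have hK := (homogeneousConst_pos hσ hC).le
  have hint : Tendsto (fun n => ∫ t, inner ℂ (G' t) (retarded A D (f n) t)) atTop
      (𝓝 (∫ t, inner ℂ (G' t) (retarded A D F t))) := by
    refine tendsto_integral_filter_of_dominated_convergence
      (fun t => ‖G' t‖ * (C * homogeneousConst C σ * (‖F‖ + 1)))
      (Eventually.of_forall fun n => hG'.aestronglyMeasurable.inner (hmeas n)) ?_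
      (hG'.norm.mul_const _) (Eventually.of_forall fun t => tendsto_const_nhds.inner (htend t))
    have h1 : ∀ᶠ n in atTop, ‖f n‖ ≤ ‖F‖ + 1 :=
      (hlim.norm.eventually_lt_const (lt_add_one _)).mono fun n hn => hn.le
    filter_upwards [h1] with n hn
    refine Eventually.of_forall fun t => (norm_inner_le_norm _ _).trans ?_
    gcongr
    refine (hA.norm_retarded_le hσ h hD (f n) t).trans ?_
    gcongr
  refine le_of_tendsto_of_tendsto hint.enorm
    (ENNReal.Tendsto.mul_const hlim.enorm (Or.inr hb')) (Eventually.of_forall fun n => ?_)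
  exact hA.enorm_integral_inner_retarded_le_of_integrable hσ h hD hAD (hG n) (hFG n) hG' hb hb'

theorem IsDispersive.lintegral_eLpNorm_retarded_sq_le (hσ : 1 < σ)
    (h : SharpAdmissible σ q r) (hA : IsDispersive C σ A) (hD : IsDispersive C σ D)
    (hAD : DispersiveBound C σ fun s t => A s ∘L ContinuousLinearMap.adjoint (D t))
    (hp : p ≠ ∞) (hk : k ≠ ∞) (F : MixedLp μ p k) :
    ∫⁻ t, eLpNorm (retarded A D F t) (ENNReal.ofReal (keelTaoExp σ)) μ ^ 2 ≤
      (ENNReal.ofReal (2 * advancedConst C σ) * ‖F‖ₑ) ^ 2 := by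
  obtain ⟨hm, hle⟩ := hA.aestronglyMeasurable_retarded_and_le hσ h hD hAD hp hk F
  refine (lintegral_eLpNorm_sq_le_of_forall (two_lt_keelTaoExp hσ) one_pos
    (S := (ENNReal.ofReal (advancedConst C σ) * ‖F‖ₑ) ^ 2) hm
    (hA.norm_retarded_le hσ h hD F) fun G hG => ?_).trans (le_of_eq ?_)
  · rw [keelTaoExp_conj hσ, ENNReal.ofReal_one, one_mul]
    set N := ∫⁻ t, eLpNorm (G t) (ENNReal.ofReal (endpointExp σ)) μ ^ 2 with hN
    rcases eq_or_ne N ∞ with hT | hT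
    · simp [hT]
    · have hN2 : (N ^ (1 / 2 : ℝ)) ^ 2 = N := by
        rw [← ENNReal.rpow_natCast, ← ENNReal.rpow_mul]; norm_num
      refine (hle hG rfl (ENNReal.mul_ne_top ENNReal.ofReal_ne_top
        (ENNReal.rpow_ne_top_of_nonneg (by norm_num) hT))).trans ?_
      calc _ = N ^ (1 / 2 : ℝ) * (ENNReal.ofReal (advancedConst C σ) * ‖F‖ₑ) := by
            rw [← hN]; ring
        _ ≤ (N ^ (1 / 2 : ℝ)) ^ 2 + (ENNReal.ofReal (advancedConst C σ) * ‖F‖ₑ) ^ 2 :=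
            ENNReal.mul_le_sq_add_sq _ _
        _ = _ := by rw [hN2]
  · rw [ENNReal.ofReal_mul zero_le_two, mul_one, ENNReal.ofReal_ofNat, ENNReal.ofReal_ofNat]
    ring

/-- The constant of the retarded Strichartz estimate. -/
noncomputable def retardedConst (C σ : ℝ) : ℝ := C * homogeneousConst C σ + 2 * advancedConst C σ

theorem advancedConst_pos (hσ : 1 < σ) (hC : 1 ≤ C) : 0 < advancedConst C σ := by
  have := bilinearConst_pos hσ hC
  unfold advancedConst
  positivity

theorem IsDispersive.retardedStrichartz {q₁ r₁ : ℝ≥0∞} [Fact (1 ≤ q₁)] [Fact (1 ≤ r₁)]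
    (hσ : 1 < σ) (h : SharpAdmissible σ q r) (h₁ : SharpAdmissible σ q₁ r₁)
    (hA : IsDispersive C σ A) (hD : IsDispersive C σ D)
    (hAD : DispersiveBound C σ fun s t => A s ∘L ContinuousLinearMap.adjoint (D t))
    (hp : p ≠ ∞) (hk : k ≠ ∞) :
    RetardedStrichartz A (fun s => ContinuousLinearMap.adjoint (D s)) q₁ r₁ p k
      (retardedConst C σ) := by
  have hC := hA.one_le
  have hK := homogeneousConst_pos hσ hC
  have hL := advancedConst_pos hσ hC
  have hR : 0 ≤ retardedConst C σ := by unfold retardedConst; positivity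
  have hex : ∀ F : MixedLp μ p k, ∃ v : MixedLp μ q₁ r₁,
      (∀ᵐ t : ℝ, (v t : X → ℂ) =ᵐ[μ] retarded A D F t) ∧
        ‖v‖ₑ ≤ ENNReal.ofReal (retardedConst C σ) * ‖F‖ₑ := fun F => by
    refine h₁.exists_mixedLp hσ
      (hA.aestronglyMeasurable_retarded_and_le hσ h hD hAD hp hk F).1 (by finiteness)
      (fun t => ?_) ((hA.lintegral_eLpNorm_retarded_sq_le hσ h hD hAD hp hk F).trans ?_)
    · rw [← ofReal_norm, ← ofReal_norm F, ← ENNReal.ofReal_mul hR]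
      refine ENNReal.ofReal_le_ofReal ((hA.norm_retarded_le hσ h hD F t).trans ?_)
      gcongr
      unfold retardedConst
      linarith
    · gcongr
      unfold retardedConst
      have : 0 ≤ C * homogeneousConst C σ := by positivity
      linarith
  choose T hT hle using hex
  have hle' : ∀ F, ‖T F‖ ≤ retardedConst C σ * ‖F‖ := fun F => by
    have h1 := hle F
    rw [← ofReal_norm F, ← ENNReal.ofReal_mul hR] at h1
    rw [Lp.norm_def, ← Lp.enorm_def]
    exact ENNReal.toReal_le_of_le_ofReal (by positivity) h1
  refine ⟨LinearMap.mkContinuous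
    { toFun := T
      map_add' := fun F G => ?_
      map_smul' := fun c F => ?_ } (retardedConst C σ) hle', fun F G hFG => ?_, hle'⟩
  · refine Lp.ext ?_
    filter_upwards [hT F, hT G, hT (F + G), Lp.coeFn_add (T F) (T G)] with t h1 h2 h3 h4
    rw [h4]
    refine Lp.ext (h3.trans ?_)
    rw [hD.retarded_add hσ h]
    exact (Lp.coeFn_add _ _).trans ((h1.add h2).symm.trans (Lp.coeFn_add _ _).symm)
  · refine Lp.ext ?_
    filter_upwards [hT F, hT (c • F), Lp.coeFn_smul c (T F)] with t h1 h3 h4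
    rw [RingHom.id_apply, h4]
    refine Lp.ext (h3.trans ?_)
    rw [hD.retarded_smul hσ h]
    exact (Lp.coeFn_smul _ _).trans ((h1.const_smul c).symm.trans (Lp.coeFn_smul _ _).symm)
  · filter_upwards [hT F] with t ht hint
    have h1 := hD.clm_weakIntegral hσ h (Iio t) F hFG (A t) hint
    rw [retarded, h1] at ht
    exact ht

end Retarded

section Monotone

variable {X : Type*} [MeasurableSpace X] {μ : Measure X}
variable {H : Type*} [NormedAddCommGroup H] [InnerProductSpace ℂ H]

theorem DispersiveBound.mono {C C' σ : ℝ} (h : C ≤ C') {A : ℝ → ℝ → Lp ℂ 2 μ →L[ℂ] Lp ℂ 2 μ}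
    (hA : DispersiveBound C σ A) : DispersiveBound C' σ A := fun s t hst f hf =>
  (hA s t hst f hf).trans (by gcongr)

theorem HomogeneousStrichartz.mono {A : ℝ → H →L[ℂ] Lp ℂ 2 μ} {q r : ℝ≥0∞} [Fact (1 ≤ r)]
    {C C' : ℝ} (h : C ≤ C') (hA : HomogeneousStrichartz A q r C) :
    HomogeneousStrichartz A q r C' := fun f =>
  let ⟨u, hu, hle⟩ := hA f
  ⟨u, hu, hle.trans (by gcongr)⟩

theorem DualStrichartz.mono {B : ℝ → Lp ℂ 2 μ →L[ℂ] H} {p k : ℝ≥0∞} [Fact (1 ≤ p)]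
    [Fact (1 ≤ k)] {C C' : ℝ} (h : C ≤ C') (hB : DualStrichartz B p k C) :
    DualStrichartz B p k C' :=
  let ⟨T, hT, hle⟩ := hB
  ⟨T, hT, fun F => (hle F).trans (by gcongr)⟩

theorem RetardedStrichartz.mono {A : ℝ → H →L[ℂ] Lp ℂ 2 μ} {B : ℝ → Lp ℂ 2 μ →L[ℂ] H}
    {q r p k : ℝ≥0∞} [Fact (1 ≤ q)] [Fact (1 ≤ r)] [Fact (1 ≤ p)] [Fact (1 ≤ k)]
    {C C' : ℝ} (h : C ≤ C') (hB : RetardedStrichartz A B q r p k C) :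
    RetardedStrichartz A B q r p k C' :=
  let ⟨T, hT, hle⟩ := hB
  ⟨T, hT, fun F => (hle F).trans (by gcongr)⟩

theorem holderConjugate_ne_top {q q' : ℝ≥0∞} (hq : 2 ≤ q)
    (h : ENNReal.HolderConjugate q q') : q' ≠ ∞ := by
  rintro rfl
  have h1 := ENNReal.HolderConjugate.inv_add_inv_eq_one q ∞
  simp only [ENNReal.inv_top, add_zero, ENNReal.inv_eq_one] at h1
  rw [h1] at hq
  norm_num at hq

end Monotone

theorem mainTheorem6 (σ : ℝ) (hσ : 1 < σ) (C : ℝ)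
    (q r q₁ r₁ q' r' q₁' r₁' : ℝ≥0∞)
    (hqr : SharpAdmissible σ q r) (hqr₁ : SharpAdmissible σ q₁ r₁)
    (hq' : ENNReal.HolderConjugate q q') (hr' : ENNReal.HolderConjugate r r')
    (hq₁' : ENNReal.HolderConjugate q₁ q₁') (hr₁' : ENNReal.HolderConjugate r₁ r₁')
    [Fact (1 ≤ q)] [Fact (1 ≤ r)] [Fact (1 ≤ q')] [Fact (1 ≤ r')]
    [Fact (1 ≤ q₁')] [Fact (1 ≤ r₁')] :
    ∃ K : ℝ, ∀ (X : Type*) [MeasurableSpace X] (μ : Measure X)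
      (H : Type*) [NormedAddCommGroup H] [InnerProductSpace ℂ H] [CompleteSpace H]
      (U : ℝ → H →L[ℂ] Lp ℂ 2 μ) (V : ℝ → Lp ℂ 2 μ →L[ℂ] H),
      (∀ f : H, AEStronglyMeasurable (fun t : ℝ => U t f) volume) →
      (∀ g : Lp ℂ 2 μ, AEStronglyMeasurable
        (fun t : ℝ => ContinuousLinearMap.adjoint (U t) g) volume) →
      (∀ g : Lp ℂ 2 μ, AEStronglyMeasurable (fun t : ℝ => V t g) volume) →
      (∀ f : H, AEStronglyMeasurable
        (fun t : ℝ => ContinuousLinearMap.adjoint (V t) f) volume) →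
      (∀ (t : ℝ) (f : H), ‖U t f‖ ≤ C * ‖f‖) →
      (∀ (t : ℝ) (g : Lp ℂ 2 μ), ‖V t g‖ ≤ C * ‖g‖) →
      DispersiveBound C σ (fun s t => U s ∘L V t) →
      DispersiveBound C σ (fun s t => U s ∘L ContinuousLinearMap.adjoint (U t)) →
      DispersiveBound C σ (fun s t => ContinuousLinearMap.adjoint (V s) ∘L V t) →
      (HomogeneousStrichartz U q r K ∧
        DualStrichartz (fun s => ContinuousLinearMap.adjoint (U s)) q' r' K ∧
        RetardedStrichartz U (fun s => ContinuousLinearMap.adjoint (U s)) q r q₁' r₁' K) ∧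
      (HomogeneousStrichartz (fun t => ContinuousLinearMap.adjoint (V t)) q r K ∧
        DualStrichartz V q' r' K ∧
        RetardedStrichartz (fun t => ContinuousLinearMap.adjoint (V t)) V q r q₁' r₁' K) ∧
      RetardedStrichartz U V q r q₁' r₁' K := by

  have : Fact (1 ≤ r₁) := ⟨one_le_two.trans hqr₁.2.1⟩
  have := hq'.symm
  have := hr'.symm
  have := hq₁'.symm
  have := hr₁'.symm
  have hq₁t := holderConjugate_ne_top hqr₁.1 hq₁'
  have hr₁t := holderConjugate_ne_top hqr₁.2.1 hr₁'
  set c := max C 1 with hc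
  have hCc : C ≤ c := le_max_left _ _
  have hc1 : 1 ≤ c := le_max_right _ _
  refine ⟨max (homogeneousConst c σ) (retardedConst c σ), ?_⟩
  intro X _ μ H _ _ _ U V hU hU' hV hV' hUb hVb hUV hUU hVV
  have hh := le_max_left (homogeneousConst c σ) (retardedConst c σ)
  have hr := le_max_right (homogeneousConst c σ) (retardedConst c σ)
  have hVb' : ∀ t f, ‖ContinuousLinearMap.adjoint (V t) f‖ ≤ c * ‖f‖ := fun t f => by
    refine ContinuousLinearMap.le_of_opNorm_le _ ?_ f
    rw [LinearIsometryEquiv.norm_map]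
    exact ContinuousLinearMap.opNorm_le_bound _ (zero_le_one.trans hc1)
      fun g => (hVb t g).trans (by gcongr)
  have hDU : IsDispersive c σ U :=
    ⟨hc1, hU, hU', fun t f => (hUb t f).trans (by gcongr), hUU.mono hCc⟩
  have hDV : IsDispersive c σ fun t => ContinuousLinearMap.adjoint (V t) :=
    ⟨hc1, hV', by simpa using hV, hVb', by simpa using hVV.mono hCc⟩
  have hDUV : DispersiveBound c σ fun s t => U s ∘L
      ContinuousLinearMap.adjoint (ContinuousLinearMap.adjoint (V t)) := by
    simpa using hUV.mono hCc
  have h1 := hDV.dualStrichartz (p := q') (k := r') hσ hqr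
  have h2 := hDV.retardedStrichartz (p := q₁') (k := r₁') hσ hqr₁ hqr hDV hDV.dispersive hq₁t hr₁t
  have h3 := hDU.retardedStrichartz (p := q₁') (k := r₁') hσ hqr₁ hqr hDV hDUV hq₁t hr₁t
  simp only [ContinuousLinearMap.adjoint_adjoint] at h1 h2 h3
  exact ⟨⟨(hDU.homogeneousStrichartz hσ hqr).mono hh, (hDU.dualStrichartz hσ hqr).mono hh,
    (hDU.retardedStrichartz hσ hqr₁ hqr hDU hDU.dispersive hq₁t hr₁t).mono hr⟩,
    ⟨(hDV.homogeneousStrichartz hσ hqr).mono hh, h1.mono hh, h2.mono hr⟩, h3.mono hr⟩
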